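/- Let $d\geqslant 3$, and let $x^1,\dots,x^d$ be Cartesian coordinates on $\mathbb R^d$. For a vector field $\vec X$ and a multivector field $F$ write $[\![F,\vec X]\!]=-L_{\vec X}F$ for their Schouten bracket, and let $\partial_{\boldsymbol x}=\partial_{x^1}\wedge\dots\wedge\partial_{x^d}$. All functions and fields are $C^\infty$. For functions $\varrho,a_1,\dots,a_{d-2}$ on $\mathbb R^d$, let $P=P(\varrho,[\boldsymbol a])$ be the Nambu–Poisson bi-vector of the bracket $$\{f,g\}=\varrho\cdot\det\bigl(\partial(f,g,a_1,\dots,a_{d-2})/\partial(x^1,\dots,x^d)\bigr).$$ *Graph flow.* Let $\gamma_3$ be the tetrahedron (the full graph on four vertices) with a fixed ordering $e_1\wedge\dots\wedge e_6$ of its edges, and let $\mathrm{Or}(\gamma_3)$ be Kontsevich's edge orientation morphism. For four multivector fields of degree $0$ or $2$ placed in the vertices, $\mathrm{Or}(\gamma_3)(F_0\otimes\dots\otimes F_3)$ is the sum over all directions of the six edges, and over all ways of issuing one extra arrow to each of the required number of ordered sinks, such that the number of arrows leaving each vertex is the degree of the field in it. An arrow with index $i$ (summed from $1$ to $d$) acts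 by $\partial/\partial x^i$ on the content of its head and is an argument of the multivector in its tail. The arrows leaving a vertex are ordered as in $e_1\wedge\dots\wedge e_6\wedge(\text{sink arrows})$, and the sign is that of the permutation collecting the arrows by their tails. Put $Q(P)=\mathrm{Or}(\gamma_3)(P\otimes P\otimes P\otimes P)$ and $$\dot a_i=\mathrm{Or}(\gamma_3)(a_i\otimes P\otimes P\otimes P)+\mathrm{Or}(\gamma_3)(P\otimes a_i\otimes P\otimes P)+\mathrm{Or}(\gamma_3)(P\otimes P\otimes a_i\otimes P)+\mathrm{Or}(\gamma_3)(P\otimes P\otimes P\otimes a_i).$$ *Micro-graphs.* A $1$-vector Nambu micro-graph over dimension $d$ built of $n$ Nambu graphs has one sink, $n$ Levi-Civita vertices, and for each of these its own $d-2$ Casimir vertices (containing $a_1,\dots,a_{d-2}$). From each Levi-Civita vertex (containing $\varrho\,\varepsilon^{i_1\dots i_d}$) run $d$ ordered arrows, decorated by the indices $i_1,\dots,i_d$. The first two have arbitrary targets, and the remaining $d-2$ head to its own Casimirs in their order. Exactly one arrow heads to the sink. The micro-graph encodes the vector field whose $i$th component is the sum over all indices, with index $i$ on the arrow to the sink, of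 the product of the contents of the vertices, each differentiated along its incoming arrows. **Statement.** 1. Let $d\geqslant 3$ and let $\vec X$ be a vector field, $a$ a function and $\varrho\,\partial_{\boldsymbol x}$ a $d$-vector field on $\mathbb R^d$. Along $\vec Y=-\vec X$ they evolve by $\dot a=(-\vec X)(a)$ and $\dot\varrho\,\partial_{\boldsymbol x}=[\![\varrho\,\partial_{\boldsymbol x},\vec X]\!]$. That is, if $\Phi_\varepsilon$ is a smooth family of maps, defined near a point for small $\varepsilon$, with $\Phi_0=\mathrm{id}$ and velocity $\vec Y$ at $\varepsilon=0$, then these are the derivatives at $\varepsilon=0$, at that point, of the pullbacks $\Phi_\varepsilon^*a$ and $\Phi_\varepsilon^*(\varrho\,\partial_{\boldsymbol x})$. 2. Let $d=3$ or $d=4$. There is a differential polynomial $\dot\varrho$ in $\varrho,a_1,\dots,a_{d-2}$ with constant real coefficients such that, identically in $\varrho,\boldsymbol a,f,g$, $$\Bigl(Q(P)-\sum_{i=1}^{d-2}P\bigl(\varrho,[a_1],\dots,[\dot a_i],\dots,[a_{d-2}]\bigr)\Bigr)(f,g)=\dot\varrho\cdot\det\bigl(\partial(f,g,a_1,\dots,a_{d-2})/\partial(x^1,\dots,x^d)\bigr).$$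 There is a real linear combination, with coefficients independent of $\varrho,\boldsymbol a$, of $1$-vector Nambu micro-graphs built of three Nambu graphs which encodes vector fields $\vec X=\vec X^{\gamma_3}_d([\varrho],[\boldsymbol a])$ trivialising the tetrahedral flow: $$Q(P)=[\![P,\vec X]\!]\quad\text{for all }\varrho,a_1,\dots,a_{d-2}.$$ Every such linear combination that trivialises the flow for all $\varrho,\boldsymbol a$ satisfies, for all $\varrho,\boldsymbol a$, $$\dot a_i=(-\vec X)(a_i)\quad(1\leqslant i\leqslant d-2)\qquad\text{and}\qquad \dot\varrho\,\partial_{\boldsymbol x}=[\![\varrho\,\partial_{\boldsymbol x},\vec X]\!].$$ -/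

import Mathlib

open scoped ContDiff Topology

noncomputable section

namespace NambuFlow

/-! ## Multivector fields on `ℝᵈ` in Cartesian coordinates -/

/-- The affine space `ℝᵈ` with its Cartesian coordinates. -/
abbrev Space (d : ℕ) : Type := Fin d → ℝ

/-- Scalar functions on `ℝᵈ`. -/
abbrev Scalar (d : ℕ) : Type := Space d → ℝ

/-- Vector fields `X = ∑ᵢ Xⁱ ∂ᵢ` on `ℝᵈ`, given by their components. -/
abbrev VField (d : ℕ) : Type := Fin d → Scalar d

/-- Multivector fields on `ℝᵈ`, given by their components on multi-indices: a `k`-vector field has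
its (totally antisymmetric) components `F [i₁, …, iₖ]` on the multi-indices of length `k`, and
zero components on all other multi-indices. -/
abbrev MField (d : ℕ) : Type := List (Fin d) → Scalar d

variable {d : ℕ}

/-- The partial derivative `∂f/∂xⁱ`. -/
def pd (i : Fin d) (f : Scalar d) : Scalar d := fun x => fderiv ℝ f x (Pi.single i 1)

/-- The iterated partial derivative of `f` along all indices in the list `J`. -/
def pds (J : List (Fin d)) (f : Scalar d) : Scalar d := J.foldr pd f

/-- The derivative `X(f) = ∑ᵢ Xⁱ ∂f/∂xⁱ` of a function along a vector field. -/
def VField.act (X : VField d) (f : Scalar d) : Scalar d := fun x => ∑ i, X i x * pd i f x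

/-- A scalar function as a `0`-vector field. -/
def scalarField (f : Scalar d) : MField d
  | [] => f
  | _ => 0

/-- The Levi-Civita symbol `ε^{i₁…i_d}`. -/
def leviCivita (I : Fin d → Fin d) : ℝ :=
  Matrix.det (Matrix.of fun s t : Fin d => if I s = t then (1 : ℝ) else 0)

/-- The `d`-vector field `ϱ ∂ₓ = ϱ ∂₁ ∧ … ∧ ∂_d`. -/
def topField (ϱ : Scalar d) : MField d := fun I x =>
  if h : I.length = d then ϱ x * leviCivita (fun s : Fin d => I.get (s.cast h.symm)) else 0

/-- The Schouten bracket `⟦F, X⟧` of a multivector field `F` with a vector field `X`, that is, minus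
the Lie derivative of `F` along `X`. -/
def schouten (F : MField d) (X : VField d) : MField d := fun I x =>
  (∑ s : Fin I.length, ∑ l : Fin d, F (I.set s l) x * pd l (X (I.get s)) x)
    - ∑ l : Fin d, X l x * pd l (F I) x

/-- The Jacobian matrix of a map `ℝᵈ → ℝᵈ` at a point. -/
def jacobianMatrix (φ : Space d → Space d) (x : Space d) : Matrix (Fin d) (Fin d) ℝ :=
  Matrix.of fun i j => pd j (fun y => φ y i) x

/-- The pullback `φ^* F = (φ⁻¹)_* F` of a multivector field by a (local) diffeomorphism `φ`. -/
def pullback (φ : Space d → Space d) (F : MField d) : MField d := fun I x =>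
  ∑ J : Fin I.length → Fin d,
    F (List.ofFn J) (φ x) * ∏ s : Fin I.length, (jacobianMatrix φ x)⁻¹ (I.get s) (J s)

/-! ## Nambu-determinant Poisson brackets on `ℝ^{m+2}` with Casimirs `a₁, …, aₘ` -/

/-- The Jacobian determinant `det (∂(u₁,…,u_d)/∂(x¹,…,x^d))`. -/
def jacobian (u : Fin d → Scalar d) : Scalar d := fun x =>
  Matrix.det (Matrix.of fun i j : Fin d => pd j (u i) x)

variable {m : ℕ}

/-- `det (∂(f,g,a₁,…,aₘ)/∂(x¹,…,x^{m+2}))`. -/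
def nambuDet (a : Fin m → Scalar (m + 2)) (f g : Scalar (m + 2)) : Scalar (m + 2) :=
  jacobian (Fin.cons f (Fin.cons g a : Fin (m + 1) → Scalar (m + 2)) :
    Fin (m + 2) → Scalar (m + 2))

/-- The Nambu-determinant bracket `{f,g} = ϱ · det (∂(f,g,a₁,…,aₘ)/∂(x¹,…,x^{m+2}))`. -/
def nambuBracket (ϱ : Scalar (m + 2)) (a : Fin m → Scalar (m + 2)) (f g : Scalar (m + 2)) :
    Scalar (m + 2) :=
  fun x => ϱ x * nambuDet a f g x

/-- The Nambu bi-vector `P(ϱ,[a])`, with components `P^{ij} = {xⁱ, xʲ}`. -/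
def nambuBivector (ϱ : Scalar (m + 2)) (a : Fin m → Scalar (m + 2)) : MField (m + 2)
  | [i, j] => nambuBracket ϱ a (fun x => x i) (fun x => x j)
  | _ => 0

/-- The value `F(f,g) = ∑ F^{ij} ∂ᵢf ∂ⱼg` of a bi-vector on two functions. -/
def bivectorApply (F : MField d) (f g : Scalar d) : Scalar d := fun x =>
  ∑ i, ∑ j, F [i, j] x * pd i f x * pd j g x

/-! ## The edge orientation morphism -/

/-- The edge orientation morphism `Or(γ)(F₀ ⊗ … ⊗ F_{n-1})` for a graph `γ` on vertices
`0, …, n-1` with edges `E 0 ∧ … ∧ E (k-1)`, evaluated at multivector fields `F v` of even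
degree. The component on the multi-index `I` is obtained by adding `I.length` sinks, with exactly
one arrow, decorated by the respective index from `I`, into each. One sums over the directions `o`
of all edges of `γ`, over the tails `w` of the arrows into the sinks, and over all indices `α` on
the edges of `γ`. An arrow with index `i` differentiates the content of its head by `∂/∂xⁱ` and is
an argument of the multivector in its tail; the outgoing arrows at every vertex are ordered as they
are in `E 0 ∧ … ∧ E (k-1) ∧ sinks`, and the sign is that of the permutation which collects the
arrows of this wedge product by their tails. (As `F v` vanishes on multi-indices of the wrong
length, only those graphs contribute in which the number of arrows from `v` is the degree of
`F v`.) -/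
def orientGraph {n k : ℕ} (E : Fin k → Fin n × Fin n) (F : Fin n → MField d) : MField d :=
  fun I x =>
    ∑ o : Fin k → Bool, ∑ w : Fin I.length → Fin n, ∑ α : Fin k → Fin d,
      let tail : Fin (k + I.length) → Fin n :=
        Fin.append (fun e => if o e then (E e).1 else (E e).2) w
      let head : Fin k → Fin n := fun e => if o e then (E e).2 else (E e).1
      let index : Fin (k + I.length) → Fin d := Fin.append α I.get
      let outgoing : Fin n → List (Fin d) := fun v =>
        ((List.finRange (k + I.length)).filter fun e => tail e = v).map index
      let incoming : Fin n → List (Fin d) := fun v =>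
        ((List.finRange k).filter fun e => head e = v).map α
      (∏ e : Fin (k + I.length), ∏ e' : Fin (k + I.length),
          if e < e' ∧ tail e' < tail e then (-1 : ℝ) else 1)
        * ∏ v : Fin n, pds (incoming v) (F v (outgoing v)) x

/-- The tetrahedron `γ₃`: the full graph on four vertices, with its edges ordered
lexicographically. -/
def tetrahedron : Fin 6 → Fin 4 × Fin 4 :=
  ![(0, 1), (0, 2), (0, 3), (1, 2), (1, 3), (2, 3)]

/-- The tetrahedral flow `Q^{γ₃}([P]) = Or(γ₃)(P ⊗ P ⊗ P ⊗ P)`. -/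
def tetraFlow (P : MField d) : MField d := orientGraph tetrahedron fun _ => P

/-- The velocity of a Casimir `a` given by the graph cocycle:
`Or(γ₃)(a ⊗ P ⊗ P ⊗ P) + Or(γ₃)(P ⊗ a ⊗ P ⊗ P) + … + Or(γ₃)(P ⊗ P ⊗ P ⊗ a)`. -/
def casimirVelocity (P : MField d) (a : Scalar d) : Scalar d :=
  ∑ s : Fin 4, orientGraph tetrahedron (Function.update (fun _ => P) s (scalarField a)) []

/-! ## Differential polynomials and the velocity of the density -/

/-- Differential polynomials in `ϱ, a₁, …, aₘ`, with constant coefficients: the variable `(none, J)`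
stands for `∂_J ϱ`, and `(some i, J)` stands for `∂_J aᵢ`. -/
abbrev DiffPoly (m : ℕ) : Type := MvPolynomial (Option (Fin m) × List (Fin (m + 2))) ℝ

/-- The value of a differential polynomial at given functions `ϱ` and `a₁, …, aₘ`. -/
def DiffPoly.value (R : DiffPoly m) (ϱ : Scalar (m + 2)) (a : Fin m → Scalar (m + 2)) :
    Scalar (m + 2) :=
  fun x => MvPolynomial.eval (fun q => pds q.2 (q.1.elim ϱ a) x) R

/-- `R` is the velocity of `ϱ` read from the tetrahedral flow: identically in `ϱ, a, f, g`, the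
differential polynomial `R` is the quotient of
`(Q([P]) - ∑ᵢ P(ϱ,[a₁],…,[ȧᵢ],…,[aₘ])) (f,g)` by `det (∂(f,g,a₁,…,aₘ)/∂(x¹,…,x^{m+2}))`. -/
def IsDensityVelocity (R : DiffPoly m) : Prop :=
  ∀ (ϱ : Scalar (m + 2)) (a : Fin m → Scalar (m + 2)) (f g : Scalar (m + 2)),
    ContDiff ℝ ∞ ϱ → (∀ i, ContDiff ℝ ∞ (a i)) → ContDiff ℝ ∞ f → ContDiff ℝ ∞ g →
    ∀ x, bivectorApply (tetraFlow (nambuBivector ϱ a)) f g x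
        - ∑ i, nambuBracket ϱ
            (Function.update a i (casimirVelocity (nambuBivector ϱ a) (a i))) f g x
      = R.value ϱ a x * nambuDet a f g x

/-! ## Vector fields encoded by Nambu micro-graphs -/

/-- The vertices of a micro-graph over one sink, built from `n` Nambu graphs over dimension
`m + 2`: the sink, the Levi-Civita vertices, and the vertices `(v, c)` with the Casimir `a_c`
of the `v`-th Nambu graph. -/
inductive Vertex (m n : ℕ) : Type
  | sink : Vertex m n
  | levi (v : Fin n) : Vertex m n
  | casimir (v : Fin n) (c : Fin m) : Vertex m n
  deriving DecidableEq

/-- `1`-vector Nambu micro-graphs built from `n` Nambu graphs over dimension `m + 2`: the first two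
arrows from every Levi-Civita vertex have arbitrary targets, and exactly one of these arrows heads
to the sink. -/
structure MicroGraph (m n : ℕ) : Type where
  target : Fin n → Fin 2 → Vertex m n
  existsUnique_sink : ∃! p : Fin n × Fin 2, target p.1 p.2 = Vertex.sink

variable {n : ℕ}

/-- The targets of all `m + 2` arrows from the `v`-th Levi-Civita vertex: the last `m` of them head
to the Casimirs `a₁, …, aₘ` of the same Nambu graph. -/
def MicroGraph.fullTarget (Γ : MicroGraph m n) (v : Fin n) : Fin (m + 2) → Vertex m n :=
  Fin.cons (Γ.target v 0) (Fin.cons (Γ.target v 1) (fun c => Vertex.casimir v c) :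
    Fin (m + 1) → Vertex m n)

/-- The list of those indices, among the indices `idx v k` on the arrows `(v, k)`, whose arrows head
to the vertex `u`. -/
def MicroGraph.incoming (Γ : MicroGraph m n) (idx : Fin n → Fin (m + 2) → Fin (m + 2))
    (u : Vertex m n) : List (Fin (m + 2)) :=
  ((List.finRange n ×ˢ List.finRange (m + 2)).filter
    fun q => Γ.fullTarget q.1 q.2 = u).map fun q => idx q.1 q.2

/-- The vector field `φ(Γ)` encoded by a micro-graph: the sum over all indices `idx v k` on the
arrows, with the index on the arrow into the sink being the index of the component; every vertex
contributes its content (`ϱ · ε` or a Casimir), differentiated along its incoming arrows. -/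
def MicroGraph.toVField (Γ : MicroGraph m n) (ϱ : Scalar (m + 2)) (a : Fin m → Scalar (m + 2)) :
    VField (m + 2) := fun i x =>
  ∑ idx : Fin n → Fin (m + 2) → Fin (m + 2),
    if Γ.incoming idx Vertex.sink = [i] then
      ∏ v : Fin n, (leviCivita (idx v) * pds (Γ.incoming idx (Vertex.levi v)) ϱ x
        * ∏ c : Fin m, pds (Γ.incoming idx (Vertex.casimir v c)) (a c) x)
    else 0

/-- The vector field encoded by a linear combination of micro-graphs. -/
def microField (c : MicroGraph m n →₀ ℝ) (ϱ : Scalar (m + 2)) (a : Fin m → Scalar (m + 2)) :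
    VField (m + 2) := fun i x =>
  c.sum fun Γ r => r * Γ.toVField ϱ a i x

/-- The linear combination `c` of micro-graphs encodes vector fields `X` which trivialise the
tetrahedral flow, `Q^{γ₃}([P]) = ⟦P, X⟧`, for all Nambu brackets `P = P(ϱ,[a])`. -/
def Trivialises (c : MicroGraph m n →₀ ℝ) : Prop :=
  ∀ (ϱ : Scalar (m + 2)) (a : Fin m → Scalar (m + 2)),
    ContDiff ℝ ∞ ϱ → (∀ i, ContDiff ℝ ∞ (a i)) →
    ∀ i j x, tetraFlow (nambuBivector ϱ a) [i, j] x
      = schouten (nambuBivector ϱ a) (microField c ϱ a) [i, j] x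

end NambuFlow

end

noncomputable section

namespace NambuFlow

/-! ## Formal expressions over a ring with derivations -/

section Expr

variable {A : Type*} [Add A] [Mul A] [Neg A] [Zero A] {V C : Type*}

/-! Everything rests on one explicit vector field and one uniqueness statement. Write the bracket as
ϱN, where N is the determinant in the gradients of the Casimirs. The tetrahedral flow is 8 times
`flow`, the velocity of a Casimir is 8 times `vel`, and 8`Y` is the field of an explicit combination
of micro-graphs (`tetraFlow_nambu`, `casimirVelocity_nambu`, `microField_trivialising`). What must
be shown is that `flow` plus the Lie derivative of ϱN along `Y` vanishes, and that `Y` applied to a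
Casimir is minus `vel` (`defect_eq_zero`, `casDefect_eq_zero`).

These are polynomial identities in 4-jets, and they are normalised before being expanded. The
expressions are contractions, so any pair of dual constant frames computes them
(`LinData.defect_congr`), and the determinant of the frame is absorbed by ϱ (`defect_scale`). At a
point where the gradients are independent and the Hessian of the first Casimir is positive definite,
`exists_adapted_frame` makes the gradients unit covectors and prescribes the second derivatives of
the first Casimir along two frame vectors. In dimension four it also diagonalises the second Hessian
on that plane; subtracting a multiple of the first Casimir from the second, which leaves the bracket
unchanged, kills one more entry. The remaining jets are treated as free variables, and the kernel
expands the identities as integer polynomials whose monomials are products of primes. The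
parametricity relation `DRel` carries the result from formal jets to smooth functions. Genericity is
then removed: along a + s·(generic functions) it holds for all large s, and a polynomial in s with
infinitely many zeros vanishes at s = 0 (`DiffPoly.value_eq_zero_of_generic`).

For the density, `schouten_nambu` gives ⟦ϱN, X⟧ = (ϱ div X − X(ϱ)) N − ϱ ∑ N(…, X(a_α), …). Since
the Casimirs move by −X(a_α), the Casimir terms cancel in the quotient, which leaves ϱ div X − X(ϱ).
By `schouten_topField` this is also the coefficient of the bracket of the top-degree field with X.

For an arbitrary trivialising combination, its difference Z from the explicit one preserves all
Nambu brackets. Contraction with gradients shows that Z(a_β) is a Casimir of N, hence constant along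
the Hamiltonian curves of N, which do not involve ϱ. But Z is local and vanishes wherever ϱ vanishes
nearby. Cutting ϱ off at the far end of a curve therefore gives Z(a_β) = 0 at its start
(`microAct_eq_zero_of_independent`), and then the density velocity of Z vanishes as well. So both
velocities are the same for every trivialising combination.

The general evolution law is the chain rule for functions. For top-degree fields the pullback
multiplies by the inverse Jacobian determinant, whose derivative at the identity is minus a trace.
-/

/-- Sum of `f` over a list, by structural recursion. -/
def lsum {ι : Type*} (l : List ι) (f : ι → A) : A := l.foldr (fun i a => f i + a) 0

namespace Expr

variable (l : List (V × C)) (D : V → A → A) (ρ : A) (N : C → C → A) (H : V → V → C → C → A)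

/-- The bivector `ϱ N`. -/
def P (i j : C) : A := ρ * N i j

/-- The cyclic contraction of three first derivatives of the bivector. -/
def T (k p m : C) : A :=
  lsum l fun q => lsum l fun r => D r.1 (P ρ N k q.2) *
    lsum l fun s => D s.1 (P ρ N p r.2) * D q.1 (P ρ N m s.2)

/-- The part of the tetrahedral flow with a third derivative. -/
def third (i j : C) : A :=
  lsum l fun k => lsum l fun p => lsum l fun m =>
    D k.1 (D p.1 (D m.1 (P ρ N i j))) * T l D ρ N k.2 p.2 m.2

/-- The part of the tetrahedral flow without third derivatives, before antisymmetrisation. -/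
def half (i m : C) : A :=
  lsum l fun j => lsum l fun p => lsum l fun k' => lsum l fun l' =>
    (lsum l fun m' => D m'.1 (P ρ N k'.2 p.2) * D j.1 (P ρ N m'.2 l'.2)) *
    (lsum l fun k => D k.1 (D p.1 (P ρ N i j.2)) * D k'.1 (D l'.1 (P ρ N k.2 m)))

/-- The modular vector field of `ϱ N`. -/
def mv (i : C) : A := lsum l fun n => D n.1 ρ * N i n.2

/-- The bracketed factor is the second derivative of ϱN along j and s, keeping only the terms in
which the two derivatives hit different factors among ϱ and the Casimirs; `H` is meant to be the
part that hits two different Casimirs. It is a separate argument because it cannot be recovered from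
N and D alone. The last summand is a correction with all derivatives of ϱ of first order. -/
def W (j : V) (k p : C) : A :=
  lsum l fun n => lsum l fun s =>
    (D j ρ * D s.1 (N k n.2) + D s.1 ρ * D j (N k n.2) + ρ * H j s.1 k n.2) * D n.1 (P ρ N p s.2)
      + D j ρ * D s.1 (N k n.2) * (D n.1 ρ * N p s.2)

/-- The derivatives p, s and n act on the density only, while k and j act on a whole factor. In
graph language the first three arrows head to Levi-Civita vertices and the other two are spread by
the Leibniz rule. -/
def G (i : C) : A :=
  lsum l fun j => lsum l fun k => lsum l fun p => D k.1 (D p.1 ρ * N i j.2) *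
    lsum l fun n => lsum l fun s => D j.1 (D s.1 ρ * N k.2 n.2) * (D n.1 ρ * N p.2 s.2)

/-- The trivialising vector field, up to a factor. -/
def Y (i : C) : A :=
  (lsum l fun k => lsum l fun p =>
      D k.1 (D p.1 (mv l D ρ N i)) * (mv l D ρ N k.2 * mv l D ρ N p.2))
    + (lsum l fun j => lsum l fun k => lsum l fun p =>
        D k.1 (D p.1 (P ρ N i j.2)) * W l D ρ N H j.1 k.2 p.2)
    + (G l D ρ N i + G l D ρ N i)

/-- The Lie derivative of the bivector along `Y`. -/
def lie (i j : C) : A :=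
  (lsum l fun p => Y l D ρ N H p.2 * D p.1 (P ρ N i j))
    + -(lsum l fun p => P ρ N p.2 j * D p.1 (Y l D ρ N H i))
    + -(lsum l fun p => P ρ N i p.2 * D p.1 (Y l D ρ N H j))

/-- The tetrahedral flow, up to a factor. -/
def flow (i j : C) : A :=
  third l D ρ N i j + (half l D ρ N i j + (half l D ρ N i j + half l D ρ N i j))
    + -(half l D ρ N j i + (half l D ρ N j i + half l D ρ N j i))

/-- The defect of the trivialisation. -/
def defect (i j : C) : A := flow l D ρ N i j + lie l D ρ N H i j

/-- The velocity of a function `c`, up to a factor. -/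
def vel (c : A) : A :=
  lsum l fun k => lsum l fun p => lsum l fun m => D k.1 (D p.1 (D m.1 c)) * T l D ρ N k.2 p.2 m.2

/-- The defect of the velocity of a function `c`. -/
def casDefect (c : A) : A :=
  (lsum l fun i => D i.1 c * Y l D ρ N H i.2) + vel l D ρ N c

end Expr

/-! ### Relational parametricity -/

/-- A relation, graded by an order of differentiation, compatible with the operations. -/
structure DRel {B : Type*} [Add B] [Mul B] [Neg B] [Zero B] (R : ℕ → A → B → Prop)
    (D : V → A → A) (D' : V → B → B) : Prop where
  add : ∀ {n a b a' b'}, R n a b → R n a' b' → R n (a + a') (b + b')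
  mul : ∀ {n a b a' b'}, R n a b → R n a' b' → R n (a * a') (b * b')
  neg : ∀ {n a b}, R n a b → R n (-a) (-b)
  zero : ∀ {n}, R n 0 0
  der : ∀ {n a b} (v : V), R (n + 1) a b → R n (D v a) (D' v b)
  mono : ∀ {n a b}, R (n + 1) a b → R n a b

namespace DRel

variable {B : Type*} [Add B] [Mul B] [Neg B] [Zero B] {R : ℕ → A → B → Prop}
  {D : V → A → A} {D' : V → B → B} (h : DRel R D D')
  {l : List (V × C)} {ρ : A} {N : C → C → A} {H : V → V → C → C → A}
  {ρ' : B} {N' : C → C → B} {H' : V → V → C → C → B} {n : ℕ}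

include h

theorem lsum {ι : Type*} (L : List ι) {f : ι → A} {g : ι → B} (hf : ∀ i, R n (f i) (g i)) :
    R n (NambuFlow.lsum L f) (NambuFlow.lsum L g) := by
  induction L with
  | nil => exact h.zero
  | cons a L ih => exact h.add (hf a) ih

theorem P (hρ : R n ρ ρ') (hN : ∀ i j, R n (N i j) (N' i j)) (i j : C) :
    R n (Expr.P ρ N i j) (Expr.P ρ' N' i j) := h.mul hρ (hN i j)

theorem T (hP : ∀ i j, R (n + 1) (Expr.P ρ N i j) (Expr.P ρ' N' i j)) (k p m : C) :
    R n (Expr.T l D ρ N k p m) (Expr.T l D' ρ' N' k p m) :=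
  h.lsum _ fun _ => h.lsum _ fun _ => h.mul (h.der _ (hP _ _))
    (h.lsum _ fun _ => h.mul (h.der _ (hP _ _)) (h.der _ (hP _ _)))

theorem third (hP : ∀ i j, R (n + 3) (Expr.P ρ N i j) (Expr.P ρ' N' i j)) (i j : C) :
    R n (Expr.third l D ρ N i j) (Expr.third l D' ρ' N' i j) :=
  h.lsum _ fun _ => h.lsum _ fun _ => h.lsum _ fun _ =>
    h.mul (h.der _ (h.der _ (h.der _ (hP _ _))))
      (h.T (fun i j => h.mono (h.mono (hP i j))) _ _ _)

theorem half (hP : ∀ i j, R (n + 2) (Expr.P ρ N i j) (Expr.P ρ' N' i j)) (i j : C) :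
    R n (Expr.half l D ρ N i j) (Expr.half l D' ρ' N' i j) :=
  h.lsum _ fun _ => h.lsum _ fun _ => h.lsum _ fun _ => h.lsum _ fun _ =>
    h.mul (h.lsum _ fun _ => h.mul (h.der _ (h.mono (hP _ _))) (h.der _ (h.mono (hP _ _))))
      (h.lsum _ fun _ => h.mul (h.der _ (h.der _ (hP _ _))) (h.der _ (h.der _ (hP _ _))))

theorem flow (hP : ∀ i j, R (n + 3) (Expr.P ρ N i j) (Expr.P ρ' N' i j)) (i j : C) :
    R n (Expr.flow l D ρ N i j) (Expr.flow l D' ρ' N' i j) := by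
  have hh := fun i j => h.half (l := l) (fun i j => h.mono (hP i j)) i j
  exact h.add (h.add (h.third hP i j) (h.add (hh i j) (h.add (hh i j) (hh i j))))
    (h.neg (h.add (hh j i) (h.add (hh j i) (hh j i))))

theorem mv (hρ : R (n + 1) ρ ρ') (hN : ∀ i j, R n (N i j) (N' i j)) (i : C) :
    R n (Expr.mv l D ρ N i) (Expr.mv l D' ρ' N' i) :=
  h.lsum _ fun _ => h.mul (h.der _ hρ) (hN _ _)

theorem W (hρ : R (n + 1) ρ ρ') (hN : ∀ i j, R (n + 1) (N i j) (N' i j))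
    (hH : ∀ v w i j, R n (H v w i j) (H' v w i j)) (v : V) (i j : C) :
    R n (Expr.W l D ρ N H v i j) (Expr.W l D' ρ' N' H' v i j) :=
  h.lsum _ fun _ => h.lsum _ fun _ => h.add
    (h.mul (h.add (h.add (h.mul (h.der _ hρ) (h.der _ (hN _ _)))
      (h.mul (h.der _ hρ) (h.der _ (hN _ _)))) (h.mul (h.mono hρ) (hH _ _ _ _)))
      (h.der _ (h.P hρ hN _ _)))
    (h.mul (h.mul (h.der _ hρ) (h.der _ (hN _ _))) (h.mul (h.der _ hρ) (h.mono (hN _ _))))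

theorem G (hρ : R (n + 2) ρ ρ') (hN : ∀ i j, R (n + 1) (N i j) (N' i j)) (i : C) :
    R n (Expr.G l D ρ N i) (Expr.G l D' ρ' N' i) :=
  h.lsum _ fun _ => h.lsum _ fun _ => h.lsum _ fun _ =>
    h.mul (h.der _ (h.mul (h.der _ hρ) (hN _ _)))
    (h.lsum _ fun _ => h.lsum _ fun _ => h.mul (h.der _ (h.mul (h.der _ hρ) (hN _ _)))
      (h.mul (h.der _ (h.mono hρ)) (h.mono (hN _ _))))

theorem Y (hρ : R (n + 3) ρ ρ') (hN : ∀ i j, R (n + 2) (N i j) (N' i j))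
    (hH : ∀ v w i j, R n (H v w i j) (H' v w i j)) (i : C) :
    R n (Expr.Y l D ρ N H i) (Expr.Y l D' ρ' N' H' i) := by
  have hm := fun i => h.mv (l := l) hρ hN i
  have hN1 := fun i j => h.mono (hN i j)
  have hG := h.G (l := l) (h.mono hρ) hN1 i
  exact h.add (h.add
    (h.lsum _ fun _ => h.lsum _ fun _ => h.mul (h.der _ (h.der _ (hm _)))
      (h.mul (h.mono (h.mono (hm _))) (h.mono (h.mono (hm _)))))
    (h.lsum _ fun _ => h.lsum _ fun _ => h.lsum _ fun _ => h.mul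
      (h.der _ (h.der _ (h.P (h.mono hρ) hN _ _)))
      (h.W (h.mono (h.mono hρ)) hN1 hH _ _ _)))
    (h.add hG hG)

theorem lie (hρ : R (n + 4) ρ ρ') (hN : ∀ i j, R (n + 3) (N i j) (N' i j))
    (hH : ∀ v w i j, R (n + 1) (H v w i j) (H' v w i j)) (i j : C) :
    R n (Expr.lie l D ρ N H i j) (Expr.lie l D' ρ' N' H' i j) := by
  have hY := fun i => h.Y (l := l) hρ hN hH i
  have hP := fun i j => h.mono (h.mono (h.P (h.mono hρ) hN i j))
  exact h.add (h.add (h.lsum _ fun _ => h.mul (h.mono (hY _)) (h.der _ (hP _ _)))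
    (h.neg (h.lsum _ fun _ => h.mul (h.mono (hP _ _)) (h.der _ (hY _)))))
    (h.neg (h.lsum _ fun _ => h.mul (h.mono (hP _ _)) (h.der _ (hY _))))

/-- This is the count of derivatives that fixes the size of the tables below. `Y` consumes three
derivatives of ϱ and two of N, and the Lie derivative one more of each; as N contains first
derivatives of the Casimirs, all functions are needed up to order four. -/
theorem defect (hρ : R (n + 4) ρ ρ') (hN : ∀ i j, R (n + 3) (N i j) (N' i j))
    (hH : ∀ v w i j, R (n + 1) (H v w i j) (H' v w i j)) (i j : C) :
    R n (Expr.defect l D ρ N H i j) (Expr.defect l D' ρ' N' H' i j) :=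
  h.add (h.flow (fun i j => h.P (h.mono hρ) hN i j) i j) (h.lie hρ hN hH i j)

theorem vel (hP : ∀ i j, R (n + 1) (Expr.P ρ N i j) (Expr.P ρ' N' i j)) {c : A} {c' : B}
    (hc : R (n + 3) c c') : R n (Expr.vel l D ρ N c) (Expr.vel l D' ρ' N' c') :=
  h.lsum _ fun _ => h.lsum _ fun _ => h.lsum _ fun _ =>
    h.mul (h.der _ (h.der _ (h.der _ hc))) (h.T hP _ _ _)

theorem casDefect (hρ : R (n + 3) ρ ρ') (hN : ∀ i j, R (n + 2) (N i j) (N' i j))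
    (hH : ∀ v w i j, R n (H v w i j) (H' v w i j)) {c : A} {c' : B} (hc : R (n + 3) c c') :
    R n (Expr.casDefect l D ρ N H c) (Expr.casDefect l D' ρ' N' H' c') :=
  h.add (h.lsum _ fun _ => h.mul (h.der _ (h.mono (h.mono hc))) (h.Y hρ hN hH _))
    (h.vel (fun i j => h.mono (h.P (h.mono hρ) hN i j)) hc)

end DRel

/-! ### Reindexing -/

theorem lsum_map {ι κ : Type*} (e : κ → ι) (l : List κ) (f : ι → A) :
    lsum (l.map e) f = lsum l fun k => f (e k) := by
  simp [lsum, List.foldr_map]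

namespace Expr

variable {V' C' : Type*} (l : List (V' × C')) (e : V' → V) (e' : C' → C)
  (D : V → A → A) (ρ : A) (N : C → C → A) (H : V → V → C → C → A)

theorem defect_map (i j : C') :
    defect (l.map (Prod.map e e')) D ρ N H (e' i) (e' j)
      = defect l (fun v => D (e v)) ρ (fun i j => N (e' i) (e' j))
        (fun v w i j => H (e v) (e w) (e' i) (e' j)) i j := by
  simp only [defect, flow, third, half, lie, Y, G, W, T, mv, P, lsum_map, Prod.map_fst,
    Prod.map_snd]

theorem casDefect_map (c : A) :
    casDefect (l.map (Prod.map e e')) D ρ N H c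
      = casDefect l (fun v => D (e v)) ρ (fun i j => N (e' i) (e' j))
        (fun v w i j => H (e v) (e w) (e' i) (e' j)) c := by
  simp only [casDefect, vel, Y, G, W, T, mv, P, lsum_map, Prod.map_fst, Prod.map_snd]

end Expr

end Expr

/-! ### Scaling and antisymmetry -/

section Ring

variable {A : Type*} [CommRing A] {V C : Type*}

theorem lsum_neg {ι : Type*} (l : List ι) (f : ι → A) : lsum l (fun i => -f i) = -lsum l f := by
  induction l with
  | nil => simp [lsum]
  | cons a l ih => simp only [lsum, List.foldr_cons] at ih ⊢; rw [ih]; ring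

namespace Expr

variable (l : List (V × C)) (D : V → A → A) (ρ : A) (N : C → C → A) (H : V → V → C → C → A)

theorem P_scale (c : A) : P ρ (fun i j => c * N i j) = P (c * ρ) N := by
  funext i j; simp only [P]; ring

/-- In every summand a constant factor of N or H can be moved onto an accompanying factor ϱ. This
lets the determinant produced by a change of frame be absorbed into the density. -/
theorem Y_scale {c : A} (hc : ∀ v f, D v (c * f) = c * D v f) :
    Y l D ρ (fun i j => c * N i j) (fun v w i j => c * H v w i j) = Y l D (c * ρ) N H := by
  have hm : mv l D ρ (fun i j => c * N i j) = mv l D (c * ρ) N := by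
    funext i; simp only [mv, hc]; congr 1; funext n; ring
  have hW : W l D ρ (fun i j => c * N i j) (fun v w i j => c * H v w i j) = W l D (c * ρ) N H := by
    funext v i j
    simp only [W, P_scale, hc]
    congr 1; funext n; congr 1; funext s; ring
  have hG : G l D ρ (fun i j => c * N i j) = G l D (c * ρ) N := by
    funext i
    have h1 : ∀ p i j, D p ρ * (c * N i j) = D p (c * ρ) * N i j := by
      intro p i j; rw [hc]; ring
    simp only [G, h1]
  funext i
  simp only [Y, hm, hW, hG, P_scale]

theorem defect_scale {c : A} (hc : ∀ v f, D v (c * f) = c * D v f) :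
    defect l D ρ (fun i j => c * N i j) (fun v w i j => c * H v w i j)
      = defect l D (c * ρ) N H := by
  funext i j
  simp only [defect, flow, third, half, lie, T, P_scale, Y_scale l D ρ N H hc]

theorem casDefect_scale {c : A} (hc : ∀ v f, D v (c * f) = c * D v f) :
    casDefect l D ρ (fun i j => c * N i j) (fun v w i j => c * H v w i j)
      = casDefect l D (c * ρ) N H := by
  funext f
  simp only [casDefect, vel, T, P_scale, Y_scale l D ρ N H hc]

/-- The double-derivative part of `flow` is antisymmetrised by construction; the other parts inherit
antisymmetry from N. Only pairs i < j of indices then have to be checked. -/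
theorem defect_antisymm (hN : ∀ i j, N i j = -N j i) (hD : ∀ v f, D v (-f) = -D v f) (i j : C) :
    defect l D ρ N H i j = -defect l D ρ N H j i := by
  have hP : ∀ i j, P ρ N i j = -P ρ N j i := fun i j => by
    simp only [P]; rw [hN]; ring
  have h3 : third l D ρ N i j = -third l D ρ N j i := by
    simp only [third, ← lsum_neg]
    congr 1; funext k; congr 1; funext p; congr 1; funext m
    rw [hP i j, hD, hD, hD]; ring
  have h4 : lie l D ρ N H i j = -lie l D ρ N H j i := by
    have e1 : (lsum l fun p => Y l D ρ N H p.2 * D p.1 (P ρ N i j))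
        = -(lsum l fun p => Y l D ρ N H p.2 * D p.1 (P ρ N j i)) := by
      rw [← lsum_neg]; congr 1; funext p; rw [hP i j, hD]; ring
    have e2 : ∀ i j, (lsum l fun p => P ρ N p.2 j * D p.1 (Y l D ρ N H i))
        = -(lsum l fun p => P ρ N j p.2 * D p.1 (Y l D ρ N H i)) := by
      intro i j
      rw [← lsum_neg]; congr 1; funext p; rw [hP p.2 j]; ring
    simp only [lie]
    rw [e1, e2 i j, e2 j i]; ring
  simp only [defect, flow]
  rw [h3, h4]; ring

end Expr

end Ring

/-! ### Independence of the frame -/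

section Frame

variable {A : Type*} [CommRing A] [Algebra ℝ A] {V C : Type*} [AddCommGroup V] [Module ℝ V]
  [AddCommGroup C] [Module ℝ C]

/-- Linearity over the reals. -/
def Lin {E F : Type*} [AddCommGroup E] [Module ℝ E] [AddCommGroup F] [Module ℝ F] (f : E → F) :
    Prop := IsLinearMap ℝ f

theorem Lin.mulConst {f : V → A} (hf : Lin f) (c : A) :
    Lin (fun v => f v * c) :=
  ⟨fun x y => by rw [hf.map_add, add_mul], fun r x => by rw [hf.map_smul, smul_mul_assoc]⟩

theorem Lin.constMul {f : V → A} (hf : Lin f) (c : A) :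
    Lin (fun v => c * f v) :=
  ⟨fun x y => by rw [hf.map_add, mul_add], fun r x => by rw [hf.map_smul, mul_smul_comm]⟩

theorem Lin.add' {f g : V → A} (hf : Lin f) (hg : Lin g) :
    Lin (fun v => f v + g v) :=
  ⟨fun x y => by rw [hf.map_add, hg.map_add]; abel,
    fun r x => by rw [hf.map_smul, hg.map_smul, smul_add]⟩

theorem Lin.neg' {f : V → A} (hf : Lin f) : Lin (fun v => -f v) :=
  ⟨fun x y => by rw [hf.map_add]; abel, fun r x => by rw [hf.map_smul, smul_neg]⟩

theorem Lin.lsum {ι : Type*} (L : List ι) {f : ι → V → A}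
    (hf : ∀ i, Lin (f i)) : Lin (fun v => NambuFlow.lsum L fun i => f i v) := by
  induction L with
  | nil => exact ⟨by simp [NambuFlow.lsum], by simp [NambuFlow.lsum]⟩
  | cons a L ih => exact (hf a).add' ih

theorem Lin.comp' {f : V → A} (hf : Lin f) {g : A → A} (hg : Lin g) :
    Lin (fun v => g (f v)) :=
  ⟨fun x y => by rw [hf.map_add, hg.map_add], fun r x => by rw [hf.map_smul, hg.map_smul]⟩

/-- Two lists of vectors and covectors define the same contraction of bilinear expressions. -/
def SameContraction (A : Type*) [CommRing A] [Algebra ℝ A] (l l' : List (V × C)) : Prop :=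
  ∀ F : V × C → A, (∀ η, Lin fun v => F (v, η)) → (∀ v, Lin fun η => F (v, η)) →
    lsum l F = lsum l' F

theorem SameContraction.step {l l' : List (V × C)} (h : SameContraction A l l') {F F' : V × C → A}
    (e : ∀ u, F u = F' u) (h1 : ∀ η, Lin fun v => F' (v, η))
    (h2 : ∀ v, Lin fun η => F' (v, η)) : lsum l F = lsum l' F' := by
  rw [funext e]; exact h F' h1 h2

/-- The linearity of the data of an expression in vectors and covectors. -/
structure LinData (D : V → A → A) (N : C → C → A) (H : V → V → C → C → A) : Prop where
  D1 : ∀ f, Lin fun v => D v f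
  D2 : ∀ v, Lin (D v)
  N1 : ∀ j, Lin fun i => N i j
  N2 : ∀ i, Lin (N i)
  H1 : ∀ w i j, Lin fun v => H v w i j
  H2 : ∀ v i j, Lin fun w => H v w i j
  H3 : ∀ v w j, Lin fun i => H v w i j
  H4 : ∀ v w i, Lin (H v w i)

namespace LinData

variable {D : V → A → A} {N : C → C → A} {H : V → V → C → C → A} (h : LinData D N H)
  {l l' : List (V × C)} (hl : SameContraction A l l') {ρ : A}

include h

theorem DD {E : Type*} [AddCommGroup E] [Module ℝ E] (v : V) {f : E → A} (hf : Lin f) :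
    Lin (fun x => D v (f x)) := hf.comp' (h.D2 v)

theorem P1 (j : C) : Lin fun i => Expr.P ρ N i j := (h.N1 j).constMul ρ

theorem P2 (i : C) : Lin (Expr.P ρ N i) := (h.N2 i).constMul ρ

theorem T1 (p m : C) : Lin fun k => Expr.T l D ρ N k p m :=
  .lsum _ fun _ => .lsum _ fun _ => (h.DD _ (h.P1 _)).mulConst _

theorem T2 (k m : C) : Lin fun p => Expr.T l D ρ N k p m :=
  .lsum _ fun _ => .lsum _ fun _ => (Lin.lsum _ fun _ =>
    (h.DD _ (h.P1 _)).mulConst _).constMul _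

theorem T3 (k p : C) : Lin fun m => Expr.T l D ρ N k p m :=
  .lsum _ fun _ => .lsum _ fun _ => (Lin.lsum _ fun _ =>
    (h.DD _ (h.P1 _)).constMul _).constMul _

theorem third1 (j : C) : Lin fun i => Expr.third l D ρ N i j :=
  .lsum _ fun _ => .lsum _ fun _ => .lsum _ fun _ =>
    (h.DD _ (h.DD _ (h.DD _ (h.P1 _)))).mulConst _

theorem half1 (j : C) : Lin fun i => Expr.half l D ρ N i j :=
  .lsum _ fun _ => .lsum _ fun _ => .lsum _ fun _ => .lsum _ fun _ => (Lin.lsum _ fun _ =>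
    (h.DD _ (h.DD _ (h.P1 _))).mulConst _).constMul _

theorem half2 (i : C) : Lin fun j => Expr.half l D ρ N i j :=
  .lsum _ fun _ => .lsum _ fun _ => .lsum _ fun _ => .lsum _ fun _ => (Lin.lsum _ fun _ =>
    (h.DD _ (h.DD _ (h.P2 _))).constMul _).constMul _

theorem mv1 : Lin (Expr.mv l D ρ N) := .lsum _ fun _ => (h.N1 _).constMul _

theorem W1 (k p : C) : Lin fun j => Expr.W l D ρ N H j k p :=
  .lsum _ fun _ => .lsum _ fun _ => .add'
    (Lin.mulConst (.add' (.add' ((h.D1 _).mulConst _) ((h.D1 _).constMul _))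
      ((h.H1 _ _ _).constMul _)) _)
    (((h.D1 _).mulConst _).mulConst _)

theorem W2 (j : V) (p : C) : Lin fun k => Expr.W l D ρ N H j k p :=
  .lsum _ fun _ => .lsum _ fun _ => .add'
    (Lin.mulConst (.add' (.add' ((h.DD _ (h.N1 _)).constMul _)
      ((h.DD _ (h.N1 _)).constMul _)) ((h.H3 _ _ _).constMul _)) _)
    (((h.DD _ (h.N1 _)).constMul _).mulConst _)

theorem W3 (j : V) (k : C) : Lin fun p => Expr.W l D ρ N H j k p :=
  .lsum _ fun _ => .lsum _ fun _ => .add' ((h.DD _ (h.P1 _)).constMul _)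
    (((h.N1 _).constMul _).constMul _)

theorem G1 : Lin (Expr.G l D ρ N) :=
  .lsum _ fun _ => .lsum _ fun _ => .lsum _ fun _ =>
    (h.DD _ ((h.N1 _).constMul _)).mulConst _

theorem Y1 : Lin (Expr.Y l D ρ N H) :=
  .add' (.add' (.lsum _ fun _ => .lsum _ fun _ => (h.DD _ (h.DD _ h.mv1)).mulConst _)
    (.lsum _ fun _ => .lsum _ fun _ => .lsum _ fun _ => (h.DD _ (h.DD _ (h.P1 _))).mulConst _))
    (.add' h.G1 h.G1)

theorem lie1 (j : C) : Lin fun i => Expr.lie l D ρ N H i j :=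
  .add' (.add' (.lsum _ fun _ => (h.DD _ (h.P1 _)).constMul _)
    (.neg' (.lsum _ fun _ => (h.DD _ h.Y1).constMul _)))
    (.neg' (.lsum _ fun _ => (h.P1 _).mulConst _))

theorem defect1 (j : C) : Lin fun i => Expr.defect l D ρ N H i j :=
  .add' (.add' (.add' (h.third1 _) (.add' (h.half1 _) (.add' (h.half1 _) (h.half1 _))))
    (.neg' (.add' (h.half2 _) (.add' (h.half2 _) (h.half2 _))))) (h.lie1 _)

include hl

/-- The sums are exchanged from the inside outwards, each exchange being legitimate because the
summand is linear in the vector and in the covector it contracts. All goals left by `step` are these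
two linearity statements, here and in the lemmas that follow. -/
theorem T_congr : Expr.T l D ρ N = Expr.T l' D ρ N := by
  funext k p m
  refine hl.step (fun q => hl.step (fun r => congrArg _ (hl.step (fun s => rfl) ?_ ?_)) ?_ ?_) ?_ ?_
  · intro _; dsimp only; exact (h.D1 _).mulConst _
  · intro _; dsimp only; exact (h.DD _ (h.P2 _)).constMul _
  · intro _; dsimp only; exact (h.D1 _).mulConst _
  · intro _; dsimp only; exact (Lin.lsum _ fun _ => (h.DD _ (h.P2 _)).mulConst _).constMul _
  · intro _; dsimp only; exact .lsum _ fun _ => (Lin.lsum _ fun _ => (h.D1 _).constMul _).constMul _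
  · intro _; dsimp only; exact .lsum _ fun _ => (h.DD _ (h.P2 _)).mulConst _

theorem third_congr : Expr.third l D ρ N = Expr.third l' D ρ N := by
  funext i j
  unfold Expr.third
  rw [h.T_congr hl]
  refine hl.step (fun k => hl.step (fun p => hl.step (fun m => rfl) ?_ ?_) ?_ ?_) ?_ ?_
  · intro _; dsimp only; exact (h.DD _ (h.DD _ (h.D1 _))).mulConst _
  · intro _; dsimp only; exact (h.T3 _ _).constMul _
  · intro _; dsimp only; exact .lsum _ fun _ => (h.DD _ (h.D1 _)).mulConst _
  · intro _; dsimp only; exact .lsum _ fun _ => (h.T2 _ _).constMul _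
  · intro _; dsimp only; exact .lsum _ fun _ => .lsum _ fun _ => (h.D1 _).mulConst _
  · intro _; dsimp only; exact .lsum _ fun _ => .lsum _ fun _ => (h.T1 _ _).constMul _

theorem half_congr : Expr.half l D ρ N = Expr.half l' D ρ N := by
  funext i m
  refine hl.step (fun j => hl.step (fun p => hl.step (fun k' => hl.step (fun l' => congrArg₂ _
    (hl.step (fun m' => rfl) ?_ ?_) (hl.step (fun k => rfl) ?_ ?_)) ?_ ?_) ?_ ?_) ?_ ?_) ?_ ?_
  · intro _; dsimp only; exact (h.D1 _).mulConst _
  · intro _; dsimp only; exact (h.DD _ (h.P1 _)).constMul _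
  · intro _; dsimp only; exact (h.D1 _).mulConst _
  · intro _; dsimp only; exact (h.DD _ (h.DD _ (h.P1 _))).constMul _
  · intro _; dsimp only; exact (Lin.lsum _ fun _ => (h.DD _ (h.D1 _)).constMul _).constMul _
  · intro _; dsimp only; exact (Lin.lsum _ fun _ => (h.DD _ (h.P2 _)).constMul _).mulConst _
  · intro _; dsimp only; exact .lsum _ fun _ => (Lin.lsum _ fun _ => (h.D1 _).constMul _).constMul _
  · intro _; dsimp only; exact .lsum _ fun _ => (Lin.lsum _ fun _ =>
      (h.DD _ (h.P1 _)).mulConst _).mulConst _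
  · intro _; dsimp only; exact .lsum _ fun _ => .lsum _ fun _ => (Lin.lsum _ fun _ =>
      (h.DD _ (h.D1 _)).mulConst _).constMul _
  · intro _; dsimp only; exact .lsum _ fun _ => .lsum _ fun _ => (Lin.lsum _ fun _ =>
      (h.DD _ (h.P2 _)).mulConst _).mulConst _
  · intro _; dsimp only; exact .lsum _ fun _ => .lsum _ fun _ => .lsum _ fun _ => (Lin.lsum _ fun _ =>
      (h.D1 _).constMul _).mulConst _
  · intro _; dsimp only; exact .lsum _ fun _ => .lsum _ fun _ => .lsum _ fun _ => (Lin.lsum _ fun _ =>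
      (h.DD _ (h.DD _ (h.P2 _))).mulConst _).constMul _

theorem mv_congr : Expr.mv l D ρ N = Expr.mv l' D ρ N := by
  funext i
  refine hl.step (fun n => rfl) ?_ ?_
  · intro _; dsimp only; exact (h.D1 _).mulConst _
  · intro _; dsimp only; exact (h.N2 _).constMul _

theorem W_congr : Expr.W l D ρ N H = Expr.W l' D ρ N H := by
  funext j k p
  refine hl.step (fun n => hl.step (fun s => rfl) ?_ ?_) ?_ ?_
  · intro _; dsimp only; exact .add' (Lin.mulConst (.add' (.add' ((h.D1 _).constMul _)
      ((h.D1 _).mulConst _)) ((h.H2 _ _ _).constMul _)) _)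
      (((h.D1 _).constMul _).mulConst _)
  · intro _; dsimp only; exact .add' ((h.DD _ (h.P2 _)).constMul _) (((h.N2 _).constMul _).constMul _)
  · intro _; dsimp only; exact .lsum _ fun _ => .add' ((h.D1 _).constMul _) (((h.D1 _).mulConst _).constMul _)
  · intro _; dsimp only; exact .lsum _ fun _ => .add' (Lin.mulConst (.add' (.add'
      ((h.DD _ (h.N2 _)).constMul _) ((h.DD _ (h.N2 _)).constMul _))
      ((h.H4 _ _ _).constMul _)) _) (((h.DD _ (h.N2 _)).constMul _).mulConst _)

theorem G_congr : Expr.G l D ρ N = Expr.G l' D ρ N := by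
  funext i
  refine hl.step (fun j => hl.step (fun k => hl.step (fun p => congrArg _
    (hl.step (fun n => hl.step (fun s => rfl) ?_ ?_) ?_ ?_)) ?_ ?_) ?_ ?_) ?_ ?_
  · intro _; dsimp only; exact (h.DD _ ((h.D1 _).mulConst _)).mulConst _
  · intro _; dsimp only; exact ((h.N2 _).constMul _).constMul _
  · intro _; dsimp only; exact .lsum _ fun _ => ((h.D1 _).mulConst _).constMul _
  · intro _; dsimp only; exact .lsum _ fun _ => (h.DD _ ((h.N2 _).constMul _)).mulConst _
  · intro _; dsimp only; exact (h.DD _ ((h.D1 _).mulConst _)).mulConst _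
  · intro _; dsimp only; exact (Lin.lsum _ fun _ => .lsum _ fun _ =>
      ((h.N1 _).constMul _).constMul _).constMul _
  · intro _; dsimp only; exact .lsum _ fun _ => (h.D1 _).mulConst _
  · intro _; dsimp only; exact .lsum _ fun _ => (Lin.lsum _ fun _ => .lsum _ fun _ =>
      (h.DD _ ((h.N1 _).constMul _)).mulConst _).constMul _
  · intro _; dsimp only; exact .lsum _ fun _ => .lsum _ fun _ => (Lin.lsum _ fun _ => .lsum _ fun _ =>
      (h.D1 _).mulConst _).constMul _
  · intro _; dsimp only; exact .lsum _ fun _ => .lsum _ fun _ =>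
      (h.DD _ ((h.N2 _).constMul _)).mulConst _

theorem Y_congr : Expr.Y l D ρ N H = Expr.Y l' D ρ N H := by
  funext i
  unfold Expr.Y
  rw [h.mv_congr hl, h.W_congr hl, h.G_congr hl]
  refine congrArg₂ _ (congrArg₂ _ (hl.step (fun k => hl.step (fun p => rfl) ?_ ?_) ?_ ?_)
    (hl.step (fun j => hl.step (fun k => hl.step (fun p => rfl) ?_ ?_) ?_ ?_) ?_ ?_)) rfl
  · intro _; dsimp only; exact (h.DD _ (h.D1 _)).mulConst _
  · intro _; dsimp only; exact (h.mv1.constMul _).constMul _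
  · intro _; dsimp only; exact .lsum _ fun _ => (h.D1 _).mulConst _
  · intro _; dsimp only; exact .lsum _ fun _ => (h.mv1.mulConst _).constMul _
  · intro _; dsimp only; exact (h.DD _ (h.D1 _)).mulConst _
  · intro _; dsimp only; exact (h.W3 _ _).constMul _
  · intro _; dsimp only; exact .lsum _ fun _ => (h.D1 _).mulConst _
  · intro _; dsimp only; exact .lsum _ fun _ => (h.W2 _ _).constMul _
  · intro _; dsimp only; exact .lsum _ fun _ => .lsum _ fun _ => (h.W1 _ _).constMul _
  · intro _; dsimp only; exact .lsum _ fun _ => .lsum _ fun _ => (h.DD _ (h.DD _ (h.P2 _))).mulConst _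

theorem lie_congr : Expr.lie l D ρ N H = Expr.lie l' D ρ N H := by
  funext i j
  unfold Expr.lie
  rw [h.Y_congr hl]
  refine congrArg₂ _ (congrArg₂ _ (hl.step (fun p => rfl) ?_ ?_)
    (congrArg _ (hl.step (fun p => rfl) ?_ ?_))) (congrArg _ (hl.step (fun p => rfl) ?_ ?_))
  · intro _; dsimp only; exact (h.D1 _).constMul _
  · intro _; dsimp only; exact h.Y1.mulConst _
  · intro _; dsimp only; exact (h.D1 _).constMul _
  · intro _; dsimp only; exact (h.P1 _).mulConst _
  · intro _; dsimp only; exact (h.D1 _).constMul _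
  · intro _; dsimp only; exact (h.P2 _).mulConst _

theorem defect_congr : Expr.defect l D ρ N H = Expr.defect l' D ρ N H := by
  unfold Expr.defect Expr.flow
  rw [h.third_congr hl, h.half_congr hl, h.lie_congr hl]

theorem casDefect_congr : Expr.casDefect l D ρ N H = Expr.casDefect l' D ρ N H := by
  funext c
  unfold Expr.casDefect Expr.vel
  rw [h.Y_congr hl, h.T_congr hl]
  refine congrArg₂ _ (hl.step (fun i => rfl) ?_ ?_)
    (hl.step (fun k => hl.step (fun p => hl.step (fun m => rfl) ?_ ?_) ?_ ?_) ?_ ?_)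
  · intro _; dsimp only; exact (h.D1 _).mulConst _
  · intro _; dsimp only; exact h.Y1.constMul _
  · intro _; dsimp only; exact (h.DD _ (h.DD _ (h.D1 _))).mulConst _
  · intro _; dsimp only; exact (h.T3 _ _).constMul _
  · intro _; dsimp only; exact .lsum _ fun _ => (h.DD _ (h.D1 _)).mulConst _
  · intro _; dsimp only; exact .lsum _ fun _ => (h.T2 _ _).constMul _
  · intro _; dsimp only; exact .lsum _ fun _ => .lsum _ fun _ => (h.D1 _).mulConst _
  · intro _; dsimp only; exact .lsum _ fun _ => .lsum _ fun _ => (h.T1 _ _).constMul _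

end LinData

theorem lsum_finRange {d : ℕ} (f : Fin d → A) : lsum (List.finRange d) f = ∑ i, f i := by
  have : ∀ L : List (Fin d), lsum L f = (L.map f).sum := fun L => by
    induction L with
    | nil => rfl
    | cons a L ih => simpa [lsum] using ih
  rw [this, Fin.sum_univ_def]

/-- Two dual frames define the same contraction. -/
theorem sameContraction_of_dual {d : ℕ} (b b' : Fin d → Fin d → ℝ)
    (hb : ∀ p q, ∑ i, b i p * b' i q = if p = q then 1 else 0) :
    SameContraction A ((List.finRange d).map fun i => (b i, b' i))
      ((List.finRange d).map fun i => ((Pi.single i 1 : Fin d → ℝ), (Pi.single i 1 : Fin d → ℝ))) := by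
  intro F h1 h2
  simp only [lsum_map, lsum_finRange]
  have e : ∀ v : Fin d → ℝ, v = ∑ p, v p • (Pi.single p 1 : Fin d → ℝ) := fun v => by
    ext j; simp [Finset.sum_apply, Pi.single_apply]
  have k1 : ∀ v η, F (v, η) = ∑ p, v p • F (Pi.single p 1, η) := fun v η => by
    conv_lhs => rw [e v]
    exact (map_sum ((h1 η).mk' _) _ _).trans (Finset.sum_congr rfl fun p _ => (h1 η).map_smul _ _)
  have k2 : ∀ v η, F (v, η) = ∑ p, η p • F (v, Pi.single p 1) := fun v η => by
    conv_lhs => rw [e η]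
    exact (map_sum ((h2 v).mk' _) _ _).trans (Finset.sum_congr rfl fun p _ => (h2 v).map_smul _ _)
  calc ∑ i, F (b i, b' i)
      = ∑ i, ∑ p, ∑ q, (b i p * b' i q) • F (Pi.single p 1, Pi.single q 1) :=
        Finset.sum_congr rfl fun i _ => by
          rw [k1]; refine Finset.sum_congr rfl fun p _ => ?_
          rw [k2, Finset.smul_sum]
          exact Finset.sum_congr rfl fun q _ => smul_smul _ _ _
    _ = ∑ p, ∑ q, (∑ i, b i p * b' i q) • F (Pi.single p 1, Pi.single q 1) := by
        rw [Finset.sum_comm]; refine Finset.sum_congr rfl fun p _ => ?_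
        rw [Finset.sum_comm]; refine Finset.sum_congr rfl fun q _ => ?_
        rw [Finset.sum_smul]
    _ = _ := by simp [hb]

end Frame

/-! ## Verification of polynomial identities by evaluation in the kernel -/

/-- Integer polynomials: lists of monomials, encoded as products of primes, with coefficients. -/
inductive Poly : Type
  | nil : Poly
  | cons (m : ℕ) (c : ℤ) (t : Poly) : Poly

namespace Poly

/-- Vanishing terms are dropped at once, so that complete cancellation ends in `nil`, which is what
`isZero` tests. -/
def consNZ (m : ℕ) (c : ℤ) (t : Poly) : Poly :=
  match c with
  | Int.ofNat 0 => t
  | Int.ofNat (n + 1) => cons m (Int.ofNat (n + 1)) t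
  | Int.negSucc n => cons m (Int.negSucc n) t

/-- Codes are merged in increasing order. The recursion over the first summand enters as the
function `ih`, so that both recursions are structural and reduce in the kernel. -/
def addGo (m : ℕ) (c : ℤ) (p : Poly) (ih : Poly → Poly) : Poly → Poly
  | nil => cons m c p
  | cons m' c' q =>
    bif Nat.ble m' m then
      (bif Nat.ble m m' then consNZ m (Int.add c c') (ih q) else cons m' c' (addGo m c p ih q))
    else cons m c (ih (cons m' c' q))

/-- Addition, merging sorted lists of monomials. -/
def add : Poly → Poly → Poly
  | nil => fun q => q
  | cons m c p => addGo m c p (add p)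

def smul (a : ℕ) (c : ℤ) : Poly → Poly
  | nil => nil
  | cons m c' p => cons (Nat.mul a m) (Int.mul c c') (smul a c p)

def neg : Poly → Poly
  | nil => nil
  | cons m c p => cons m (Int.neg c) (neg p)

def shorter : Poly → Poly → Bool
  | nil, _ => true
  | cons _ _ _, nil => false
  | cons _ _ p, cons _ _ q => shorter p q

def mulGo : Poly → Poly → Poly
  | nil, _ => nil
  | cons m c p, q => add (smul m c q) (mulGo p q)

/-- Multiplication, by recursion on the shorter factor. -/
def mul (p q : Poly) : Poly := bif shorter p q then mulGo p q else mulGo q p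

instance : Add Poly := ⟨add⟩
instance : Neg Poly := ⟨neg⟩
instance : Zero Poly := ⟨nil⟩
instance : Mul Poly := ⟨mul⟩

def isZero : Poly → Bool
  | nil => true
  | cons _ _ _ => false

/-- The monomial with a given code. -/
def var : ℕ → Poly
  | 0 => nil
  | n + 1 => cons (n + 1) 1 nil

/-- The value of a polynomial for a given valuation of the monomials. -/
def ev (φ : ℕ →*₀ ℝ) : Poly → ℝ
  | nil => 0
  | cons m c p => c * φ m + ev φ p

variable (φ : ℕ →*₀ ℝ)

theorem ev_consNZ (m : ℕ) (c : ℤ) (t : Poly) : ev φ (consNZ m c t) = c * φ m + ev φ t := by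
  rcases c with (_ | n) | n <;> simp [consNZ, ev]

theorem ev_addGo (m : ℕ) (c : ℤ) (p : Poly) (ih : Poly → Poly)
    (h : ∀ q, ev φ (ih q) = ev φ p + ev φ q) (q : Poly) :
    ev φ (addGo m c p ih q) = c * φ m + ev φ p + ev φ q := by
  induction q with
  | nil => simp [addGo, ev]
  | cons m' c' q IH =>
    rw [addGo]
    cases h1 : Nat.ble m' m <;> cases h2 : Nat.ble m m' <;> simp only [cond_true, cond_false]
    · simp only [ev, h]; ring
    · simp only [ev, h]; ring
    · simp only [ev, IH]; ring
    · have e : m = m' := le_antisymm (Nat.le_of_ble_eq_true h2) (Nat.le_of_ble_eq_true h1)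
      have e2 : ((Int.add c c' : ℤ) : ℝ) = c + c' := Int.cast_add c c'
      rw [ev_consNZ, h, e2]; subst e; simp only [ev]; ring

theorem ev_add (p q : Poly) : ev φ (p + q) = ev φ p + ev φ q := by
  change ev φ (add p q) = _
  induction p generalizing q with
  | nil => simp [add, ev]
  | cons m c p IH => rw [add, ev_addGo φ m c p _ IH]; rfl

theorem ev_smul (a : ℕ) (c : ℤ) (p : Poly) : ev φ (smul a c p) = c * φ a * ev φ p := by
  induction p with
  | nil => simp [smul, ev]
  | cons m c' p IH =>
    have e1 : ((Int.mul c c' : ℤ) : ℝ) = c * c' := Int.cast_mul c c'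
    have e2 : φ (Nat.mul a m) = φ a * φ m := map_mul φ a m
    rw [smul, ev, IH, e1, e2, ev]; ring

theorem ev_neg (p : Poly) : ev φ (-p) = -ev φ p := by
  change ev φ (neg p) = _
  induction p with
  | nil => simp [neg, ev]
  | cons m c p IH =>
    have e1 : ((Int.neg c : ℤ) : ℝ) = -c := Int.cast_neg c
    rw [neg, ev, IH, e1, ev]; ring

theorem ev_mulGo (p q : Poly) : ev φ (mulGo p q) = ev φ p * ev φ q := by
  induction p with
  | nil => simp [mulGo, ev]
  | cons m c p IH =>
    have := ev_add φ (smul m c q) (mulGo p q)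
    change ev φ (add _ _) = _ at this
    rw [mulGo, this, ev_smul, IH, ev]; ring

theorem ev_mul (p q : Poly) : ev φ (p * q) = ev φ p * ev φ q := by
  change ev φ (mul p q) = _
  unfold mul
  cases shorter p q
  · rw [cond_false, ev_mulGo, mul_comm]
  · rw [cond_true, ev_mulGo]

/-- Soundness needs only this direction. That lists are sorted, or that terms are fully collected,
matters for the test to succeed but never for its meaning, since all evaluation lemmas hold for
arbitrary lists. -/
theorem ev_of_isZero {p : Poly} (h : p.isZero = true) : ev φ p = 0 := by
  cases p with
  | nil => rfl
  | cons => simp [isZero] at h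

theorem ev_var (n : ℕ) : ev φ (var n) = φ n := by
  cases n <;> simp [var, ev]

end Poly

/-! ### Formal jets and their comparison with derivations -/

/-- Formal jets: the values of all iterated derivatives. -/
def Jet (α ι : Type*) : Type _ := List ι → α

namespace Jet

variable {α ι : Type*} [Add α] [Mul α] [Neg α] [Zero α]

/-- The product of jets, by the Leibniz rule. -/
def mul (f g : Jet α ι) : Jet α ι
  | [] => f [] * g []
  | k :: K => mul (fun L => f (k :: L)) g K + mul f (fun L => g (k :: L)) K

instance : Add (Jet α ι) := ⟨fun f g J => f J + g J⟩
instance : Neg (Jet α ι) := ⟨fun f J => -f J⟩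
instance : Zero (Jet α ι) := ⟨fun _ => 0⟩
instance : Mul (Jet α ι) := ⟨mul⟩

/-- The derivative of a jet. -/
def D (k : ι) (f : Jet α ι) : Jet α ι := fun J => f (k :: J)

end Jet

/-- The polynomial jet `f` describes the derivatives of `w` up to order `n`. -/
def JetRel {A ι : Type*} [CommRing A] (φ : ℕ →*₀ ℝ) (e : A →+* ℝ) (D : ι → A → A) (n : ℕ)
    (f : Jet Poly ι) (w : A) : Prop :=
  ∀ J : List ι, J.length ≤ n → Poly.ev φ (f J) = e (J.foldl (fun g k => D k g) w)

/-- The product of formal jets is defined by the Leibniz recursion on the list of derivatives, which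
is the rule that the derivations obey. Taking the derivative of a jet spends one order, and this is
what the grading records. -/
theorem JetRel.dRel {A ι : Type*} [CommRing A] (φ : ℕ →*₀ ℝ) (e : A →+* ℝ) {D : ι → A → A}
    (hadd : ∀ k f g, D k (f + g) = D k f + D k g)
    (hmul : ∀ k f g, D k (f * g) = D k f * g + f * D k g) :
    DRel (JetRel φ e D) Jet.D D := by
  have h0 : ∀ k, D k 0 = 0 := fun k => by simpa using hadd k 0 0
  have hneg : ∀ k f, D k (-f) = -D k f := fun k f => by
    rw [eq_neg_iff_add_eq_zero, ← hadd, neg_add_cancel, h0]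
  have a1 : ∀ (J : List ι) (f g : A), J.foldl (fun g k => D k g) (f + g)
      = J.foldl (fun g k => D k g) f + J.foldl (fun g k => D k g) g := by
    intro J
    induction J with
    | nil => intros; rfl
    | cons k J IH => intro f g; simp only [List.foldl_cons, hadd, IH]
  have a2 : ∀ (J : List ι) (f : A), J.foldl (fun g k => D k g) (-f)
      = -J.foldl (fun g k => D k g) f := by
    intro J
    induction J with
    | nil => intros; rfl
    | cons k J IH => intro f; simp only [List.foldl_cons, hneg, IH]
  have a3 : ∀ J : List ι, J.foldl (fun g k => D k g) (0 : A) = 0 := by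
    intro J
    induction J with
    | nil => rfl
    | cons k J IH => simp only [List.foldl_cons, h0, IH]
  refine ⟨?_, ?_, ?_, ?_, ?_, ?_⟩
  · intro n a b a' b' h1 h2 J hJ
    rw [a1, map_add, ← h1 J hJ, ← h2 J hJ]
    exact Poly.ev_add φ _ _
  · intro n a b a' b' h1 h2 J hJ
    change Poly.ev φ (Jet.mul a a' J) = _
    induction J generalizing a a' b b' n with
    | nil =>
      simp only [Jet.mul, List.foldl_nil, map_mul, Poly.ev_mul]
      rw [h1 [] (Nat.zero_le _), h2 [] (Nat.zero_le _)]; rfl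
    | cons k J IH =>
      obtain ⟨n, rfl⟩ : ∃ k, n = k + 1 := ⟨n - 1, by simp at hJ; omega⟩
      have hJ' : J.length ≤ n := by simpa using hJ
      have s1 : JetRel φ e D n (fun L => a (k :: L)) (D k b) := fun L hL =>
        h1 (k :: L) (by simpa using hL)
      have s2 : JetRel φ e D n (fun L => a' (k :: L)) (D k b') := fun L hL =>
        h2 (k :: L) (by simpa using hL)
      have t1 : JetRel φ e D n a b := fun L hL => h1 L (by omega)
      have t2 : JetRel φ e D n a' b' := fun L hL => h2 L (by omega)
      rw [Jet.mul, Poly.ev_add, IH s1 t2 hJ', IH t1 s2 hJ', List.foldl_cons, hmul, a1, map_add]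
  · intro n a b h J hJ
    rw [a2, map_neg, ← h J hJ]
    exact Poly.ev_neg φ _
  · intro n J hJ
    rw [a3, map_zero]; rfl
  · intro n a b k h J hJ
    exact h (k :: J) (by simpa using hJ)
  · intro n a b h J hJ
    exact h J (by omega)

/-! ### The components of the Nambu bivector in a frame -/

section Frame

variable {A : Type*} [Add A] [Mul A] [Neg A] [Zero A]

def minor {d : ℕ} (D : Fin d → A → A) (f g : A) (k l : Fin d) : A :=
  D k f * D l g + -(D l f * D k g)

/-- The components of the Nambu bivector over dimension four. -/
def nambuFour (D : Fin 4 → A → A) (f g : A) (i j : Fin 4) : A :=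
  match i.1, j.1 with
  | 0, 1 => minor D f g ⟨2, by decide⟩ ⟨3, by decide⟩
  | 0, 2 => minor D f g ⟨3, by decide⟩ ⟨1, by decide⟩
  | 0, 3 => minor D f g ⟨1, by decide⟩ ⟨2, by decide⟩
  | 1, 0 => minor D f g ⟨3, by decide⟩ ⟨2, by decide⟩
  | 2, 0 => minor D f g ⟨1, by decide⟩ ⟨3, by decide⟩
  | 3, 0 => minor D f g ⟨2, by decide⟩ ⟨1, by decide⟩
  | 1, 2 => minor D f g ⟨0, by decide⟩ ⟨3, by decide⟩
  | 1, 3 => minor D f g ⟨2, by decide⟩ ⟨0, by decide⟩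
  | 2, 3 => minor D f g ⟨0, by decide⟩ ⟨1, by decide⟩
  | 2, 1 => minor D f g ⟨3, by decide⟩ ⟨0, by decide⟩
  | 3, 1 => minor D f g ⟨0, by decide⟩ ⟨2, by decide⟩
  | 3, 2 => minor D f g ⟨1, by decide⟩ ⟨0, by decide⟩
  | _, _ => 0

/-- The second derivatives of the Nambu bivector acting on both Casimirs. -/
def mixedFour (D : Fin 4 → A → A) (f g : A) (j s k n : Fin 4) : A :=
  nambuFour D (D j f) (D s g) k n + nambuFour D (D s f) (D j g) k n

/-- The components of the Nambu bivector over dimension three. -/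
def nambuThree (D : Fin 3 → A → A) (f : A) (i j : Fin 3) : A :=
  match i.1, j.1 with
  | 0, 1 => D ⟨2, by decide⟩ f
  | 1, 0 => -D ⟨2, by decide⟩ f
  | 1, 2 => D ⟨0, by decide⟩ f
  | 2, 1 => -D ⟨0, by decide⟩ f
  | 2, 0 => D ⟨1, by decide⟩ f
  | 0, 2 => -D ⟨1, by decide⟩ f
  | _, _ => 0

end Frame

namespace DRel

variable {A B : Type*} [Add A] [Mul A] [Neg A] [Zero A] [Add B] [Mul B] [Neg B] [Zero B]
  {R : ℕ → A → B → Prop}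

theorem nambuFour {D : Fin 4 → A → A} {D' : Fin 4 → B → B} (h : DRel R D D') {n : ℕ}
    {f g : A} {f' g' : B} (hf : R (n + 1) f f') (hg : R (n + 1) g g') (i j : Fin 4) :
    R n (NambuFlow.nambuFour D f g i j) (NambuFlow.nambuFour D' f' g' i j) := by
  have hm : ∀ k l, R n (minor D f g k l) (minor D' f' g' k l) := fun k l =>
    h.add (h.mul (h.der _ hf) (h.der _ hg)) (h.neg (h.mul (h.der _ hf) (h.der _ hg)))
  fin_cases i <;> fin_cases j <;> first | exact hm _ _ | exact h.zero

theorem mixedFour {D : Fin 4 → A → A} {D' : Fin 4 → B → B} (h : DRel R D D') {n : ℕ}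
    {f g : A} {f' g' : B} (hf : R (n + 2) f f') (hg : R (n + 2) g g') (v w i j : Fin 4) :
    R n (NambuFlow.mixedFour D f g v w i j) (NambuFlow.mixedFour D' f' g' v w i j) :=
  h.add (h.nambuFour (h.der _ hf) (h.der _ hg) _ _) (h.nambuFour (h.der _ hf) (h.der _ hg) _ _)

theorem nambuThree {D : Fin 3 → A → A} {D' : Fin 3 → B → B} (h : DRel R D D') {n : ℕ}
    {f : A} {f' : B} (hf : R (n + 1) f f') (i j : Fin 3) :
    R n (NambuFlow.nambuThree D f i j) (NambuFlow.nambuThree D' f' i j) := by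
  fin_cases i <;> fin_cases j <;>
    first | exact h.der _ hf | exact h.neg (h.der _ hf) | exact h.zero

end DRel

/-! ### Generic jets in normal form -/

/-- A table of codes of variables, indexed by sorted lists of indices. -/
inductive Trie : Type
  | o : Trie
  | z (v : ℕ) : Trie
  | n (v : ℕ) (a b c d : Trie) : Trie

namespace Trie

/-- Code 0, also the default outside the table, denotes the zero polynomial and code 1 the constant
1. These two codes carry the prescribed values of the normal form; the other entries are primes
naming free variables. -/
def get : List ℕ → Trie → ℕ
  | _, o => 0
  | [], z v => v
  | _ :: _, z _ => 0
  | [], n v _ _ _ _ => v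
  | i :: J, n _ a b c d =>
    match i with
    | 0 => get J a
    | 1 => get J b
    | 2 => get J c
    | _ => get J d

def insert (a : ℕ) : List ℕ → List ℕ
  | [] => [a]
  | b :: l => bif Nat.ble a b then a :: b :: l else b :: insert a l

def sort : List ℕ → List ℕ
  | [] => []
  | a :: l => insert a (sort l)

theorem insert_perm (a : ℕ) (l : List ℕ) : (insert a l).Perm (a :: l) := by
  induction l with
  | nil => exact List.Perm.refl _
  | cons b l IH =>
    rw [insert]
    cases Nat.ble a b
    · exact (IH.cons b).trans (List.Perm.swap a b l)
    · exact List.Perm.refl _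

theorem sort_perm (l : List ℕ) : (sort l).Perm l := by
  induction l with
  | nil => exact List.Perm.refl _
  | cons a l IH => exact (insert_perm a _).trans (IH.cons a)

/-- The jet whose derivatives are the variables in a table. -/
def jet {d : ℕ} (t : Trie) : Jet Poly (Fin d) := fun J =>
  Poly.var (get (sort (J.map Fin.val)) t)

/-- The variables for the jet of the density. -/
def rhoTrie : Trie :=
  (n 2 (n 3 (n 13 (n 53 (z 151) (z 157) (z 163) (z 167)) (n 59 o (z 173) (z 179) (z 181)) (n 61 o
  o (z 191) (z 193)) (n 67 o o o (z 197))) (n 17 o (n 71 o (z 199) (z 211) (z 223)) (n 73 o o (z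
  227) (z 229)) (n 79 o o o (z 233))) (n 19 o o (n 83 o o (z 239) (z 241)) (n 89 o o o (z 251)))
  (n 23 o o o (n 97 o o o (z 257)))) (n 5 o (n 29 o (n 101 o (z 263) (z 269) (z 271)) (n 103 o o
  (z 277) (z 281)) (n 107 o o o (z 283))) (n 31 o o (n 109 o o (z 293) (z 307)) (n 113 o o o (z
  311))) (n 37 o o o (n 127 o o o (z 313)))) (n 7 o o (n 41 o o (n 131 o o (z 317) (z 331)) (n 137
  o o o (z 337))) (n 43 o o o (n 139 o o o (z 347)))) (n 11 o o o (n 47 o o o (n 149 o o o (z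
  349)))))

/-- The variables for the jet of the first Casimir, in normal form. -/
def fstTrie : Trie :=
  (n 353 (n 0 (n 1 (n 379 (z 499) (z 503) (z 509) (z 521)) (n 383 o (z 523) (z 541) (z 547)) (n
  389 o o (z 557) (z 563)) (n 397 o o o (z 569))) (n 0 o (n 401 o (z 571) (z 577) (z 587)) (n 409
  o o (z 593) (z 599)) (n 419 o o o (z 601))) (n 0 o o (n 421 o o (z 607) (z 613)) (n 431 o o o (z
  617))) (n 0 o o o (n 433 o o o (z 619)))) (n 0 o (n 1 o (n 439 o (z 631) (z 641) (z 643)) (n 443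
  o o (z 647) (z 653)) (n 449 o o o (z 659))) (n 0 o o (n 457 o o (z 661) (z 673)) (n 461 o o o (z
  677))) (n 0 o o o (n 463 o o o (z 683)))) (n 1 o o (n 359 o o (n 467 o o (z 691) (z 701)) (n 479
  o o o (z 709))) (n 367 o o o (n 487 o o o (z 719)))) (n 0 o o o (n 373 o o o (n 491 o o o (z
  727)))))

/-- The variables for the jet of the second Casimir, in normal form. -/
def sndTrie : Trie :=
  (n 733 (n 0 (n 0 (n 797 (z 937) (z 941) (z 947) (z 953)) (n 809 o (z 967) (z 971) (z 977)) (n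
  811 o o (z 983) (z 991)) (n 821 o o o (z 997))) (n 0 o (n 823 o (z 1009) (z 1013) (z 1019)) (n
  827 o o (z 1021) (z 1031)) (n 829 o o o (z 1033))) (n 739 o o (n 839 o o (z 1039) (z 1049)) (n
  853 o o o (z 1051))) (n 743 o o o (n 857 o o o (z 1061)))) (n 0 o (n 751 o (n 859 o (z 1063) (z
  1069) (z 1087)) (n 863 o o (z 1091) (z 1093)) (n 877 o o o (z 1097))) (n 757 o o (n 881 o o (z
  1103) (z 1109)) (n 883 o o o (z 1117))) (n 761 o o o (n 887 o o o (z 1123)))) (n 0 o o (n 769 o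
  o (n 907 o o (z 1129) (z 1151)) (n 911 o o o (z 1153))) (n 773 o o o (n 919 o o o (z 1163)))) (n
  1 o o o (n 787 o o o (n 929 o o o (z 1171)))))

end Trie

/-! ### Kernel verification of the identities in normal form -/

open Trie NambuFlow.Expr

set_option maxRecDepth 1000000

def diagFour : List (Fin 4 × Fin 4) :=
  [(⟨0, by decide⟩, ⟨0, by decide⟩), (⟨1, by decide⟩, ⟨1, by decide⟩),
    (⟨2, by decide⟩, ⟨2, by decide⟩), (⟨3, by decide⟩, ⟨3, by decide⟩)]

def diagThree : List (Fin 3 × Fin 3) :=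
  [(⟨0, by decide⟩, ⟨0, by decide⟩), (⟨1, by decide⟩, ⟨1, by decide⟩),
    (⟨2, by decide⟩, ⟨2, by decide⟩)]

def genericN : Fin 4 → Fin 4 → Jet Poly (Fin 4) := nambuFour Jet.D (jet fstTrie) (jet sndTrie)

def genericH : Fin 4 → Fin 4 → Fin 4 → Fin 4 → Jet Poly (Fin 4) :=
  mixedFour Jet.D (jet fstTrie) (jet sndTrie)

set_option maxRecDepth 1000000

/-- Only four of the six components are expanded. The normal form singles out frame vector 0 by a
vanishing second derivative of the second Casimir, and the components 12 and 13 follow from 02 and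
03 by exchanging the first two frame vectors. -/
theorem generic_defect_01 : (defect diagFour Jet.D (jet rhoTrie) genericN genericH
    ⟨0, by decide⟩ ⟨1, by decide⟩ []).isZero = true := by decide +kernel

theorem generic_defect_02 : (defect diagFour Jet.D (jet rhoTrie) genericN genericH
    ⟨0, by decide⟩ ⟨2, by decide⟩ []).isZero = true := by decide +kernel

theorem generic_defect_03 : (defect diagFour Jet.D (jet rhoTrie) genericN genericH
    ⟨0, by decide⟩ ⟨3, by decide⟩ []).isZero = true := by decide +kernel

theorem generic_defect_23 : (defect diagFour Jet.D (jet rhoTrie) genericN genericH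
    ⟨2, by decide⟩ ⟨3, by decide⟩ []).isZero = true := by decide +kernel

theorem generic_casDefect_fst : (casDefect diagFour Jet.D (jet rhoTrie) genericN genericH
    (jet fstTrie) []).isZero = true := by decide +kernel

theorem generic_casDefect_snd : (casDefect diagFour Jet.D (jet rhoTrie) genericN genericH
    (jet sndTrie) []).isZero = true := by decide +kernel

/-- With a single Casimir there is no pair of different Casimirs to differentiate, so the mixed term
`H` is zero. -/
theorem generic_defectThree_01 : (defect diagThree Jet.D (jet rhoTrie)
    (nambuThree Jet.D (jet fstTrie)) 0 ⟨0, by decide⟩ ⟨1, by decide⟩ []).isZero = true := by decide +kernel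

theorem generic_defectThree_02 : (defect diagThree Jet.D (jet rhoTrie)
    (nambuThree Jet.D (jet fstTrie)) 0 ⟨0, by decide⟩ ⟨2, by decide⟩ []).isZero = true := by decide +kernel

theorem generic_defectThree_12 : (defect diagThree Jet.D (jet rhoTrie)
    (nambuThree Jet.D (jet fstTrie)) 0 ⟨1, by decide⟩ ⟨2, by decide⟩ []).isZero = true := by decide +kernel

theorem generic_casDefectThree : (casDefect diagThree Jet.D (jet rhoTrie)
    (nambuThree Jet.D (jet fstTrie)) 0 (jet fstTrie) []).isZero = true := by decide +kernel

set_option maxRecDepth 1000000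

/-! ### Valuations of the variables -/

/-- The multiplicative extension of a function on the primes. -/
def primeValuation (val : ℕ → ℝ) : ℕ →*₀ ℝ where
  toFun n := if n = 0 then 0 else n.factorization.prod fun p k => val p ^ k
  map_zero' := by simp
  map_one' := by simp
  map_mul' a b := by
    by_cases ha : a = 0
    · simp [ha]
    by_cases hb : b = 0
    · simp [hb]
    simp only [mul_eq_zero, ha, hb, or_self, if_false]
    rw [Nat.factorization_mul ha hb]
    exact Finsupp.prod_add_index' (by simp) (fun p m n => pow_add _ _ _)

theorem primeValuation_prime (val : ℕ → ℝ) {p : ℕ} (hp : p.Prime) :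
    primeValuation val p = val p := by
  change (if p = 0 then 0 else _) = _
  rw [if_neg hp.ne_zero, hp.factorization, Finsupp.prod_single_index] <;> simp

/-! ### Decoding the variables and checking the tables -/

namespace Trie

/-- The lists of a given length with entries below four. -/
def listsOfLength : ℕ → List (List ℕ)
  | 0 => [[]]
  | l + 1 => (listsOfLength l).flatMap fun J => [0 :: J, 1 :: J, 2 :: J, 3 :: J]

def shortLists : List (List ℕ) :=
  listsOfLength 0 ++ listsOfLength 1 ++ listsOfLength 2 ++ listsOfLength 3 ++ listsOfLength 4

theorem mem_listsOfLength {n : ℕ} {J : List ℕ} (h : ∀ i ∈ J, i < 4) (hJ : J.length = n) :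
    J ∈ listsOfLength n := by
  induction J generalizing n with
  | nil => subst hJ; simp [listsOfLength]
  | cons i J IH =>
    subst hJ
    have := IH (fun i hi => h i (List.mem_cons_of_mem _ hi)) rfl
    simp only [List.length_cons, listsOfLength, List.mem_flatMap]
    refine ⟨J, this, ?_⟩
    have : i < 4 := h i List.mem_cons_self
    interval_cases i <;> simp

theorem mem_shortLists {J : List ℕ} (h : ∀ i ∈ J, i < 4) (hJ : J.length ≤ 4) :
    J ∈ shortLists := by
  have := mem_listsOfLength h rfl
  simp only [shortLists, List.mem_append]
  generalize J.length = n at *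
  interval_cases n <;> simp [this]

def sortedLists : List (List ℕ) := shortLists.filter fun J => decide (sort J = J)

theorem sort_mem_sortedLists : ∀ J ∈ shortLists, sort J ∈ sortedLists := by decide +kernel

def table : ℕ → Trie
  | 0 => rhoTrie
  | 1 => fstTrie
  | _ => sndTrie

/-- The variables with their codes. -/
def decoding : List (ℕ × ℕ × List ℕ) :=
  [0, 1, 2].flatMap fun k => sortedLists.map fun J => (get J (table k), k, J)

def smallPrime (p : ℕ) : Bool :=
  decide (2 ≤ p) && decide (p < 1600) &&
    (List.range 40).all fun m => decide (m < 2) || decide (p ≤ m) || !decide (p % m = 0)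

/-- A composite number below 1600 = 40² has its least prime factor below 40, so trial division by
the numbers below 40 suffices. -/
theorem prime_of_smallPrime {p : ℕ} (h : smallPrime p = true) : p.Prime := by
  simp only [smallPrime, Bool.and_eq_true, decide_eq_true_eq, List.all_eq_true, List.mem_range,
    Bool.or_eq_true, Bool.not_eq_true', decide_eq_false_iff_not] at h
  obtain ⟨⟨h2, hp⟩, h⟩ := h
  by_contra hn
  have h3 := Nat.minFac_sq_le_self (by omega) hn
  have h4 : p.minFac < 40 := by nlinarith
  rcases h _ h4 with (h5 | h5) | h5
  · have := (Nat.minFac_prime (n := p) (by omega)).two_le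
    omega
  · have := (Nat.minFac_prime (n := p) (by omega)).two_le
    nlinarith
  · exact h5 (Nat.mod_eq_zero_of_dvd (Nat.minFac_dvd p))

/-- Looking up the code returns the very entry it came from, so different variables carry different
primes and a valuation of the primes can be prescribed freely. -/
def decoded (k : ℕ) (J : List ℕ) : Bool :=
  smallPrime (get J (table k)) &&
    decide (decoding.find? (fun q => Nat.beq q.1 (get J (table k))) = some (get J (table k), k, J))

/-- Either a prescribed value of the jet, or a variable. -/
def checked (k : ℕ) (norm : List ℕ → Option ℕ) (J : List ℕ) : Bool :=
  match norm J with
  | some v => Nat.beq (get J (table k)) v && Nat.ble v 1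
  | none => decoded k J

/-- The prescribed derivatives of the first Casimir. -/
def normFst : List ℕ → Option ℕ
  | [i] => some (if i = 2 then 1 else 0)
  | [i, j] => if i < 2 ∨ j < 2 then some (if i = j then 1 else 0) else none
  | _ => none

/-- The prescribed derivatives of the second Casimir. -/
def normSnd : List ℕ → Option ℕ
  | [i] => some (if i = 3 then 1 else 0)
  | [i, j] => if i + j ≤ 1 then some 0 else none
  | _ => none

theorem checked_rho : ∀ J ∈ sortedLists, checked 0 (fun _ => none) J = true := by decide +kernel

theorem checked_fst : ∀ J ∈ sortedLists, checked 1 normFst J = true := by decide +kernel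

theorem checked_snd : ∀ J ∈ sortedLists, checked 2 normSnd J = true := by decide +kernel

end Trie

section Valuation

variable {A : Type*} [CommRing A] {d : ℕ} [NeZero d] {D : Fin d → A → A}

theorem foldl_perm (hcomm : ∀ i j f, D i (D j f) = D j (D i f)) {J K : List (Fin d)}
    (h : J.Perm K) (f : A) : J.foldl (fun g k => D k g) f = K.foldl (fun g k => D k g) f :=
  haveI : RightCommutative (fun (g : A) k => D k g) := ⟨fun g i j => hcomm j i g⟩
  h.foldl_eq f

/-- The valuation of the codes by the derivatives of given elements. -/
def jetValuation (D : Fin d → A → A) (e : A →+* ℝ) (w : ℕ → A) : ℕ →*₀ ℝ :=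
  primeValuation fun p =>
    match decoding.find? fun q => Nat.beq q.1 p with
    | some q => e ((q.2.2.map (Fin.ofNat d)).foldl (fun g k => D k g) (w q.2.1))
    | none => 0

theorem map_ofNat_val (J : List (Fin d)) : (J.map Fin.val).map (Fin.ofNat d) = J := by
  rw [List.map_map]
  conv_rhs => rw [← List.map_id J]
  exact List.map_congr_left fun i _ => by simp

/-- Derivatives commute, so sorting the list of indices changes nothing. The table entry is then
either a prescribed 0 or 1, on which every valuation agrees, or a prime that the valuation sends,
via decoding, to the required derivative. -/
theorem jetRel_table (hd : d ≤ 4) (hcomm : ∀ i j f, D i (D j f) = D j (D i f)) (e : A →+* ℝ)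
    (w : ℕ → A) (k : ℕ) (norm : List ℕ → Option ℕ)
    (hk : ∀ J ∈ sortedLists, checked k norm J = true)
    (hnorm : ∀ (J : List (Fin d)) (v : ℕ), norm (J.map Fin.val) = some v →
      e (J.foldl (fun g k => D k g) (w k)) = v) :
    JetRel (jetValuation D e w) e D 4 (jet (table k)) (w k) := by
  intro J hJ
  have hlt : ∀ i ∈ J.map Fin.val, i < d := fun i hi => by
    obtain ⟨a, -, rfl⟩ := List.mem_map.1 hi
    exact a.2
  have hmem : J.map Fin.val ∈ shortLists :=
    mem_shortLists (fun i hi => (hlt i hi).trans_le hd) (by simpa using hJ)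
  have h := hk _ (sort_mem_sortedLists _ hmem)
  have hp := sort_perm (J.map Fin.val)
  rw [jet, Poly.ev_var]
  generalize sort (J.map Fin.val) = K at *
  obtain ⟨L, rfl⟩ : ∃ L : List (Fin d), K = L.map Fin.val := by
    refine ⟨K.map (Fin.ofNat d), ?_⟩
    rw [List.map_map]
    conv_lhs => rw [← List.map_id K]
    refine List.map_congr_left fun i hi => ?_
    simp [Nat.mod_eq_of_lt (hlt i (hp.subset hi))]
  have hp' : L.Perm J := by
    have := hp.map (Fin.ofNat d)
    rwa [map_ofNat_val, map_ofNat_val] at this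
  rw [← foldl_perm hcomm hp']
  unfold checked at h
  cases hn : norm (L.map Fin.val) with
  | some v =>
    rw [hn] at h
    simp only [Bool.and_eq_true] at h
    rw [hnorm L v hn, Nat.eq_of_beq_eq_true h.1]
    have hv := Nat.le_of_ble_eq_true h.2
    interval_cases v <;> simp
  | none =>
    rw [hn] at h
    simp only [decoded, Bool.and_eq_true, decide_eq_true_eq] at h
    rw [jetValuation, primeValuation_prime _ (prime_of_smallPrime h.1), h.2]
    simp only [map_ofNat_val]

end Valuation

/-! ### The identities in normal form -/

/-- A commutative ring with commuting derivations. -/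
structure CommDer {A ι : Type*} [CommRing A] (D : ι → A → A) : Prop where
  add : ∀ k f g, D k (f + g) = D k f + D k g
  mul : ∀ k f g, D k (f * g) = D k f * g + f * D k g
  comm : ∀ i j f, D i (D j f) = D j (D i f)

/-- The values of the derivatives of two Casimirs in normal form over dimension four. -/
structure NormalFour {A : Type*} [CommRing A] (D : Fin 4 → A → A) (e : A →+* ℝ) (f g : A) :
    Prop where
  fst_one : ∀ i, e (D i f) = if i = 2 then 1 else 0
  fst_two : ∀ i j, i = 0 ∨ i = 1 → e (D i (D j f)) = if i = j then 1 else 0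
  snd_one : ∀ i, e (D i g) = if i = 3 then 1 else 0
  snd_zero_zero : e (D 0 (D 0 g)) = 0
  snd_zero_one : e (D 0 (D 1 g)) = 0

section Checks

variable {A : Type*} [CommRing A]

theorem jetRel_rho {d : ℕ} [NeZero d] (hd : d ≤ 4) {D : Fin d → A → A} (hD : CommDer D)
    (e : A →+* ℝ) (w : ℕ → A) : JetRel (jetValuation D e w) e D 4 (jet rhoTrie) (w 0) :=
  jetRel_table hd hD.comm e w 0 _ checked_rho (by simp)

theorem jetRel_fst {d : ℕ} [NeZero d] (hd : d ≤ 4) {D : Fin d → A → A} (hD : CommDer D)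
    (e : A →+* ℝ) (w : ℕ → A) (h1 : ∀ i, e (D i (w 1)) = if i.1 = 2 then 1 else 0)
    (h2 : ∀ i j, i.1 < 2 → e (D i (D j (w 1))) = if i = j then 1 else 0) :
    JetRel (jetValuation D e w) e D 4 (jet fstTrie) (w 1) := by
  refine jetRel_table hd hD.comm e w 1 _ checked_fst fun J v hJ => ?_
  match J with
  | [] => simp [normFst] at hJ
  | [i] =>
    simp only [List.map_cons, List.map_nil, normFst, Option.some.injEq] at hJ
    rw [← hJ]; simp [h1]
  | [i, j] =>
    simp only [List.map_cons, List.map_nil, normFst] at hJ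
    split_ifs at hJ with h3 h4
    all_goals
      simp only [Option.some.injEq] at hJ
      rw [← hJ]
      simp only [List.foldl_cons, List.foldl_nil]
      rcases h3 with h3 | h3
      · rw [hD.comm, h2 i j h3]; simp [Fin.ext_iff, h4]
      · rw [h2 j i h3]; simp [Fin.ext_iff, h4, Ne.symm]
        try omega
  | _ :: _ :: _ :: _ => simp [normFst] at hJ

theorem jetRel_snd {D : Fin 4 → A → A} (hD : CommDer D)
    (e : A →+* ℝ) (w : ℕ → A) {f : A} (h : NormalFour D e f (w 2)) :
    JetRel (jetValuation D e w) e D 4 (jet sndTrie) (w 2) := by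
  refine jetRel_table le_rfl hD.comm e w 2 _ checked_snd fun J v hJ => ?_
  match J with
  | [] => simp [normSnd] at hJ
  | [i] =>
    simp only [List.map_cons, List.map_nil, normSnd, Option.some.injEq] at hJ
    rw [← hJ]; simp [h.snd_one, Fin.ext_iff]
  | [i, j] =>
    simp only [List.map_cons, List.map_nil, normSnd] at hJ
    split_ifs at hJ with h3
    simp only [Option.some.injEq] at hJ
    rw [← hJ]
    simp only [List.foldl_cons, List.foldl_nil]
    have : (i = 0 ∧ j = 0) ∨ (i = 0 ∧ j = 1) ∨ (i = 1 ∧ j = 0) := by omega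
    rcases this with ⟨rfl, rfl⟩ | ⟨rfl, rfl⟩ | ⟨rfl, rfl⟩
    · simpa using h.snd_zero_zero
    · rw [hD.comm]; simpa using h.snd_zero_one
    · simpa using h.snd_zero_one
  | _ :: _ :: _ :: _ => simp [normSnd] at hJ

theorem JetRel.mono_le {ι : Type*} {φ : ℕ →*₀ ℝ} {e : A →+* ℝ} {D : ι → A → A} {n k : ℕ}
    {f : Jet Poly ι} {w : A} (h : JetRel φ e D n f w) (hk : k ≤ n) : JetRel φ e D k f w :=
  fun J hJ => h J (hJ.trans hk)

theorem eval_eq_zero {ι : Type*} {φ : ℕ →*₀ ℝ} {e : A →+* ℝ} {D : ι → A → A}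
    {f : Jet Poly ι} {w : A} (h : JetRel φ e D 0 f w) (hf : (f []).isZero = true) : e w = 0 := by
  have := h [] le_rfl
  rw [Poly.ev_of_isZero φ hf] at this
  exact this.symm

end Checks

section Normal

variable {A : Type*} [CommRing A]

/-- Parametricity says that the expression over formal jets evaluates to the same expression over
the ring; the former has been computed to be the zero polynomial. -/
theorem normalFour_zero {D : Fin 4 → A → A} (hD : CommDer D) (e : A →+* ℝ) (ρ f g : A)
    (h : NormalFour D e f g) :
    (e (defect diagFour D ρ (nambuFour D f g) (mixedFour D f g) 0 1) = 0 ∧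
      e (defect diagFour D ρ (nambuFour D f g) (mixedFour D f g) 0 2) = 0 ∧
      e (defect diagFour D ρ (nambuFour D f g) (mixedFour D f g) 0 3) = 0 ∧
      e (defect diagFour D ρ (nambuFour D f g) (mixedFour D f g) 2 3) = 0) ∧
    e (casDefect diagFour D ρ (nambuFour D f g) (mixedFour D f g) f) = 0 ∧
    e (casDefect diagFour D ρ (nambuFour D f g) (mixedFour D f g) g) = 0 := by
  -- The numbering of the three functions is that of `table`.
  let w : ℕ → A := fun k => match k with | 0 => ρ | 1 => f | _ => g
  have r0 := jetRel_rho le_rfl hD e w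
  have r1 := jetRel_fst le_rfl hD e w (fun i => (h.fst_one i).trans (by simp [Fin.ext_iff]))
    (fun i j hi => h.fst_two i j (by omega))
  have r2 := jetRel_snd hD e w (f := f) h
  have hd := JetRel.dRel (jetValuation D e w) e hD.add hD.mul
  have hN := fun i j => hd.nambuFour (n := 3) r1 r2 i j
  have hH := fun v w i j => hd.mixedFour (n := 1) (r1.mono_le (by omega)) (r2.mono_le (by omega))
    v w i j
  have hE := fun i j => hd.defect (l := diagFour) (n := 0) r0 hN hH i j
  have hC := fun c c' (hc : JetRel (jetValuation D e w) e D 4 c c') =>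
    hd.casDefect (l := diagFour) (n := 0)
    (r0.mono_le (by omega)) (fun i j => (hN i j).mono_le (by omega))
    (fun v w i j => (hH v w i j).mono_le (by omega)) (hc.mono_le (n := 4) (k := 3) (by omega))
  exact ⟨⟨eval_eq_zero (hE _ _) generic_defect_01, eval_eq_zero (hE _ _) generic_defect_02,
    eval_eq_zero (hE _ _) generic_defect_03, eval_eq_zero (hE _ _) generic_defect_23⟩,
    eval_eq_zero (hC _ _ r1) generic_casDefect_fst, eval_eq_zero (hC _ _ r2) generic_casDefect_snd⟩

theorem normalThree_zero {D : Fin 3 → A → A} (hD : CommDer D) (e : A →+* ℝ) (ρ f : A)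
    (h1 : ∀ i, e (D i f) = if i = 2 then 1 else 0)
    (h2 : ∀ i j, i = 0 ∨ i = 1 → e (D i (D j f)) = if i = j then 1 else 0) :
    (e (defect diagThree D ρ (nambuThree D f) 0 0 1) = 0 ∧
      e (defect diagThree D ρ (nambuThree D f) 0 0 2) = 0 ∧
      e (defect diagThree D ρ (nambuThree D f) 0 1 2) = 0) ∧
    e (casDefect diagThree D ρ (nambuThree D f) 0 f) = 0 := by
  let w : ℕ → A := fun k => match k with | 0 => ρ | _ => f
  have r0 := jetRel_rho (by omega) hD e w
  have r1 := jetRel_fst (by omega) hD e w (fun i => (h1 i).trans (by simp [Fin.ext_iff]))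
    (fun i j hi => h2 i j (by omega))
  have hd := JetRel.dRel (jetValuation D e w) e hD.add hD.mul
  have hN := fun i j => hd.nambuThree (n := 3) r1 i j
  have hE := fun i j => hd.defect (l := diagThree) (n := 0) r0 hN (fun _ _ _ _ => hd.zero) i j
  have hC := hd.casDefect (l := diagThree) (n := 0)
    (r0.mono_le (by omega)) (fun i j => (hN i j).mono_le (by omega))
    (fun _ _ _ _ => hd.zero) (r1.mono_le (k := 3) (by omega))
  exact ⟨⟨eval_eq_zero (hE _ _) generic_defectThree_01, eval_eq_zero (hE _ _) generic_defectThree_02,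
    eval_eq_zero (hE _ _) generic_defectThree_12⟩, eval_eq_zero hC generic_casDefectThree⟩

end Normal

/-! ## The ring of smooth functions -/

/-- Smooth functions on `ℝᵈ`. -/
def Smooth (d : ℕ) : Subalgebra ℝ (Scalar d) where
  carrier := {f | ContDiff ℝ ∞ f}
  mul_mem' {f g} hf hg := by
    rw [Set.mem_ofPred_eq] at *; exact hf.mul hg
  add_mem' {f g} hf hg := by
    rw [Set.mem_ofPred_eq] at *; exact hf.add hg
  algebraMap_mem' r := by
    change ContDiff ℝ ∞ fun _ => r
    exact contDiff_const

variable {d : ℕ}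

theorem contDiff_coe (f : Smooth d) : ContDiff ℝ ∞ (f : Scalar d) := f.2

theorem differentiable_coe (f : Smooth d) : Differentiable ℝ (f : Scalar d) :=
  (contDiff_coe f).differentiable (by simp)

theorem contDiff_dirDeriv {f : Scalar d} (hf : ContDiff ℝ ∞ f) (v : Space d) :
    ContDiff ℝ ∞ fun x => fderiv ℝ f x v :=
  (hf.fderiv_right (by simp)).clm_apply contDiff_const

theorem contDiff_pd {f : Scalar d} (hf : ContDiff ℝ ∞ f) (i : Fin d) : ContDiff ℝ ∞ (pd i f) :=
  contDiff_dirDeriv hf _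

theorem contDiff_pds {f : Scalar d} (hf : ContDiff ℝ ∞ f) (J : List (Fin d)) :
    ContDiff ℝ ∞ (pds J f) := by
  induction J with
  | nil => exact hf
  | cons i J IH => exact contDiff_pd IH i

/-- The directional derivative of smooth functions. -/
def dir (v : Space d) (f : Smooth d) : Smooth d :=
  ⟨fun x => fderiv ℝ (f : Scalar d) x v, contDiff_dirDeriv (contDiff_coe f) v⟩

/-- The evaluation of smooth functions at a point. -/
def evalAt (x : Space d) : Smooth d →+* ℝ := (Pi.evalRingHom _ x).comp (Smooth d).val.toRingHom

theorem evalAt_apply (x : Space d) (f : Smooth d) : evalAt x f = (f : Scalar d) x := rfl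

theorem Smooth.ext_eval {f g : Smooth d} (h : ∀ x, evalAt x f = evalAt x g) : f = g :=
  Subtype.ext (funext h)

theorem evalAt_smul (x : Space d) (r : ℝ) (f : Smooth d) : evalAt x (r • f) = r * evalAt x f := rfl

theorem evalAt_dir (x : Space d) (v : Space d) (f : Smooth d) :
    evalAt x (dir v f) = fderiv ℝ (f : Scalar d) x v := rfl

theorem dir_add (v : Space d) (f g : Smooth d) : dir v (f + g) = dir v f + dir v g := by
  refine Smooth.ext_eval fun x => ?_
  rw [map_add, evalAt_dir, evalAt_dir, evalAt_dir]
  change fderiv ℝ ((f : Scalar d) + (g : Scalar d)) x v = _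
  rw [fderiv_add (differentiable_coe f x) (differentiable_coe g x)]; rfl

theorem dir_mul (v : Space d) (f g : Smooth d) : dir v (f * g) = dir v f * g + f * dir v g := by
  refine Smooth.ext_eval fun x => ?_
  rw [map_add, map_mul, map_mul, evalAt_dir, evalAt_dir, evalAt_dir]
  change fderiv ℝ ((f : Scalar d) * (g : Scalar d)) x v = _
  rw [fderiv_mul (differentiable_coe f x) (differentiable_coe g x)]
  simp [evalAt_apply]; ring

theorem dir_algebraMap (v : Space d) (r : ℝ) : dir v (algebraMap ℝ (Smooth d) r) = 0 := by
  refine Smooth.ext_eval fun x => ?_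
  rw [evalAt_dir]
  change fderiv ℝ (fun _ => r) x v = 0
  simp

theorem dir_smul (v : Space d) (r : ℝ) (f : Smooth d) : dir v (r • f) = r • dir v f := by
  rw [Algebra.smul_def, dir_mul, dir_algebraMap, zero_mul, zero_add, Algebra.smul_def]

theorem dir_comm (v w : Space d) (f : Smooth d) : dir v (dir w f) = dir w (dir v f) := by
  refine Smooth.ext_eval fun x => ?_
  have key : ∀ v w : Space d, evalAt x (dir v (dir w f))
      = fderiv ℝ (fderiv ℝ (f : Scalar d)) x v w := fun v w => by
    rw [evalAt_dir]
    change fderiv ℝ (fun y => fderiv ℝ (f : Scalar d) y w) x v = _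
    rw [fderiv_clm_apply _ (differentiableAt_const _)]
    · simp
    · exact (((contDiff_coe f).fderiv_right (m := ∞) (by simp)).differentiable (by simp)) x
  rw [key, key]
  exact ((contDiff_coe f).contDiffAt.isSymmSndFDerivAt (by simp; exact WithTop.coe_le_coe.2 le_top)) v w

theorem lin_dir_left (f : Smooth d) : Lin fun v => dir v f :=
  ⟨fun v w => Smooth.ext_eval fun x => by simp [evalAt_dir],
    fun r v => Smooth.ext_eval fun x => by rw [evalAt_smul]; simp [evalAt_dir]⟩

theorem lin_dir (v : Space d) : Lin (dir v) := ⟨dir_add v, dir_smul v⟩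

theorem commDer_dir {ι : Type*} (b : ι → Space d) : CommDer fun i => dir (b i) :=
  ⟨fun _ => dir_add _, fun _ => dir_mul _, fun _ _ => dir_comm _ _⟩

/-- The standard basis vectors. -/
abbrev unit (i : Fin d) : Fin d → ℝ := Pi.single i 1

theorem dir_eq_sum (v : Space d) (f : Smooth d) : dir v f = ∑ i, v i • dir (unit i) f := by
  have e : v = ∑ p, v p • unit p := by ext j; simp [Finset.sum_apply, Pi.single_apply]
  conv_lhs => rw [e]
  exact (map_sum ((lin_dir_left f).mk') _ _).trans
    (Finset.sum_congr rfl fun p _ => (lin_dir_left f).map_smul _ _)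

/-! ### Iterated partial derivatives -/

theorem pd_comm {f : Scalar d} (hf : ContDiff ℝ ∞ f) (i j : Fin d) :
    pd i (pd j f) = pd j (pd i f) :=
  congrArg Subtype.val (dir_comm (unit i) (unit j) ⟨f, hf⟩)

theorem pds_perm {f : Scalar d} (hf : ContDiff ℝ ∞ f) {J K : List (Fin d)} (h : J.Perm K) :
    pds J f = pds K f := by
  induction h with
  | nil => rfl
  | cons i _ IH => exact congrArg (pd i) IH
  | swap i j J => exact pd_comm (contDiff_pds hf J) j i
  | trans _ _ h1 h2 => exact h1.trans h2

theorem pd_add {f g : Scalar d} (hf : ContDiff ℝ ∞ f) (hg : ContDiff ℝ ∞ g) (i : Fin d) :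
    pd i (f + g) = pd i f + pd i g :=
  congrArg Subtype.val (dir_add (unit i) ⟨f, hf⟩ ⟨g, hg⟩)

theorem pd_mul {f g : Scalar d} (hf : ContDiff ℝ ∞ f) (hg : ContDiff ℝ ∞ g) (i : Fin d) :
    pd i (f * g) = pd i f * g + f * pd i g :=
  congrArg Subtype.val (dir_mul (unit i) ⟨f, hf⟩ ⟨g, hg⟩)

theorem pd_const (i : Fin d) (r : ℝ) : pd i (fun _ => r) = 0 := by
  funext x; simp [pd]

theorem pd_smul {f : Scalar d} (hf : ContDiff ℝ ∞ f) (i : Fin d) (r : ℝ) :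
    pd i (r • f) = r • pd i f :=
  congrArg Subtype.val (dir_smul (unit i) r ⟨f, hf⟩)

theorem pd_neg {f : Scalar d} (i : Fin d) : pd i (-f) = -pd i f := by
  funext x
  change fderiv ℝ (-f) x _ = -fderiv ℝ f x _
  rw [fderiv_neg]; rfl

theorem pd_coord (i j : Fin d) : pd i (fun x : Space d => x j) = fun _ => if i = j then 1 else 0 := by
  funext x
  have : (fun x : Space d => x j) = (ContinuousLinearMap.proj j : Space d →L[ℝ] ℝ) := rfl
  rw [pd, this, ContinuousLinearMap.fderiv]
  simp [Pi.single_apply, eq_comm]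

theorem pds_add {f g : Scalar d} (hf : ContDiff ℝ ∞ f) (hg : ContDiff ℝ ∞ g) (J : List (Fin d)) :
    pds J (f + g) = pds J f + pds J g := by
  induction J with
  | nil => rfl
  | cons i J IH =>
    change pd i (pds J (f + g)) = _
    rw [IH, pd_add (contDiff_pds hf J) (contDiff_pds hg J)]; rfl

theorem pds_smul {f : Scalar d} (hf : ContDiff ℝ ∞ f) (r : ℝ) (J : List (Fin d)) :
    pds J (r • f) = r • pds J f := by
  induction J with
  | nil => rfl
  | cons i J IH =>
    change pd i (pds J (r • f)) = _
    rw [IH, pd_smul (contDiff_pds hf J)]; rfl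

/-! ### Differential polynomials -/

variable {m : ℕ}

namespace DiffPoly

/-- The total derivative of a differential polynomial. -/
def D (k : Fin (m + 2)) : Derivation ℝ (DiffPoly m) (DiffPoly m) :=
  MvPolynomial.mkDerivation ℝ fun q => MvPolynomial.X (q.1, k :: q.2)

variable {ρ : Scalar (m + 2)} {a : Fin m → Scalar (m + 2)}

theorem value_add (p q : DiffPoly m) : value (p + q) ρ a = value p ρ a + value q ρ a := by
  funext x; simp [value]

theorem value_mul (p q : DiffPoly m) : value (p * q) ρ a = value p ρ a * value q ρ a := by
  funext x; simp [value]

theorem value_neg (p : DiffPoly m) : value (-p) ρ a = -value p ρ a := by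
  funext x; simp [value]

theorem value_C (r : ℝ) : value (MvPolynomial.C r : DiffPoly m) ρ a = fun _ => r := by
  funext x; simp [value]

theorem value_X (q : Option (Fin m) × List (Fin (m + 2))) :
    value (MvPolynomial.X q : DiffPoly m) ρ a = pds q.2 (q.1.elim ρ a) := by
  funext x; simp [value]

theorem value_zero : value (0 : DiffPoly m) ρ a = 0 := by
  funext x; simp [value]

theorem value_sum {ι : Type*} (s : Finset ι) (f : ι → DiffPoly m) :
    value (∑ i ∈ s, f i) ρ a = ∑ i ∈ s, value (f i) ρ a := by
  funext x; simp [value]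

variable (hρ : ContDiff ℝ ∞ ρ) (ha : ∀ i, ContDiff ℝ ∞ (a i))

include hρ ha

theorem contDiff_elim (q : Option (Fin m)) : ContDiff ℝ ∞ (q.elim ρ a) := by
  cases q
  · exact hρ
  · exact ha _

theorem contDiff_value (p : DiffPoly m) : ContDiff ℝ ∞ (value p ρ a) := by
  induction p using MvPolynomial.induction_on with
  | C r => rw [value_C]; exact contDiff_const
  | add p q hp hq => rw [value_add]; exact hp.add hq
  | mul_X p q hp =>
    rw [value_mul, value_X]
    exact hp.mul (contDiff_pds (contDiff_elim hρ ha q.1) q.2)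

theorem value_D (k : Fin (m + 2)) (p : DiffPoly m) : value (D k p) ρ a = pd k (value p ρ a) := by
  induction p using MvPolynomial.induction_on with
  | C r =>
    rw [value_C, pd_const, MvPolynomial.derivation_C, value_zero]
  | add p q hp hq =>
    rw [map_add, value_add, value_add, hp, hq,
      pd_add (contDiff_value hρ ha p) (contDiff_value hρ ha q)]
  | mul_X p q hp =>
    have hX := contDiff_value hρ ha (MvPolynomial.X q)
    rw [Derivation.leibniz, value_mul, pd_mul (contDiff_value hρ ha p) hX, value_add, smul_eq_mul,
      smul_eq_mul, value_mul, value_mul, hp, D, MvPolynomial.mkDerivation_X, value_X, value_X]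
    change _ * pd k (pds q.2 (q.1.elim ρ a)) + _ = _
    ring

/-- The value of a differential polynomial along an affine line of arguments is polynomial. -/
theorem exists_polynomial {σ : Scalar (m + 2)} {q : Fin m → Scalar (m + 2)}
    (hσ : ContDiff ℝ ∞ σ) (hq : ∀ i, ContDiff ℝ ∞ (q i)) (p : DiffPoly m) (x : Space (m + 2)) :
    ∃ P : Polynomial ℝ, ∀ s : ℝ, value p (ρ + s • σ) (fun i => a i + s • q i) x = P.eval s := by
  refine ⟨MvPolynomial.aeval (fun u => Polynomial.C (pds u.2 (u.1.elim ρ a) x)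
    + Polynomial.X * Polynomial.C (pds u.2 (u.1.elim σ q) x)) p, fun s => ?_⟩
  have h1 := MvPolynomial.map_aeval (fun u : Option (Fin m) × List (Fin (m + 2)) =>
    Polynomial.C (pds u.2 (u.1.elim ρ a) x)
    + Polynomial.X * Polynomial.C (pds u.2 (u.1.elim σ q) x)) (Polynomial.evalRingHom s) p
  rw [Polynomial.coe_evalRingHom] at h1
  rw [h1, value]
  have h2 : (Polynomial.evalRingHom s).comp (algebraMap ℝ (Polynomial ℝ)) = RingHom.id ℝ := by
    ext; simp
  rw [h2, MvPolynomial.eval, MvPolynomial.eval₂Hom_congr rfl _ rfl]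
  funext u
  have h3 : u.1.elim (ρ + s • σ) (fun i => a i + s • q i) = u.1.elim ρ a + s • u.1.elim σ q := by
    cases u.1 <;> rfl
  have c1 := contDiff_elim hρ ha u.1
  have c2 := contDiff_elim hσ hq u.1
  rw [h3, pds_add c1 (show ContDiff ℝ ∞ (s • u.1.elim σ q) from c2.const_smul s), pds_smul c2]
  simp only [Polynomial.eval_add, Polynomial.eval_mul, Polynomial.eval_C, Polynomial.eval_X]
  rfl

/-- A differential polynomial which vanishes for infinitely many points of an affine line of
arguments vanishes at its origin. -/
theorem value_eq_zero_of_line {σ : Scalar (m + 2)} {q : Fin m → Scalar (m + 2)}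
    (hσ : ContDiff ℝ ∞ σ) (hq : ∀ i, ContDiff ℝ ∞ (q i)) (p : DiffPoly m) (x : Space (m + 2))
    (h : {s : ℝ | value p (ρ + s • σ) (fun i => a i + s • q i) x = 0}.Infinite) :
    value p ρ a x = 0 := by
  obtain ⟨P, hP⟩ := exists_polynomial hρ ha hσ hq p x
  have h0 : P = 0 := by
    refine Polynomial.eq_zero_of_infinite_isRoot P (h.mono fun s hs => ?_)
    rw [Set.mem_ofPred_eq, hP] at hs
    exact hs
  have := hP 0
  simpa [h0] using this

end DiffPoly

/-! ## The Nambu bivector in frames -/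

section Rows

variable {R : Type*} [CommRing R] {m : ℕ}

/-- The determinant with two distinguished rows. -/
def rowDet (u v : Fin (m + 2) → R) (G : Fin m → Fin (m + 2) → R) : R :=
  Matrix.detRowAlternating (Fin.cons u (Fin.cons v G : Fin (m + 1) → Fin (m + 2) → R) :
    Fin (m + 2) → Fin (m + 2) → R)

theorem rowDet_eq_det (u v : Fin (m + 2) → R) (G : Fin m → Fin (m + 2) → R) :
    rowDet u v G = Matrix.det (Matrix.of (Fin.cons u (Fin.cons v G :
      Fin (m + 1) → Fin (m + 2) → R) : Fin (m + 2) → Fin (m + 2) → R)) := rfl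

theorem rowDet_add (u u' v : Fin (m + 2) → R) (G : Fin m → Fin (m + 2) → R) :
    rowDet (u + u') v G = rowDet u v G + rowDet u' v G :=
  MultilinearMap.cons_add (Matrix.detRowAlternating (R := R) (n := Fin (m + 2))).toMultilinearMap _ _ _

theorem rowDet_smul (r : R) (u v : Fin (m + 2) → R) (G : Fin m → Fin (m + 2) → R) :
    rowDet (r • u) v G = r * rowDet u v G :=
  MultilinearMap.cons_smul (Matrix.detRowAlternating (R := R) (n := Fin (m + 2))).toMultilinearMap _ _ _

theorem rowDet_swap (u v : Fin (m + 2) → R) (G : Fin m → Fin (m + 2) → R) :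
    rowDet u v G = -rowDet v u G := by
  unfold rowDet
  rw [← AlternatingMap.map_swap _ _ (show (0 : Fin (m + 2)) ≠ 1 by simp)]
  congr 1
  funext i
  refine Fin.cases ?_ (fun i => Fin.cases ?_ (fun i => ?_) i) i
  · simp
  · simp only [Function.comp_apply, Fin.succ_zero_eq_one, Equiv.swap_apply_right]; rfl
  · rw [Function.comp_apply, Equiv.swap_apply_of_ne_of_ne]
    · rfl
    · exact Fin.succ_ne_zero _
    · rw [← Fin.succ_zero_eq_one]; exact fun h => Fin.succ_ne_zero _ (Fin.succ_injective _ h)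

theorem rowDet_update (u v : Fin (m + 2) → R) (G : Fin m → Fin (m + 2) → R) (α : Fin m)
    (z : Fin (m + 2) → R) : rowDet u v (Function.update G α z)
      = Matrix.detRowAlternating (Function.update (Fin.cons u (Fin.cons v G :
        Fin (m + 1) → Fin (m + 2) → R) : Fin (m + 2) → Fin (m + 2) → R) α.succ.succ z) := by
  rw [rowDet, Fin.cons_update, Fin.cons_update]

theorem rowDet_update_add (u v : Fin (m + 2) → R) (G : Fin m → Fin (m + 2) → R) (α : Fin m)
    (z z' : Fin (m + 2) → R) : rowDet u v (Function.update G α (z + z'))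
      = rowDet u v (Function.update G α z) + rowDet u v (Function.update G α z') := by
  rw [rowDet_update, rowDet_update, rowDet_update, AlternatingMap.map_update_add]

theorem rowDet_update_smul (u v : Fin (m + 2) → R) (G : Fin m → Fin (m + 2) → R) (α : Fin m)
    (r : R) (z : Fin (m + 2) → R) : rowDet u v (Function.update G α (r • z))
      = r * rowDet u v (Function.update G α z) := by
  rw [rowDet_update, rowDet_update, AlternatingMap.map_update_smul, smul_eq_mul]

theorem rowDet_update_self {u v : Fin (m + 2) → R} {G : Fin m → Fin (m + 2) → R} {α β : Fin m}
    (h : α ≠ β) : rowDet u v (Function.update G α (G β)) = 0 := by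
  rw [rowDet_update]
  refine AlternatingMap.map_eq_zero_of_eq _ _ (i := α.succ.succ) (j := β.succ.succ) ?_ (by simpa)
  rw [Function.update_self, Function.update_of_ne (by simpa using h.symm)]; rfl

theorem map_rowDet {S : Type*} [CommRing S] (φ : R →+* S) (u v : Fin (m + 2) → R)
    (G : Fin m → Fin (m + 2) → R) :
    φ (rowDet u v G) = rowDet (fun k => φ (u k)) (fun k => φ (v k)) (fun α k => φ (G α k)) := by
  rw [rowDet_eq_det, rowDet_eq_det, RingHom.map_det]
  congr 1
  ext i k
  refine Fin.cases ?_ (fun i => Fin.cases ?_ (fun i => ?_) i) i <;> rfl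

theorem rowDet_mul (u v : Fin (m + 2) → R) (G : Fin m → Fin (m + 2) → R)
    (B : Matrix (Fin (m + 2)) (Fin (m + 2)) R) :
    rowDet u v G * B.det = rowDet (fun k => ∑ l, u l * B l k) (fun k => ∑ l, v l * B l k)
      (fun α k => ∑ l, G α l * B l k) := by
  rw [rowDet_eq_det, rowDet_eq_det, ← Matrix.det_mul]
  congr 1
  ext i k
  refine Fin.cases ?_ (fun i => Fin.cases ?_ (fun i => ?_) i) i <;> rfl

theorem rowDet_three (f : R) (D : Fin 3 → R → R) (i j : Fin 3) :
    rowDet (m := 1) (fun k => if i = k then 1 else 0) (fun k => if j = k then 1 else 0)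
      (fun _ k => D k f) = nambuThree D f i j := by
  rw [rowDet_eq_det]
  generalize hM : Matrix.of _ = M
  have h0 : ∀ k, M 0 k = if i = k then 1 else 0 := by subst hM; intro k; rfl
  have h1 : ∀ k, M 1 k = if j = k then 1 else 0 := by subst hM; intro k; rfl
  have h2 : ∀ k, M 2 k = D k f := by subst hM; intro k; rfl
  rw [Matrix.det_fin_three]
  simp only [h0, h1, h2]
  fin_cases i <;> fin_cases j <;> simp [nambuThree]

theorem rowDet_four (f g : R) (D : Fin 4 → R → R) (i j : Fin 4) (c : Fin 2 → R) (h0 : c 0 = f)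
    (h1 : c 1 = g) :
    rowDet (m := 2) (fun k => if i = k then 1 else 0) (fun k => if j = k then 1 else 0)
      (fun α k => D k (c α)) = nambuFour D f g i j := by
  rw [rowDet_eq_det]
  generalize hM : Matrix.of _ = M
  have e0 : ∀ k, M 0 k = if i = k then 1 else 0 := by subst hM; intro k; rfl
  have e1 : ∀ k, M 1 k = if j = k then 1 else 0 := by subst hM; intro k; rfl
  have e2 : ∀ k, M 2 k = D k f := by subst hM h0; intro k; rfl
  have e3 : ∀ k, M 3 k = D k g := by subst hM h1; intro k; rfl
  have hd : ∀ p : Fin 4, (M.submatrix Fin.succ p.succAbove).det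
      = M 1 (p.succAbove 0) * M 2 (p.succAbove 1) * M 3 (p.succAbove 2)
        - M 1 (p.succAbove 0) * M 2 (p.succAbove 2) * M 3 (p.succAbove 1)
        - M 1 (p.succAbove 1) * M 2 (p.succAbove 0) * M 3 (p.succAbove 2)
        + M 1 (p.succAbove 1) * M 2 (p.succAbove 2) * M 3 (p.succAbove 0)
        + M 1 (p.succAbove 2) * M 2 (p.succAbove 0) * M 3 (p.succAbove 1)
        - M 1 (p.succAbove 2) * M 2 (p.succAbove 1) * M 3 (p.succAbove 0) := fun p =>
    Matrix.det_fin_three _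
  rw [Matrix.det_succ_row_zero]
  simp only [hd, e0, e1, e2, e3]
  rw [Finset.sum_eq_single i (by intro b _ hb; simp [hb.symm]) (by simp)]
  fin_cases i <;> fin_cases j <;> simp [nambuFour, minor, Fin.succAbove] <;> try ring

end Rows

variable {m : ℕ}

/-- The Nambu determinant of two constant covectors and smooth Casimirs. -/
def nam (c : Fin m → Smooth (m + 2)) (ξ η : Fin (m + 2) → ℝ) : Smooth (m + 2) :=
  rowDet (fun k => algebraMap ℝ _ (ξ k)) (fun k => algebraMap ℝ _ (η k))
    (fun α k => dir (unit k) (c α))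

/-- The part of a second derivative of the Nambu determinant which differentiates two Casimirs. -/
def namMixed (c : Fin m → Smooth (m + 2)) (v w : Space (m + 2)) (ξ η : Fin (m + 2) → ℝ) :
    Smooth (m + 2) :=
  ∑ α, ∑ β ∈ Finset.univ.erase α,
    nam (Function.update (Function.update c α (dir v (c α))) β (dir w (c β))) ξ η

theorem nam_swap (c : Fin m → Smooth (m + 2)) (ξ η : Fin (m + 2) → ℝ) : nam c ξ η = -nam c η ξ :=
  rowDet_swap _ _ _

theorem lin_nam_left (c : Fin m → Smooth (m + 2)) (η : Fin (m + 2) → ℝ) :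
    Lin fun ξ => nam c ξ η := by
  constructor
  · intro ξ ξ'
    unfold nam
    rw [← rowDet_add]
    exact congrArg (fun u => rowDet u _ _) (funext fun k => map_add _ _ _)
  · intro r ξ
    unfold nam
    rw [Algebra.smul_def (A := Smooth (m + 2)), ← rowDet_smul]
    exact congrArg (fun u => rowDet u _ _) (funext fun k => map_mul _ _ _)

theorem lin_nam_right (c : Fin m → Smooth (m + 2)) (ξ : Fin (m + 2) → ℝ) :
    Lin (nam c ξ) := by
  have : nam c ξ = fun η => -nam c η ξ := funext fun η => nam_swap _ _ _
  rw [this]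
  exact (lin_nam_left c ξ).neg'

theorem nam_update_eq (c : Fin m → Smooth (m + 2)) (α : Fin m) (z : Smooth (m + 2))
    (ξ η : Fin (m + 2) → ℝ) : nam (Function.update c α z) ξ η
      = rowDet (fun k => algebraMap ℝ _ (ξ k)) (fun k => algebraMap ℝ _ (η k))
        (Function.update (fun α k => dir (unit k) (c α)) α fun k => dir (unit k) z) := by
  unfold nam
  congr 1
  funext β
  by_cases h : β = α
  · subst h; simp
  · simp [Function.update_of_ne h]

theorem lin_nam_update (c : Fin m → Smooth (m + 2)) (α : Fin m) (ξ η : Fin (m + 2) → ℝ) :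
    Lin fun z => nam (Function.update c α z) ξ η := by
  constructor
  · intro z z'
    simp only [nam_update_eq]
    rw [← rowDet_update_add]; congr 2; funext k; exact dir_add _ _ _
  · intro r z
    simp only [nam_update_eq]
    rw [Algebra.smul_def r (rowDet _ _ _), ← rowDet_update_smul]; congr 2; funext k
    rw [dir_smul, Algebra.smul_def]; rfl

theorem lin_finset_sum {E F ι : Type*} [AddCommGroup E] [Module ℝ E] [AddCommGroup F] [Module ℝ F]
    (s : Finset ι) {f : ι → E → F} (h : ∀ i ∈ s, Lin (f i)) : Lin fun x => ∑ i ∈ s, f i x := by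
  constructor
  · intro x y
    rw [← Finset.sum_add_distrib]
    exact Finset.sum_congr rfl fun i hi => (h i hi).map_add _ _
  · intro r x
    rw [Finset.smul_sum]
    exact Finset.sum_congr rfl fun i hi => (h i hi).map_smul _ _

theorem Lin.comp {E F G : Type*} [AddCommGroup E] [Module ℝ E] [AddCommGroup F] [Module ℝ F]
    [AddCommGroup G] [Module ℝ G] {g : F → G} {f : E → F} (hg : Lin g) (hf : Lin f) :
    Lin fun x => g (f x) :=
  ⟨fun x y => by rw [hf.map_add, hg.map_add], fun r x => by rw [hf.map_smul, hg.map_smul]⟩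

theorem linData (c : Fin m → Smooth (m + 2)) : LinData dir (nam c) (namMixed c) where
  D1 := lin_dir_left
  D2 := lin_dir
  N1 := lin_nam_left c
  N2 := lin_nam_right c
  H1 w i j := by
    refine lin_finset_sum _ fun α _ => lin_finset_sum _ fun β hβ => ?_
    have : ∀ v, nam (Function.update (Function.update c α (dir v (c α))) β (dir w (c β))) i j
        = nam (Function.update (Function.update c β (dir w (c β))) α (dir v (c α))) i j := fun v => by
      rw [Function.update_comm (Finset.ne_of_mem_erase hβ).symm]
    simp only [this]
    exact Lin.comp (g := fun z => nam (Function.update _ α z) i j) (lin_nam_update _ α i j)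
      (lin_dir_left _)
  H2 v i j := lin_finset_sum _ fun α _ => lin_finset_sum _ fun β _ =>
    Lin.comp (g := fun z => nam (Function.update _ β z) i j) (lin_nam_update _ β i j)
      (lin_dir_left _)
  H3 v w j := lin_finset_sum _ fun α _ => lin_finset_sum _ fun β _ => lin_nam_left _ _
  H4 v w i := lin_finset_sum _ fun α _ => lin_finset_sum _ fun β _ => lin_nam_right _ _

/-- Dual frames. -/
structure DualFrame {d : ℕ} (b b' : Fin d → Fin d → ℝ) : Prop where
  pairing : ∀ i j, b' i ⬝ᵥ b j = if i = j then 1 else 0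

namespace DualFrame

variable {d : ℕ} {b b' : Fin d → Fin d → ℝ} (h : DualFrame b b')
include h

theorem mul_eq : Matrix.of b' * (Matrix.of b).transpose = 1 := by
  ext i j
  rw [Matrix.mul_apply, Matrix.one_apply, ← h.pairing]; rfl

theorem sum_eq (p q : Fin d) : ∑ i, b i p * b' i q = if p = q then 1 else 0 := by
  have := congrArg (fun M : Matrix (Fin d) (Fin d) ℝ => M p q) (mul_eq_one_comm.1 h.mul_eq)
  rwa [Matrix.mul_apply, Matrix.one_apply] at this

theorem covector_eq (ξ : Fin d → ℝ) : ξ = ∑ i, (ξ ⬝ᵥ b i) • b' i := by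
  funext q
  simp only [Finset.sum_apply, Pi.smul_apply, smul_eq_mul, dotProduct, Finset.sum_mul]
  rw [Finset.sum_comm]
  simp only [mul_assoc, ← Finset.mul_sum, h.sum_eq]
  simp

theorem det_mul : (Matrix.of b).transpose.det * (Matrix.of b').det = 1 := by
  rw [← Matrix.det_mul, mul_eq_one_comm.1 h.mul_eq, Matrix.det_one]

end DualFrame

/-- Multiply the matrix with rows b'ᵢ, b'ⱼ and the gradients by the matrix of the frame. Duality
turns the first two rows into unit rows, the gradients become derivatives along the frame, and the
determinant of the frame is inverse to that of the coframe. -/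
theorem nam_frame {b b' : Fin (m + 2) → Fin (m + 2) → ℝ} (h : DualFrame b b')
    (c : Fin m → Smooth (m + 2)) (i j : Fin (m + 2)) :
    nam c (b' i) (b' j) = algebraMap ℝ _ (Matrix.of b').det *
      rowDet (fun k => if i = k then 1 else 0) (fun k => if j = k then 1 else 0)
        (fun α k => dir (b k) (c α)) := by
  have e1 := rowDet_mul (fun k => algebraMap ℝ (Smooth (m + 2)) (b' i k))
    (fun k => algebraMap ℝ _ (b' j k)) (fun α k => dir (unit k) (c α))
    ((algebraMap ℝ (Smooth (m + 2))).mapMatrix (Matrix.of b).transpose)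
  rw [← RingHom.map_det] at e1
  have e2 : ∀ i k, (∑ l, algebraMap ℝ (Smooth (m + 2)) (b' i l) *
      (algebraMap ℝ (Smooth (m + 2))).mapMatrix (Matrix.of b).transpose l k)
      = if i = k then 1 else 0 := fun i k => by
    have := congrArg (algebraMap ℝ (Smooth (m + 2))) (h.pairing i k)
    rw [dotProduct, map_sum] at this
    simp only [map_mul] at this
    refine Eq.trans this ?_
    split_ifs <;> simp
  have e3 : ∀ α k, (∑ l, dir (unit l) (c α) *
      (algebraMap ℝ (Smooth (m + 2))).mapMatrix (Matrix.of b).transpose l k) = dir (b k) (c α) :=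
    fun α k => by
      rw [dir_eq_sum (b k)]
      refine Finset.sum_congr rfl fun l _ => ?_
      rw [Algebra.smul_def, mul_comm]; rfl
  simp only [e2, e3] at e1
  rw [← e1, nam, mul_comm, mul_assoc, ← map_mul, h.det_mul, map_one, mul_one]

/-- The standard frame. -/
def stdFrame (d : ℕ) : List ((Fin d → ℝ) × (Fin d → ℝ)) :=
  (List.finRange d).map fun i => (unit i, unit i)

/-- The diagonal of pairs of indices. -/
def diag (d : ℕ) : List (Fin d × Fin d) := (List.finRange d).map fun i => (i, i)

theorem algebraMap_const (v : Space (m + 2)) (r : ℝ) (f : Smooth (m + 2)) :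
    dir v (algebraMap ℝ _ r * f) = algebraMap ℝ _ r * dir v f := by
  rw [← Algebra.smul_def, dir_smul, Algebra.smul_def]

section Frame

variable {b b' : Fin (m + 2) → Fin (m + 2) → ℝ} (h : DualFrame b b')
  (c : Fin m → Smooth (m + 2)) (ρ : Smooth (m + 2))
include h

theorem sameContraction_frame :
    SameContraction (Smooth (m + 2)) ((diag (m + 2)).map (Prod.map b b')) (stdFrame (m + 2)) := by
  have := sameContraction_of_dual (A := Smooth (m + 2)) b b' h.sum_eq
  rw [diag, List.map_map]
  exact this

theorem defect_frame (i j : Fin (m + 2)) :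
    defect (stdFrame (m + 2)) dir ρ (nam c) (namMixed c) (b' i) (b' j)
      = defect (diag (m + 2)) (fun i => dir (b i)) ρ (fun i j => nam c (b' i) (b' j))
        (fun v w i j => namMixed c (b v) (b w) (b' i) (b' j)) i j := by
  rw [← (linData c).defect_congr (sameContraction_frame h), defect_map]

theorem casDefect_frame (f : Smooth (m + 2)) :
    casDefect (stdFrame (m + 2)) dir ρ (nam c) (namMixed c) f
      = casDefect (diag (m + 2)) (fun i => dir (b i)) ρ (fun i j => nam c (b' i) (b' j))
        (fun v w i j => namMixed c (b v) (b w) (b' i) (b' j)) f := by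
  rw [← (linData c).casDefect_congr (sameContraction_frame h), casDefect_map]

end Frame

/-- The value of the defect on two constant covectors. -/
def defectAt (c : Fin m → Smooth (m + 2)) (ρ : Smooth (m + 2)) (e : Smooth (m + 2) →+* ℝ)
    (ξ η : Fin (m + 2) → ℝ) : ℝ :=
  e (defect (stdFrame (m + 2)) dir ρ (nam c) (namMixed c) ξ η)

/-- The value of the defect of a Casimir. -/
def casDefectAt (c : Fin m → Smooth (m + 2)) (ρ : Smooth (m + 2)) (e : Smooth (m + 2) →+* ℝ)
    (f : Smooth (m + 2)) : ℝ :=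
  e (casDefect (stdFrame (m + 2)) dir ρ (nam c) (namMixed c) f)

/-! ### Dimension four -/

theorem diag_four : diag 4 = diagFour := by decide

theorem diag_three : diag 3 = diagThree := by decide

section Four

variable {b b' : Fin 4 → Fin 4 → ℝ} (c : Fin 2 → Smooth 4) (ρ : Smooth 4)

theorem nam_four (h : DualFrame b b') (i j : Fin 4) : nam c (b' i) (b' j)
    = algebraMap ℝ _ (Matrix.of b').det * nambuFour (fun i => dir (b i)) (c 0) (c 1) i j := by
  rw [nam_frame h, rowDet_four (c 0) (c 1) (fun i => dir (b i)) i j c rfl rfl]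

theorem namMixed_four (h : DualFrame b b') (v w i j : Fin 4) :
    namMixed c (b v) (b w) (b' i) (b' j) = algebraMap ℝ _ (Matrix.of b').det *
      mixedFour (fun i => dir (b i)) (c 0) (c 1) v w i j := by
  have e0 : (Finset.univ.erase (0 : Fin 2)) = {1} := by decide
  have e1 : (Finset.univ.erase (1 : Fin 2)) = {0} := by decide
  rw [namMixed, Fin.sum_univ_two, e0, e1, Finset.sum_singleton, Finset.sum_singleton,
    nam_four _ h, nam_four _ h, mixedFour, mul_add]
  simp

/-- Passing to the frame multiplies both N and its mixed part by the determinant of the coframe.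
This constant is moved into ϱ, which is arbitrary in the normal form. -/
theorem defect_four_zero (h : DualFrame b b') (e : Smooth 4 →+* ℝ)
    (hn : NormalFour (fun i => dir (b i)) e (c 0) (c 1)) :
    (defectAt c ρ e (b' 0) (b' 1) = 0 ∧
      defectAt c ρ e (b' 0) (b' 2) = 0 ∧
      defectAt c ρ e (b' 0) (b' 3) = 0 ∧
      defectAt c ρ e (b' 2) (b' 3) = 0) ∧
    casDefectAt c ρ e (c 0) = 0 ∧
    casDefectAt c ρ e (c 1) = 0 := by
  have h4 := normalFour_zero (commDer_dir b) e (algebraMap ℝ _ (Matrix.of b').det * ρ) _ _ hn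
  have hc : ∀ (v : Fin 4) f, dir (b v) (algebraMap ℝ (Smooth 4) (Matrix.of b').det * f)
    = algebraMap ℝ _ (Matrix.of b').det * dir (b v) f := fun v f => algebraMap_const (m := 2) _ _ _
  unfold defectAt casDefectAt
  simp only [defect_frame (m := 2) h, casDefect_frame (m := 2) h, nam_four c h, namMixed_four c h]
  rw [defect_scale _ _ _ _ _ hc, casDefect_scale _ _ _ _ _ hc, diag_four]
  exact h4

end Four

section Three

variable {b b' : Fin 3 → Fin 3 → ℝ} (c : Fin 1 → Smooth 3) (ρ : Smooth 3)

theorem nam_three (h : DualFrame b b') (i j : Fin 3) : nam c (b' i) (b' j)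
    = algebraMap ℝ _ (Matrix.of b').det * nambuThree (fun i => dir (b i)) (c 0) i j := by
  rw [nam_frame h, ← rowDet_three (c 0) (fun i => dir (b i)) i j]
  congr 2
  funext α k
  rw [Subsingleton.elim α 0]

theorem namMixed_three : namMixed c = fun _ _ _ _ => 0 := by
  funext v w i j
  have e0 : (Finset.univ.erase (0 : Fin 1)) = ∅ := by decide
  rw [namMixed, Fin.sum_univ_one, e0, Finset.sum_empty]

theorem defect_three_zero (h : DualFrame b b') (e : Smooth 3 →+* ℝ)
    (h1 : ∀ i, e (dir (b i) (c 0)) = if i = 2 then 1 else 0)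
    (h2 : ∀ i j, i = 0 ∨ i = 1 → e (dir (b i) (dir (b j) (c 0))) = if i = j then 1 else 0) :
    (defectAt c ρ e (b' 0) (b' 1) = 0 ∧
      defectAt c ρ e (b' 0) (b' 2) = 0 ∧
      defectAt c ρ e (b' 1) (b' 2) = 0) ∧
    casDefectAt c ρ e (c 0) = 0 := by
  have h4 := normalThree_zero (commDer_dir b) e (algebraMap ℝ _ (Matrix.of b').det * ρ) (c 0) h1 h2
  have hc : ∀ (v : Fin 3) f, dir (b v) (algebraMap ℝ (Smooth 3) (Matrix.of b').det * f)
    = algebraMap ℝ _ (Matrix.of b').det * dir (b v) f := fun v f => algebraMap_const (m := 1) _ _ _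
  have hH : (fun (v w i j : Fin 3) => namMixed c (b v) (b w) (b' i) (b' j))
      = fun v w i j => algebraMap ℝ _ (Matrix.of b').det * (0 : Fin 3 → Fin 3 → Fin 3 → Fin 3 →
        Smooth 3) v w i j := by
    funext v w i j; rw [namMixed_three]; simp
  unfold defectAt casDefectAt
  simp only [defect_frame (m := 1) h, casDefect_frame (m := 1) h, nam_three c h, hH]
  rw [defect_scale _ _ _ _ _ hc, casDefect_scale _ _ _ _ _ hc, diag_three]
  exact h4

end Three

/-! ### Bilinearity of the defect in the covectors -/

section Bilinear

variable {m : ℕ} (c : Fin m → Smooth (m + 2)) (ρ : Smooth (m + 2)) (e : Smooth (m + 2) →+* ℝ)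

theorem dir_neg (v : Space (m + 2)) (f : Smooth (m + 2)) : dir v (-f) = -dir v f := by
  have := (lin_dir v).map_smul (-1) f
  simpa using this

theorem defectAt_swap (ξ η : Fin (m + 2) → ℝ) : defectAt c ρ e ξ η = -defectAt c ρ e η ξ := by
  unfold defectAt
  rw [defect_antisymm _ _ _ _ _ (nam_swap c) dir_neg, map_neg]

theorem defectAt_add (ξ ξ' η : Fin (m + 2) → ℝ) :
    defectAt c ρ e (ξ + ξ') η = defectAt c ρ e ξ η + defectAt c ρ e ξ' η := by
  unfold defectAt
  rw [((linData c).defect1 η).map_add, map_add]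

theorem map_evalAt_smul (x : Space (m + 2)) (r : ℝ) (f : Smooth (m + 2)) :
    evalAt x (r • f) = r * evalAt x f := rfl

theorem defectAt_smul (x : Space (m + 2)) (r : ℝ) (ξ η : Fin (m + 2) → ℝ) :
    defectAt c ρ (evalAt x) (r • ξ) η = r * defectAt c ρ (evalAt x) ξ η := by
  unfold defectAt
  rw [((linData c).defect1 η).map_smul, map_evalAt_smul]

theorem defectAt_self (ξ : Fin (m + 2) → ℝ) : defectAt c ρ e ξ ξ = 0 := by
  have := defectAt_swap c ρ e ξ ξ
  linarith

/-- An alternating bilinear form is determined by its values on pairs i < j of a coframe, and the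
coframe spans by `DualFrame.covector_eq`. -/
theorem defectAt_eq_zero {b b' : Fin (m + 2) → Fin (m + 2) → ℝ} (h : DualFrame b b')
    (x : Space (m + 2)) (h0 : ∀ i j, i < j → defectAt c ρ (evalAt x) (b' i) (b' j) = 0)
    (ξ η : Fin (m + 2) → ℝ) : defectAt c ρ (evalAt x) ξ η = 0 := by
  have h1 : ∀ i j, defectAt c ρ (evalAt x) (b' i) (b' j) = 0 := fun i j => by
    rcases lt_trichotomy i j with hij | rfl | hij
    · exact h0 i j hij
    · exact defectAt_self _ _ _ _
    · rw [defectAt_swap, h0 j i hij, neg_zero]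
  have h2 : ∀ η, (∀ i, defectAt c ρ (evalAt x) (b' i) η = 0) →
      ∀ ξ, defectAt c ρ (evalAt x) ξ η = 0 := fun η hη ξ => by
    have hl : IsLinearMap ℝ fun ξ => defectAt c ρ (evalAt x) ξ η :=
      ⟨fun _ _ => defectAt_add _ _ _ _ _ _, fun _ _ => defectAt_smul _ _ _ _ _ _⟩
    rw [h.covector_eq ξ]
    refine (map_sum (hl.mk' _) _ _).trans (Finset.sum_eq_zero fun i _ => ?_)
    exact ((hl.mk' _).map_smul _ _).trans (by
      change _ • defectAt c ρ (evalAt x) (b' i) η = 0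
      rw [hη, smul_zero])
  refine h2 η (fun i => ?_) ξ
  rw [defectAt_swap, h2 _ (fun j => h1 j i), neg_zero]

theorem casDefectAt_add_smul (x : Space (m + 2)) (f g : Smooth (m + 2)) (r : ℝ) :
    casDefectAt c ρ (evalAt x) (g + r • f)
      = casDefectAt c ρ (evalAt x) g + r * casDefectAt c ρ (evalAt x) f := by
  have hl : Lin (casDefect (stdFrame (m + 2)) dir ρ (nam c) (namMixed c)) :=
    .add' (.lsum _ fun _ => (lin_dir _).mulConst _)
      (.lsum _ fun _ => .lsum _ fun _ => .lsum _ fun _ =>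
        Lin.mulConst (.comp (lin_dir _) (.comp (lin_dir _) (lin_dir _))) _)
  unfold casDefectAt
  rw [hl.map_add, hl.map_smul, map_add, map_evalAt_smul]

end Bilinear

/-! ### Normalising a pair of Casimirs in dimension four -/

section Four

/-- A frame adapted to two Casimirs at a point. -/
structure AdaptedFour (b b' : Fin 4 → Fin 4 → ℝ) (e : Smooth 4 →+* ℝ) (f g : Smooth 4) :
    Prop where
  dual : DualFrame b b'
  fst_one : ∀ i, e (dir (b i) f) = if i = 2 then 1 else 0
  fst_two : ∀ i j, i = 0 ∨ i = 1 → e (dir (b i) (dir (b j) f)) = if i = j then 1 else 0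
  snd_one : ∀ i, e (dir (b i) g) = if i = 3 then 1 else 0
  snd_zero_one : e (dir (b 0) (dir (b 1) g)) = 0

variable {b b' : Fin 4 → Fin 4 → ℝ} (x : Space 4) (c : Fin 2 → Smooth 4) (ρ : Smooth 4)

theorem nam_pair_add_left (p p' q : Smooth 4) (ξ η : Fin 4 → ℝ) :
    nam ![p + p', q] ξ η = nam ![p, q] ξ η + nam ![p', q] ξ η := by
  have hu : ∀ r : Smooth 4, ![r, q] = Function.update ![0, q] 0 r := by
    intro r; funext i; fin_cases i <;> rfl
  rw [hu (p + p'), hu p, hu p', (lin_nam_update ![0, q] 0 ξ η).map_add]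

theorem nam_pair_add_right (p q q' : Smooth 4) (ξ η : Fin 4 → ℝ) :
    nam ![p, q + q'] ξ η = nam ![p, q] ξ η + nam ![p, q'] ξ η := by
  have hu : ∀ r : Smooth 4, ![p, r] = Function.update ![p, 0] 1 r := by
    intro r; funext i; fin_cases i <;> rfl
  rw [hu (q + q'), hu q, hu q', (lin_nam_update ![p, 0] 1 ξ η).map_add]

theorem nam_pair_smul_right (p q : Smooth 4) (t : ℝ) (ξ η : Fin 4 → ℝ) :
    nam ![p, t • q] ξ η = t • nam ![p, q] ξ η := by
  have hu : ∀ r : Smooth 4, ![p, r] = Function.update ![p, 0] 1 r := by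
    intro r; funext i; fin_cases i <;> rfl
  rw [hu (t • q), hu q, (lin_nam_update ![p, 0] 1 ξ η).map_smul]

theorem nam_pair_self (p : Smooth 4) (ξ η : Fin 4 → ℝ) : nam ![p, p] ξ η = 0 := by
  have h5 := rowDet_update_self (u := fun k => algebraMap ℝ (Smooth 4) (ξ k))
    (v := fun k => algebraMap ℝ (Smooth 4) (η k))
    (G := fun α k => dir (unit k) ((![p, p] : Fin 2 → Smooth 4) α))
    (show (1 : Fin 2) ≠ 0 by decide)
  rw [show (![p, p] : Fin 2 → Smooth 4) = Function.update ![p, p] 1 p by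
    funext i; fin_cases i <;> rfl, nam_update_eq]
  exact h5

theorem nam_pair_swap (p q : Smooth 4) (ξ η : Fin 4 → ℝ) :
    nam ![p, q] ξ η = -nam ![q, p] ξ η := by
  have h := nam_pair_self (p + q) ξ η
  rw [nam_pair_add_left, nam_pair_add_right, nam_pair_add_right, nam_pair_self, nam_pair_self,
    zero_add, add_zero] at h
  exact eq_neg_of_add_eq_zero_left h

/-- This is a row operation on the determinant. -/
theorem nam_shift (t : ℝ) : nam ![c 0, c 1 + t • c 0] = nam c := by
  have h1 : ![c 0, c 1] = c := by
    funext i; fin_cases i <;> rfl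
  funext ξ η
  rw [nam_pair_add_right, nam_pair_smul_right, nam_pair_self, smul_zero, add_zero, h1]

theorem namMixed_pair (v w : Space 4) (ξ η : Fin 4 → ℝ) : namMixed c v w ξ η
    = nam ![dir v (c 0), dir w (c 1)] ξ η + nam ![dir w (c 0), dir v (c 1)] ξ η := by
  have e0 : (Finset.univ.erase (0 : Fin 2)) = {1} := by decide
  have e1 : (Finset.univ.erase (1 : Fin 2)) = {0} := by decide
  rw [namMixed, Fin.sum_univ_two, e0, e1, Finset.sum_singleton, Finset.sum_singleton]
  congr 2 <;> funext i <;> fin_cases i <;> rfl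

/-- The two additional terms are determinants with gradient rows built from dir v (c 0) and dir w (c
0) in opposite orders, so they cancel. -/
theorem namMixed_shift (t : ℝ) : namMixed ![c 0, c 1 + t • c 0] = namMixed c := by
  funext v w ξ η
  have hd : ∀ v : Space 4, dir v (c 1 + t • c 0) = dir v (c 1) + t • dir v (c 0) := fun v => by
    rw [dir_add, dir_smul]
  rw [namMixed_pair, namMixed_pair]
  simp only [Matrix.cons_val_zero, Matrix.cons_val_one]
  rw [hd, hd, nam_pair_add_right, nam_pair_add_right, nam_pair_smul_right, nam_pair_smul_right,
    nam_pair_swap (dir w (c 0)) (dir v (c 0)), smul_neg]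
  abel

/-- The defect vanishes on the pairs of covectors which determine it, up to exchange of the first
two vectors of the frame. -/
structure DefectZero (b' : Fin 4 → Fin 4 → ℝ) : Prop where
  zero_one : defectAt c ρ (evalAt x) (b' 0) (b' 1) = 0
  zero_two : defectAt c ρ (evalAt x) (b' 0) (b' 2) = 0
  zero_three : defectAt c ρ (evalAt x) (b' 0) (b' 3) = 0
  two_three : defectAt c ρ (evalAt x) (b' 2) (b' 3) = 0
  fst : casDefectAt c ρ (evalAt x) (c 0) = 0
  snd : casDefectAt c ρ (evalAt x) (c 1) = 0

variable {x c ρ} in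
theorem DefectZero.of_normal (h : DualFrame b b')
    (hn : NormalFour (fun i => dir (b i)) (evalAt x) (c 0) (c 1)) : DefectZero x c ρ b' := by
  obtain ⟨⟨k1, k2, k3, k4⟩, k5, k6⟩ := defect_four_zero c ρ h (evalAt x) hn
  exact ⟨k1, k2, k3, k4, k5, k6⟩

variable {x c ρ} in
-- The shift changes neither the bracket nor its mixed part, hence not the defect; only the last
-- covector of the coframe is different. Its contribution is undone by bilinearity, using that the
-- defect vanishes on the pair 02 and on the diagonal.
theorem DefectZero.of_shift {t : ℝ} (h : DefectZero x ![c 0, c 1 + t • c 0] ρ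
    (Function.update b' 3 (b' 3 + t • b' 2))) : DefectZero x c ρ b' := by
  obtain ⟨k1, k2, k3, k4, k5, k6⟩ := h
  have hN : ∀ ξ η, defectAt ![c 0, c 1 + t • c 0] ρ (evalAt x) ξ η
      = defectAt c ρ (evalAt x) ξ η := fun ξ η => by
    unfold defectAt
    rw [nam_shift, namMixed_shift]
  have hC : ∀ f, casDefectAt ![c 0, c 1 + t • c 0] ρ (evalAt x) f
      = casDefectAt c ρ (evalAt x) f := fun f => by
    unfold casDefectAt
    rw [nam_shift, namMixed_shift]
  rw [hC] at k5 k6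
  rw [hN] at k1 k2 k3 k4
  generalize hu : b' 3 + t • b' 2 = u at *
  have e0 : Function.update b' 3 u 0 = b' 0 := Function.update_of_ne (by decide) _ _
  have e1 : Function.update b' 3 u 1 = b' 1 := Function.update_of_ne (by decide) _ _
  have e2 : Function.update b' 3 u 2 = b' 2 := Function.update_of_ne (by decide) _ _
  have e3 : Function.update b' 3 u 3 = u := Function.update_self _ _ _
  rw [e0, e1] at k1
  rw [e0, e2] at k2
  rw [e0, e3] at k3
  rw [e2, e3] at k4
  have s : ∀ ξ, defectAt c ρ (evalAt x) ξ u
      = defectAt c ρ (evalAt x) ξ (b' 3) + t * defectAt c ρ (evalAt x) ξ (b' 2) := fun ξ => by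
    rw [defectAt_swap, ← hu, defectAt_add, defectAt_smul (m := 2), defectAt_swap c ρ _ (b' 3),
      defectAt_swap c ρ _ (b' 2)]
    ring
  rw [s, k2] at k3
  rw [s, defectAt_self] at k4
  have k5' : casDefectAt c ρ (evalAt x) (c 0) = 0 := k5
  have k6' : casDefectAt c ρ (evalAt x) (c 1 + t • c 0) = 0 := k6
  rw [casDefectAt_add_smul (m := 2), k5'] at k6'
  exact ⟨k1, k2, by linarith, by linarith, k5', by linarith⟩

variable {x c ρ} in
-- An adapted frame leaves the second derivative of the second Casimir along b 0 arbitrary. The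
-- first Casimir has there the value 1, so subtracting t times it reaches the normal form; the 01
-- entry stays zero because the first Casimir has none.
theorem AdaptedFour.defectZero (h : AdaptedFour b b' (evalAt x) (c 0) (c 1)) :
    DefectZero x c ρ b' := by
  set t : ℝ := evalAt x (dir (b 0) (dir (b 0) (c 1))) with ht
  -- The gradient of the shifted Casimir is b' 3 − t b' 2. Duality then forces b 2 to become b 2 + t
  -- b 3 and leaves the other frame vectors alone.
  let b2 := Function.update b 2 (b 2 + t • b 3)
  let b2' := Function.update b' 3 (b' 3 + (-t) • b' 2)
  have p := h.dual.pairing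
  have hd : DualFrame b2 b2' := by
    refine ⟨fun i j => ?_⟩
    fin_cases i <;> fin_cases j <;> simp [b2, b2', p]
  have hb : ∀ i, i ≠ 2 → b2 i = b i := fun i hi => Function.update_of_ne hi _ _
  have hb2 : b2 2 = b 2 + t • b 3 := Function.update_self _ _ _
  have d2 : ∀ f, dir (b2 2) f = dir (b 2) f + t • dir (b 3) f := fun f => by
    rw [hb2, (lin_dir_left f).map_add, (lin_dir_left f).map_smul]
  have hn : NormalFour (fun i => dir (b2 i)) (evalAt x) (c 0) (c 1 + (-t) • c 0) := by
    refine ⟨fun i => ?_, fun i j hi => ?_, fun i => ?_, ?_, ?_⟩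
    · by_cases hi : i = 2
      · subst hi
        rw [d2, map_add, evalAt_smul, h.fst_one, h.fst_one]; simp
      · rw [hb i hi, h.fst_one]
    · have hi2 : i ≠ 2 := by rintro rfl; rcases hi with hi | hi <;> exact absurd hi (by decide)
      rw [hb i hi2]
      by_cases hj : j = 2
      · subst hj
        rw [d2, dir_add, dir_smul, map_add, evalAt_smul, h.fst_two i _ hi, h.fst_two i _ hi,
          if_neg hi2, if_neg (by rintro rfl; rcases hi with hi | hi <;> exact absurd hi (by decide))]
        simp
      · rw [hb j hj, h.fst_two i j hi]
    · rw [dir_add, dir_smul, map_add, evalAt_smul]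
      by_cases hi : i = 2
      · subst hi
        rw [d2, d2, map_add, map_add, evalAt_smul, evalAt_smul]
        simp [h.fst_one, h.snd_one]
      · rw [hb i hi, h.fst_one, h.snd_one, if_neg hi]; simp
    · rw [hb 0 (by decide), dir_add, dir_smul, dir_add, dir_smul, map_add, evalAt_smul, ← ht,
        h.fst_two 0 0 (Or.inl rfl)]
      simp
    · rw [hb 0 (by decide), hb 1 (by decide), dir_add, dir_smul, dir_add, dir_smul, map_add,
        evalAt_smul, h.snd_zero_one, h.fst_two 0 1 (Or.inl rfl)]
      simp
  exact .of_shift (t := -t) (.of_normal hd hn)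

/-- The conditions on an adapted frame treat b 0 and b 1 alike, unlike those of the normal form. For
this reason the exchange is made before the shift. -/
theorem AdaptedFour.swap {f g : Smooth 4} {e : Smooth 4 →+* ℝ} (h : AdaptedFour b b' e f g) :
    AdaptedFour (b ∘ Equiv.swap 0 1) (b' ∘ Equiv.swap 0 1) e f g := by
  refine ⟨⟨fun i j => ?_⟩, fun i => ?_, fun i j hi => ?_, fun i => ?_, ?_⟩
  · rw [Function.comp_apply, Function.comp_apply, h.dual.pairing]; simp
  · have e : Equiv.swap 0 1 i = 2 ↔ i = 2 := by revert i; decide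
    rw [Function.comp_apply, h.fst_one]; simp only [e]
  · rw [Function.comp_apply, Function.comp_apply, h.fst_two]
    · simp
    · revert i; decide
  · have e : Equiv.swap 0 1 i = 3 ↔ i = 3 := by revert i; decide
    rw [Function.comp_apply, h.snd_one]; simp only [e]
  · rw [dir_comm]; simpa using h.snd_zero_one

variable {x c ρ} in
theorem AdaptedFour.defect_zero (h : AdaptedFour b b' (evalAt x) (c 0) (c 1)) :
    (∀ ξ η, defectAt c ρ (evalAt x) ξ η = 0) ∧
    ∀ i, casDefectAt c ρ (evalAt x) (c i) = 0 := by
  have k := h.defectZero (ρ := ρ)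
  have l := h.swap.defectZero (ρ := ρ)
  refine ⟨defectAt_eq_zero c ρ h.dual x ?_, fun i => ?_⟩
  · have h0 : ∀ i : Fin 4, 0 < i → defectAt c ρ (evalAt x) (b' 0) (b' i) = 0 := fun i hi => by
      have : i = 1 ∨ i = 2 ∨ i = 3 := by revert i; decide
      rcases this with rfl | rfl | rfl
      exacts [k.zero_one, k.zero_two, k.zero_three]
    have h1 : ∀ i : Fin 4, 1 < i → defectAt c ρ (evalAt x) (b' 1) (b' i) = 0 := fun i hi => by
      have : i = 2 ∨ i = 3 := by revert i; decide
      rcases this with rfl | rfl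
      exacts [l.zero_two, l.zero_three]
    intro i j hij
    have : i = 0 ∨ i = 1 ∨ i = 2 ∧ j = 3 := by revert i j; decide
    rcases this with rfl | rfl | ⟨rfl, rfl⟩
    exacts [h0 j hij, h1 j hij, k.two_three]
  · have : i = 0 ∨ i = 1 := by revert i; decide
    rcases this with rfl | rfl
    exacts [k.fst, k.snd]

end Four

section Three

theorem three_defect_zero {b b' : Fin 3 → Fin 3 → ℝ} (x : Space 3) (c : Fin 1 → Smooth 3)
    (ρ : Smooth 3) (h : DualFrame b b')
    (h1 : ∀ i, evalAt x (dir (b i) (c 0)) = if i = 2 then 1 else 0)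
    (h2 : ∀ i j, i = 0 ∨ i = 1 →
      evalAt x (dir (b i) (dir (b j) (c 0))) = if i = j then 1 else 0) :
    (∀ ξ η, defectAt c ρ (evalAt x) ξ η = 0) ∧
    ∀ i, casDefectAt c ρ (evalAt x) (c i) = 0 := by
  obtain ⟨⟨k1, k2, k3⟩, k4⟩ := defect_three_zero c ρ h (evalAt x) h1 h2
  refine ⟨defectAt_eq_zero c ρ h x fun i j hij => ?_, fun i => ?_⟩
  · have : i = 0 ∧ j = 1 ∨ i = 0 ∧ j = 2 ∨ i = 1 ∧ j = 2 := by revert i j; decide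
    rcases this with ⟨rfl, rfl⟩ | ⟨rfl, rfl⟩ | ⟨rfl, rfl⟩
    exacts [k1, k2, k3]
  · rw [Subsingleton.elim i 0]; exact k4

end Three

/-! ## Adapted frames -/

section LinearAlgebra

variable {n m : ℕ}

theorem abs_mul_le_dotProduct (v : Fin n → ℝ) (i j : Fin n) : |v i * v j| ≤ v ⬝ᵥ v := by
  have h : ∀ i, v i ^ 2 ≤ v ⬝ᵥ v := fun i => by
    rw [dotProduct]
    simp only [← pow_two]
    exact Finset.single_le_sum (f := fun i => v i ^ 2) (fun i _ => sq_nonneg (v i))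
      (Finset.mem_univ i)
  rw [abs_mul]
  have := h i
  have := h j
  nlinarith [sq_nonneg (|v i| - |v j|), sq_abs (v i), sq_abs (v j)]

/-- A matrix becomes positive definite upon adding a large multiple of the identity. -/
theorem add_smul_dotProduct_pos (M : Matrix (Fin n) (Fin n) ℝ) {s : ℝ}
    (hs : ∑ i, ∑ j, |M i j| < s) {v : Fin n → ℝ} (hv : v ≠ 0) :
    0 < v ⬝ᵥ M.mulVec v + s * (v ⬝ᵥ v) := by
  have h0 : 0 < v ⬝ᵥ v := by
    rcases (dotProduct_self_star_nonneg v).lt_or_eq with h | h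
    · simpa using h
    · exact absurd (dotProduct_self_eq_zero.1 (by simpa using h.symm)) hv
  have h1 : |v ⬝ᵥ M.mulVec v| ≤ (∑ i, ∑ j, |M i j|) * (v ⬝ᵥ v) := by
    simp only [dotProduct, Matrix.mulVec, Finset.mul_sum]
    rw [← Finset.mul_sum, Finset.sum_mul]
    refine (Finset.abs_sum_le_sum_abs _ _).trans (Finset.sum_le_sum fun i _ => ?_)
    rw [Finset.sum_mul]
    refine (Finset.abs_sum_le_sum_abs _ _).trans (Finset.sum_le_sum fun j _ => ?_)
    rw [show v i * (M i j * v j) = M i j * (v i * v j) by ring, abs_mul]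
    exact mul_le_mul_of_nonneg_left (abs_mul_le_dotProduct v i j) (abs_nonneg _)
  have h2 := (abs_le.1 h1).1
  nlinarith

/-- F is the off-diagonal entry of a quadratic form in a basis rotated by t. A quarter turn changes
its sign, so it vanishes somewhere in between. -/
theorem exists_pair_diagonal (F : ℝ → ℝ) (p q r : ℝ)
    (hF : ∀ t, F t = (Real.cos t ^ 2 - Real.sin t ^ 2) * q + Real.cos t * Real.sin t * (r - p)) :
    ∃ t, F t = 0 := by
  have hc : Continuous F := by
    rw [funext hF]; fun_prop
  have h0 : F 0 = q := by rw [hF]; simp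
  have h1 : F (Real.pi / 2) = -q := by rw [hF]; simp
  rcases le_total q 0 with h | h
  · exact mem_range_of_exists_le_of_exists_ge hc ⟨0, by rw [h0]; exact h⟩
      ⟨Real.pi / 2, by rw [h1]; linarith⟩
  · exact mem_range_of_exists_le_of_exists_ge hc ⟨Real.pi / 2, by rw [h1]; linarith⟩
      ⟨0, by rw [h0]; exact h⟩

theorem exists_ne_zero_dotProduct_eq_zero {k : ℕ} (hk : k < n) (w : Fin k → Fin n → ℝ) :
    ∃ v : Fin n → ℝ, v ≠ 0 ∧ ∀ i, w i ⬝ᵥ v = 0 := by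
  have h := LinearMap.ker_ne_bot_of_finrank_lt (f := (Matrix.of w).mulVecLin)
    (by rw [Module.finrank_fin_fun, Module.finrank_fin_fun]; exact hk)
  obtain ⟨v, hv, h0⟩ := Submodule.exists_mem_ne_zero_of_ne_bot h
  refine ⟨v, h0, fun i => ?_⟩
  exact congrFun (LinearMap.mem_ker.1 hv) i

variable {S Q : Matrix (Fin (m + 2)) (Fin (m + 2)) ℝ}
  (hS : ∀ v w, v ⬝ᵥ S.mulVec w = w ⬝ᵥ S.mulVec v) (hpos : ∀ v, v ≠ 0 → 0 < v ⬝ᵥ S.mulVec v)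
  (hQ : ∀ v w, v ⬝ᵥ Q.mulVec w = w ⬝ᵥ Q.mulVec v) (G : Fin m → Fin (m + 2) → ℝ)

include hS hpos

theorem exists_orthonormal_pair : ∃ u v : Fin (m + 2) → ℝ, (∀ α, G α ⬝ᵥ u = 0) ∧
    (∀ α, G α ⬝ᵥ v = 0) ∧ u ⬝ᵥ S.mulVec u = 1 ∧ v ⬝ᵥ S.mulVec v = 1 ∧ u ⬝ᵥ S.mulVec v = 0 := by
  have hn : ∀ v : Fin (m + 2) → ℝ, v ≠ 0 → ∃ t : ℝ, (t • v) ⬝ᵥ S.mulVec (t • v) = 1 := fun v hv => by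
    have hp := hpos v hv
    refine ⟨(√(v ⬝ᵥ S.mulVec v))⁻¹, ?_⟩
    rw [Matrix.mulVec_smul, smul_dotProduct, dotProduct_smul, smul_eq_mul, smul_eq_mul, ← mul_assoc,
      ← mul_inv, Real.mul_self_sqrt hp.le, inv_mul_cancel₀ hp.ne']
  obtain ⟨u, hu, hGu⟩ := exists_ne_zero_dotProduct_eq_zero (show m < m + 2 by omega) G
  -- Orthogonality to u for the form S is one more linear condition besides the m covectors; there
  -- is still one dimension left.
  obtain ⟨v, hv, hGv⟩ := exists_ne_zero_dotProduct_eq_zero (show m + 1 < m + 2 by omega)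
    (Fin.cons (S.mulVec u) G : Fin (m + 1) → Fin (m + 2) → ℝ)
  obtain ⟨t, ht⟩ := hn u hu
  obtain ⟨t', ht'⟩ := hn v hv
  have h1 : S.mulVec u ⬝ᵥ v = 0 := hGv 0
  refine ⟨t • u, t' • v, fun α => ?_, fun α => ?_, ht, ht', ?_⟩
  · rw [dotProduct_smul, hGu, smul_zero]
  · have : G α ⬝ᵥ v = 0 := hGv α.succ
    rw [dotProduct_smul, this, smul_zero]
  · rw [hS, Matrix.mulVec_smul, smul_dotProduct, dotProduct_smul, dotProduct_comm, h1, smul_zero,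
      smul_zero]

include hQ

/-- Simultaneous diagonalisation of two quadratic forms on the common kernel of covectors. -/
theorem exists_diagonal_pair : ∃ u v : Fin (m + 2) → ℝ, (∀ α, G α ⬝ᵥ u = 0) ∧
    (∀ α, G α ⬝ᵥ v = 0) ∧ u ⬝ᵥ S.mulVec u = 1 ∧ v ⬝ᵥ S.mulVec v = 1 ∧ u ⬝ᵥ S.mulVec v = 0 ∧
    u ⬝ᵥ Q.mulVec v = 0 := by
  obtain ⟨u, v, hu, hv, huu, hvv, huv⟩ := exists_orthonormal_pair hS hpos G
  have hvu : v ⬝ᵥ S.mulVec u = 0 := by rw [hS, huv]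
  obtain ⟨t, ht⟩ := exists_pair_diagonal (fun t => (Real.cos t • u + Real.sin t • v) ⬝ᵥ
    Q.mulVec (-Real.sin t • u + Real.cos t • v)) (u ⬝ᵥ Q.mulVec u) (u ⬝ᵥ Q.mulVec v)
    (v ⬝ᵥ Q.mulVec v) (fun t => by
      simp only [Matrix.mulVec_add, Matrix.mulVec_smul, add_dotProduct, dotProduct_add,
        smul_dotProduct, dotProduct_smul, smul_eq_mul]
      rw [hQ v u]; ring)
  have hcs := Real.cos_sq_add_sin_sq t
  refine ⟨_, _, fun α => ?_, fun α => ?_, ?_, ?_, ?_, ht⟩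
  · rw [dotProduct_add, dotProduct_smul, dotProduct_smul, hu, hv]; simp
  · rw [dotProduct_add, dotProduct_smul, dotProduct_smul, hu, hv]; simp
  all_goals
    simp only [Matrix.mulVec_add, Matrix.mulVec_smul, add_dotProduct, dotProduct_add,
        smul_dotProduct, dotProduct_smul, smul_eq_mul, huu, hvv, huv, hvu]
    first | linear_combination hcs | ring

variable {G} in
-- Take as coframe S u, S v and the given covectors, with u, v an S-orthonormal and Q-orthogonal
-- pair in the common kernel. Its dual frame starts with u, v. When S is the Hessian of a function,
-- pairing b'₀ = S b₀ with any bⱼ is a second derivative, so duality prescribes all second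
-- derivatives in which u or v takes part.
theorem exists_adapted_frame (hG : LinearIndependent ℝ G) :
    ∃ b b' : Fin (m + 2) → Fin (m + 2) → ℝ, DualFrame b b' ∧ b' 0 = S.mulVec (b 0) ∧
      b' 1 = S.mulVec (b 1) ∧ (∀ α : Fin m, b' α.succ.succ = G α) ∧
      b 0 ⬝ᵥ Q.mulVec (b 1) = 0 := by
  obtain ⟨u, v, hu, hv, huu, hvv, huv, hq⟩ := exists_diagonal_pair hS hpos hQ G
  have hvu : v ⬝ᵥ S.mulVec u = 0 := by rw [hS, huv]
  let M : Matrix (Fin (m + 2)) (Fin (m + 2)) ℝ := Matrix.of (Fin.cons (S.mulVec u)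
    (Fin.cons (S.mulVec v) G : Fin (m + 1) → Fin (m + 2) → ℝ) : Fin (m + 2) → Fin (m + 2) → ℝ)
  have hMu : M.mulVec u = Pi.single 0 1 := by
    funext i
    refine Fin.cases ?_ (fun i => Fin.cases ?_ (fun i => ?_) i) i
    · change S.mulVec u ⬝ᵥ u = _
      rw [dotProduct_comm, huu]; simp
    · change S.mulVec v ⬝ᵥ u = _
      rw [dotProduct_comm, huv]; simp
    · exact (hu i).trans (by simp)
  have hMv : M.mulVec v = Pi.single 1 1 := by
    funext i
    refine Fin.cases ?_ (fun i => Fin.cases ?_ (fun i => ?_) i) i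
    · change S.mulVec u ⬝ᵥ v = _
      rw [dotProduct_comm, hvu]; simp
    · change S.mulVec v ⬝ᵥ v = _
      rw [dotProduct_comm, hvv]; simp
    · refine (hv i).trans ?_
      rw [Pi.single_eq_of_ne]
      rw [← Fin.succ_zero_eq_one]; exact fun h => Fin.succ_ne_zero _ (Fin.succ_injective _ h)
  have hM : IsUnit M := by
    rw [← Matrix.linearIndependent_rows_iff_isUnit, Fintype.linearIndependent_iff]
    intro g hg
    -- A linear relation between the rows, paired with u and v, loses its first two coefficients;
    -- the others vanish by independence of the given covectors.
    have hgw : ∀ w, g ⬝ᵥ M.mulVec w = 0 := fun w => by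
      rw [Matrix.dotProduct_mulVec]
      have : Matrix.vecMul g M = 0 := by
        rw [← hg]; funext k; simp [Matrix.vecMul, dotProduct, Finset.sum_apply]
      rw [this, zero_dotProduct]
    have g0 : g 0 = 0 := by simpa [hMu] using hgw u
    have g1 : g 1 = 0 := by simpa [hMv] using hgw v
    have g2 : ∀ α : Fin m, g α.succ.succ = 0 := by
      rw [Fin.sum_univ_succ, Fin.sum_univ_succ, g0, Fin.succ_zero_eq_one, g1, zero_smul, zero_smul,
        zero_add, zero_add] at hg
      exact Fintype.linearIndependent_iff.1 hG _ hg
    intro i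
    exact Fin.cases g0 (fun i => Fin.cases g1 g2 i) i
  have hinv : ∀ w, M⁻¹.mulVec (M.mulVec w) = w := fun w => by
    rw [Matrix.mulVec_mulVec, Matrix.nonsing_inv_mul _ ((Matrix.isUnit_iff_isUnit_det M).1 hM),
      Matrix.one_mulVec]
  have hb0 : M⁻¹.mulVec (Pi.single 0 1) = u := by rw [← hMu, hinv]
  have hb1 : M⁻¹.mulVec (Pi.single 1 1) = v := by rw [← hMv, hinv]
  refine ⟨fun i => M⁻¹.mulVec (Pi.single i 1), M, ⟨fun i j => ?_⟩, ?_, ?_, fun α => rfl, ?_⟩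
  · have : M i ⬝ᵥ M⁻¹.mulVec (Pi.single j 1) = (M.mulVec (M⁻¹.mulVec (Pi.single j 1))) i := rfl
    rw [this, Matrix.mulVec_mulVec, Matrix.mul_nonsing_inv _ ((Matrix.isUnit_iff_isUnit_det M).1 hM),
      Matrix.one_mulVec, Pi.single_apply]
  · exact (congrArg S.mulVec hb0).symm
  · exact (congrArg S.mulVec hb1).symm
  · exact (congrArg₂ (fun p q => p ⬝ᵥ Q.mulVec q) hb0 hb1).trans hq

end LinearAlgebra

/-! ## Vanishing of the defect -/

section Hessian

variable {d : ℕ} (f : Smooth d) (x : Space d)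

/-- The gradient at a point. -/
def grad (i : Fin d) : ℝ := evalAt x (dir (unit i) f)

/-- The Hessian at a point. -/
def hess : Matrix (Fin d) (Fin d) ℝ := Matrix.of fun i j => evalAt x (dir (unit i) (dir (unit j) f))

theorem evalAt_dir_eq (v : Space d) : evalAt x (dir v f) = grad f x ⬝ᵥ v := by
  rw [dir_eq_sum, map_sum, dotProduct]
  exact Finset.sum_congr rfl fun i _ => by rw [evalAt_smul, mul_comm]; rfl

theorem evalAt_dir_dir (v w : Space d) :
    evalAt x (dir v (dir w f)) = v ⬝ᵥ (hess f x).mulVec w := by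
  rw [dir_eq_sum, map_sum, dotProduct]
  refine Finset.sum_congr rfl fun i _ => ?_
  rw [evalAt_smul, dir_comm, evalAt_dir_eq]
  congr 1
  rw [Matrix.mulVec, dotProduct, dotProduct]
  refine Finset.sum_congr rfl fun j _ => ?_
  rw [grad, dir_comm]; rfl

theorem hess_symm (v w : Space d) : v ⬝ᵥ (hess f x).mulVec w = w ⬝ᵥ (hess f x).mulVec v := by
  rw [← evalAt_dir_dir, ← evalAt_dir_dir, dir_comm]

end Hessian

/-- In an adapted frame both kinds of prescribed derivatives are pairings of the coframe with the
frame: gradients because they belong to the coframe, second derivatives because b'ᵢ is the Hessian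
applied to bᵢ. With one Casimir the second form Q plays no role, so the same Hessian is used for it.
-/
theorem defect_zero_of_posDef_three (c : Fin 1 → Smooth 3) (ρ : Smooth 3) (x : Space 3)
    (hG : LinearIndependent ℝ fun α => grad (c α) x)
    (hpos : ∀ v, v ≠ 0 → 0 < v ⬝ᵥ (hess (c 0) x).mulVec v) :
    (∀ ξ η, defectAt c ρ (evalAt x) ξ η = 0) ∧ ∀ i, casDefectAt c ρ (evalAt x) (c i) = 0 := by
  obtain ⟨b, b', h, h0, h1, h2, -⟩ := exists_adapted_frame (m := 1) (hess_symm (c 0) x) hpos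
    (hess_symm (c 0) x) hG
  have h2' : b' 2 = grad (c 0) x := h2 0
  refine three_defect_zero x c ρ h (fun i => ?_) (fun i j hi => ?_)
  · rw [evalAt_dir_eq, ← h2', h.pairing]; simp only [eq_comm]
  · rw [dir_comm, evalAt_dir_dir, dotProduct_comm]
    rcases hi with rfl | rfl
    · rw [← h0, h.pairing]
    · rw [← h1, h.pairing]

theorem defect_zero_of_posDef_four (c : Fin 2 → Smooth 4) (ρ : Smooth 4) (x : Space 4)
    (hG : LinearIndependent ℝ fun α => grad (c α) x)
    (hpos : ∀ v, v ≠ 0 → 0 < v ⬝ᵥ (hess (c 0) x).mulVec v) :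
    (∀ ξ η, defectAt c ρ (evalAt x) ξ η = 0) ∧ ∀ i, casDefectAt c ρ (evalAt x) (c i) = 0 := by
  obtain ⟨b, b', h, h0, h1, h2, h3⟩ := exists_adapted_frame (m := 2) (hess_symm (c 0) x) hpos
    (hess_symm (c 1) x) hG
  have h2' : b' 2 = grad (c 0) x := h2 0
  have h3' : b' 3 = grad (c 1) x := h2 1
  refine AdaptedFour.defect_zero (b := b) (b' := b') ⟨h, fun i => ?_, fun i j hi => ?_, fun i => ?_, ?_⟩
  · rw [evalAt_dir_eq, ← h2', h.pairing]; simp only [eq_comm]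
  · rw [dir_comm, evalAt_dir_dir, dotProduct_comm]
    rcases hi with rfl | rfl
    · rw [← h0, h.pairing]
    · rw [← h1, h.pairing]
  · rw [evalAt_dir_eq, ← h3', h.pairing]; simp only [eq_comm]
  · rw [evalAt_dir_dir]; exact h3

/-! ## Differential polynomials of Nambu brackets -/

section Data

variable {m : ℕ}

/-- The components of the Nambu determinant. -/
def namC (c : Fin m → Smooth (m + 2)) (i j : Fin (m + 2)) : Smooth (m + 2) :=
  nam c (unit i) (unit j)

/-- The components of the mixed part of the second derivatives of the Nambu determinant. -/
def mixC (c : Fin m → Smooth (m + 2)) (v w i j : Fin (m + 2)) : Smooth (m + 2) :=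
  namMixed c (unit v) (unit w) (unit i) (unit j)

/-- The partial derivatives of smooth functions. -/
def pdS {d : ℕ} (k : Fin d) : Smooth d → Smooth d := dir (unit k)

namespace DiffPoly

/-- The rows of the Jacobian matrix as differential polynomials. -/
def row (α : Fin m) (k : Fin (m + 2)) : DiffPoly m := MvPolynomial.X (some α, [k])

/-- A Nambu determinant as a differential polynomial. -/
def namRow (G : Fin m → Fin (m + 2) → DiffPoly m) (i j : Fin (m + 2)) : DiffPoly m :=
  rowDet (fun k => MvPolynomial.C ((unit i : Fin (m + 2) → ℝ) k))
    (fun k => MvPolynomial.C ((unit j : Fin (m + 2) → ℝ) k)) G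

/-- The components of the Nambu determinant as differential polynomials. -/
def namC (i j : Fin (m + 2)) : DiffPoly m := namRow row i j

/-- The differential polynomials whose values are the functions `mixC`. -/
def mixC (v w i j : Fin (m + 2)) : DiffPoly m :=
  ∑ α, ∑ β ∈ Finset.univ.erase α,
    namRow (Function.update (Function.update row α fun k => D v (row α k)) β
      fun k => D w (row β k)) i j

/-- The density as a differential polynomial. -/
def density : DiffPoly m := MvPolynomial.X (none, [])

variable (ρ : Smooth (m + 2)) (c : Fin m → Smooth (m + 2))

/-- A differential polynomial and a smooth function which is its value. -/
def IsValue (p : DiffPoly m) (f : Smooth (m + 2)) : Prop := value p ρ (fun α => c α) = f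

variable {ρ c}

theorem isValue_D {p : DiffPoly m} {f : Smooth (m + 2)} (k : Fin (m + 2)) (h : IsValue ρ c p f) :
    IsValue ρ c (D k p) (pdS k f) := by
  unfold IsValue at *
  rw [value_D (contDiff_coe ρ) (fun α => contDiff_coe (c α)), h]; rfl

/-- Differential polynomials can be differentiated without limit, so the relation is constant in the
order. Parametricity then shows that each expression over differential polynomials has the same
expression over smooth functions as its value. -/
theorem isValue_dRel : DRel (fun _ => IsValue ρ c) (fun k => D k) (pdS (d := m + 2)) where
  add h h' := by unfold IsValue at *; rw [value_add, h, h']; rfl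
  mul h h' := by unfold IsValue at *; rw [value_mul, h, h']; rfl
  neg h := by unfold IsValue at *; rw [value_neg, h]; rfl
  zero := value_zero
  der k h := isValue_D k h
  mono h := h

theorem isValue_row (α : Fin m) (k : Fin (m + 2)) : IsValue ρ c (row α k) (pdS k (c α)) := by
  unfold IsValue
  rw [row, value_X]; rfl

theorem isValue_density : IsValue ρ c density ρ := by
  unfold IsValue
  rw [density, value_X]; rfl

theorem isValue_namRow {G : Fin m → Fin (m + 2) → DiffPoly m} {G' : Fin m → Fin (m + 2) → Smooth (m + 2)}
    (h : ∀ α k, IsValue ρ c (G α k) (G' α k)) (i j : Fin (m + 2)) :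
    IsValue ρ c (namRow G i j) (rowDet (fun k => algebraMap ℝ _ ((unit i : Fin (m + 2) → ℝ) k))
      (fun k => algebraMap ℝ _ ((unit j : Fin (m + 2) → ℝ) k)) G') := by
  funext x
  rw [namRow, value, map_rowDet]
  refine Eq.trans ?_ (map_rowDet (evalAt x) _ _ _).symm
  simp only [MvPolynomial.eval_C]
  exact congrArg (rowDet _ _) (funext fun α => funext fun k => congrFun (h α k) x)

theorem isValue_namC (i j : Fin (m + 2)) : IsValue ρ c (namC i j) (NambuFlow.namC c i j) :=
  isValue_namRow (fun α k => isValue_row α k) i j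

theorem isValue_sum {ι : Type*} (s : Finset ι) {p : ι → DiffPoly m} {f : ι → Smooth (m + 2)}
    (h : ∀ i, IsValue ρ c (p i) (f i)) : IsValue ρ c (∑ i ∈ s, p i) (∑ i ∈ s, f i) := by
  classical
  induction s using Finset.induction_on with
  | empty => exact value_zero
  | insert a s ha ih =>
    rw [Finset.sum_insert ha, Finset.sum_insert ha]
    exact isValue_dRel.add (n := 0) (h a) ih

theorem isValue_mixC (v w i j : Fin (m + 2)) :
    IsValue ρ c (mixC v w i j) (NambuFlow.mixC c v w i j) := by
  refine isValue_sum _ fun α => isValue_sum _ fun β => isValue_namRow (fun γ k => ?_) i j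
  by_cases hβ : γ = β
  · subst hβ
    rw [Function.update_self, Function.update_self]
    have := isValue_D w (isValue_row (ρ := ρ) (c := c) γ k)
    unfold IsValue at *
    rw [this, pdS, pdS, dir_comm]
  · rw [Function.update_of_ne hβ, Function.update_of_ne hβ]
    by_cases hα : γ = α
    · subst hα
      rw [Function.update_self, Function.update_self]
      have := isValue_D v (isValue_row (ρ := ρ) (c := c) γ k)
      unfold IsValue at *
      rw [this, pdS, pdS, dir_comm]
    · rw [Function.update_of_ne hα, Function.update_of_ne hα]
      exact isValue_row γ k

/-- The defect of the trivialisation as a differential polynomial. -/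
def defect (i j : Fin (m + 2)) : DiffPoly m :=
  Expr.defect (diag (m + 2)) (fun k => D k) density namC mixC i j

/-- The defect of the velocity of a Casimir as a differential polynomial. -/
def casDefect (α : Fin m) : DiffPoly m :=
  Expr.casDefect (diag (m + 2)) (fun k => D k) density namC mixC (MvPolynomial.X (some α, []))

theorem isValue_defect (i j : Fin (m + 2)) : IsValue ρ c (defect i j)
    (Expr.defect (diag (m + 2)) pdS ρ (NambuFlow.namC c) (NambuFlow.mixC c) i j) :=
  isValue_dRel.defect (n := 0) isValue_density isValue_namC isValue_mixC i j

theorem isValue_casDefect (α : Fin m) : IsValue ρ c (casDefect α)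
    (Expr.casDefect (diag (m + 2)) pdS ρ (NambuFlow.namC c) (NambuFlow.mixC c) (c α)) :=
  isValue_dRel.casDefect (n := 0) isValue_density isValue_namC isValue_mixC
    (by unfold IsValue; rw [value_X]; rfl)

end DiffPoly

theorem dualFrame_unit (d : ℕ) : DualFrame (unit (d := d)) unit :=
  ⟨fun i j => by simp [Pi.single_apply, eq_comm]⟩

theorem defect_unit (c : Fin m → Smooth (m + 2)) (ρ : Smooth (m + 2)) (e : Smooth (m + 2) →+* ℝ)
    (i j : Fin (m + 2)) :
    e (defect (diag (m + 2)) pdS ρ (namC c) (mixC c) i j) = defectAt c ρ e (unit i) (unit j) :=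
  congrArg e (defect_frame (dualFrame_unit _) c ρ i j).symm

theorem casDefect_unit (c : Fin m → Smooth (m + 2)) (ρ : Smooth (m + 2)) (e : Smooth (m + 2) →+* ℝ)
    (f : Smooth (m + 2)) :
    e (casDefect (diag (m + 2)) pdS ρ (namC c) (mixC c) f) = casDefectAt c ρ e f :=
  congrArg e (casDefect_frame (dualFrame_unit _) c ρ f).symm

end Data

/-! ## Density of the generic case -/

section Density

variable {d m : ℕ}

/-- The coordinate functions. -/
def coord (k : Fin d) : Smooth d := ⟨fun y => y k, show ContDiff ℝ ∞ _ from contDiff_apply ℝ ℝ k⟩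

theorem dir_coord (v : Space d) (k : Fin d) : dir v (coord k) = algebraMap ℝ _ (v k) := by
  refine Smooth.ext_eval fun x => ?_
  rw [evalAt_dir]
  have : ((coord k : Smooth d) : Scalar d) = (ContinuousLinearMap.proj k : Space d →L[ℝ] ℝ) := rfl
  rw [this, ContinuousLinearMap.fderiv]; rfl

theorem dir_sum {ι : Type*} (s : Finset ι) (v : Space d) (f : ι → Smooth d) :
    dir v (∑ i ∈ s, f i) = ∑ i ∈ s, dir v (f i) := map_sum ((lin_dir v).mk') _ _

/-- Half the squared distance to a point. -/
def halfSq (x : Space d) : Smooth d :=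
  ∑ k, (1 / 2 : ℝ) • ((coord k - algebraMap ℝ _ (x k)) * (coord k - algebraMap ℝ _ (x k)))

theorem dir_halfSq (x v : Space d) :
    dir v (halfSq x) = ∑ k, v k • (coord k - algebraMap ℝ _ (x k)) := by
  have h1 : ∀ k : Fin d, dir v (coord k - algebraMap ℝ _ (x k)) = algebraMap ℝ _ (v k) := fun k => by
    rw [sub_eq_add_neg, ← map_neg, dir_add, dir_coord, dir_algebraMap, add_zero]
  rw [halfSq, dir_sum]
  refine Finset.sum_congr rfl fun k _ => ?_
  rw [dir_smul, dir_mul, h1, mul_comm, ← two_mul, Algebra.smul_def, Algebra.smul_def, ← mul_assoc,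
    show (2 : Smooth d) = algebraMap ℝ _ 2 from (map_ofNat _ 2).symm, ← map_mul]
  norm_num
  ring

theorem grad_halfSq (x : Space d) : grad (halfSq x) x = 0 := by
  funext i
  rw [grad, dir_halfSq, map_sum]
  refine Finset.sum_eq_zero fun k _ => ?_
  rw [evalAt_smul, map_sub]
  exact mul_eq_zero_of_right _ (sub_self _)

theorem hess_halfSq (x : Space d) : hess (halfSq x) x = 1 := by
  ext i j
  rw [hess, Matrix.of_apply, dir_halfSq, dir_sum, map_sum]
  have : ∀ k, evalAt x (dir (unit i) ((unit j : Space d) k • (coord k - algebraMap ℝ _ (x k))))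
      = (unit j : Space d) k * (unit i : Space d) k := fun k => by
    rw [dir_smul, evalAt_smul, sub_eq_add_neg, ← map_neg, dir_add, dir_coord, dir_algebraMap,
      add_zero]; rfl
  simp only [this]
  simp [Matrix.one_apply, Pi.single_apply]

theorem grad_add_smul (f g : Smooth d) (x : Space d) (s : ℝ) :
    grad (f + s • g) x = grad f x + s • grad g x := by
  funext i
  simp only [grad, dir_add, dir_smul, map_add, evalAt_smul, Pi.add_apply, Pi.smul_apply, smul_eq_mul]

theorem hess_add_smul (f g : Smooth d) (x : Space d) (s : ℝ) :
    hess (f + s • g) x = hess f x + s • hess g x := by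
  ext i j
  simp only [hess, dir_add, dir_smul, map_add, evalAt_smul, Matrix.of_apply, Matrix.add_apply,
    Matrix.smul_apply, smul_eq_mul]

theorem grad_coord (k : Fin d) (x : Space d) : grad (coord k) x = unit k := by
  funext i
  rw [grad, dir_coord]
  change (unit i : Space d) k = _
  simp [Pi.single_apply, eq_comm]

theorem hess_coord (k : Fin d) (x : Space d) : hess (coord k) x = 0 := by
  ext i j
  rw [hess, Matrix.of_apply, dir_coord, dir_algebraMap, map_zero]; rfl

/-- A direction in which Casimirs become generic at a point. -/
def generic (x : Space (m + 2)) (α : Fin m) : Smooth (m + 2) :=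
  coord α.succ.succ + (if (α : ℕ) = 0 then 1 else 0 : ℝ) • halfSq x

theorem grad_generic (x : Space (m + 2)) (α : Fin m) : grad (generic x α) x = unit α.succ.succ := by
  rw [generic, grad_add_smul, grad_halfSq, smul_zero, add_zero, grad_coord]

theorem hess_generic (x : Space (m + 2)) {α : Fin m} (h : (α : ℕ) = 0) :
    hess (generic x α) x = 1 := by
  rw [generic, hess_add_smul, hess_halfSq, hess_coord, if_pos h, zero_add, one_smul]

/-- Casimirs become generic at a point by adding a large multiple of generic functions. -/
theorem exists_generic (c : Fin m → Smooth (m + 2)) (x : Space (m + 2)) :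
    ∃ s₀ : ℝ, ∀ s, s₀ < s → LinearIndependent ℝ (fun α => grad (c α + s • generic x α) x) ∧
      ∀ α : Fin m, (α : ℕ) = 0 →
        ∀ v, v ≠ 0 → 0 < v ⬝ᵥ (hess (c α + s • generic x α) x).mulVec v := by
  let A : Matrix (Fin m) (Fin m) ℝ := Matrix.of fun α β => grad (c α) x β.succ.succ
  -- The bound serves both purposes: beyond it the square block of the gradients along the last m
  -- coordinates, and the Hessian of the first Casimir, become positive definite after adding s
  -- times the identity.
  refine ⟨(∑ α, ∑ β, |A α β|) + ∑ α : Fin m, ∑ i, ∑ j, |hess (c α) x i j|, fun s hs => ⟨?_, ?_⟩⟩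
  · have hA : ∑ α, ∑ β, |A α β| < s := lt_of_le_of_lt (le_add_of_nonneg_right
      (Finset.sum_nonneg fun _ _ => Finset.sum_nonneg fun _ _ => Finset.sum_nonneg fun _ _ =>
        abs_nonneg _)) hs
    rw [Fintype.linearIndependent_iff]
    intro g hg
    by_contra! hne
    have hg0 : g ≠ 0 := by
      rintro rfl; obtain ⟨i, hi⟩ := hne; exact hi rfl
    have h1 := add_smul_dotProduct_pos A.transpose (s := s) (by
      rw [Finset.sum_comm]; exact hA) hg0
    have h2 : A.transpose.mulVec g + s • g = 0 := by
      funext β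
      have := congrFun hg β.succ.succ
      simp only [grad_add_smul, grad_generic, Finset.sum_apply, Pi.smul_apply, Pi.add_apply,
        smul_eq_mul, mul_add, Finset.sum_add_distrib] at this
      rw [Pi.add_apply, Pi.smul_apply, Matrix.mulVec, dotProduct, smul_eq_mul, Pi.zero_apply]
      refine Eq.trans ?_ this
      congr 1
      · exact Finset.sum_congr rfl fun α _ => mul_comm _ _
      · simp [Pi.single_apply, mul_comm]
    have h3 : g ⬝ᵥ (A.transpose.mulVec g + s • g) = 0 := by rw [h2, dotProduct_zero]
    rw [dotProduct_add, dotProduct_smul, smul_eq_mul] at h3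
    linarith
  · intro α hα v hv
    have h0 : ∑ i, ∑ j, |hess (c α) x i j| ≤ ∑ α : Fin m, ∑ i, ∑ j, |hess (c α) x i j| :=
      Finset.single_le_sum (f := fun α => ∑ i, ∑ j, |hess (c α) x i j|)
        (fun _ _ => Finset.sum_nonneg fun _ _ => Finset.sum_nonneg fun _ _ => abs_nonneg _)
        (Finset.mem_univ α)
    have h1 : 0 ≤ ∑ α, ∑ β, |A α β| :=
      Finset.sum_nonneg fun _ _ => Finset.sum_nonneg fun _ _ => abs_nonneg _
    have h2 := add_smul_dotProduct_pos (hess (c α) x) (s := s) (by linarith) hv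
    rw [hess_add_smul, hess_generic x hα, Matrix.add_mulVec, Matrix.smul_mulVec, Matrix.one_mulVec,
      dotProduct_add, dotProduct_smul, smul_eq_mul]
    exact h2

theorem defect_zero_of_posDef (hm : m = 1 ∨ m = 2) (c : Fin m → Smooth (m + 2))
    (ρ : Smooth (m + 2)) (x : Space (m + 2)) (hG : LinearIndependent ℝ fun α => grad (c α) x)
    (hpos : ∀ α : Fin m, (α : ℕ) = 0 → ∀ v, v ≠ 0 → 0 < v ⬝ᵥ (hess (c α) x).mulVec v) :
    (∀ ξ η, defectAt c ρ (evalAt x) ξ η = 0) ∧ ∀ i, casDefectAt c ρ (evalAt x) (c i) = 0 := by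
  rcases hm with rfl | rfl
  · exact defect_zero_of_posDef_three c ρ x hG (hpos 0 rfl)
  · exact defect_zero_of_posDef_four c ρ x hG (hpos 0 rfl)

variable (c : Fin m → Smooth (m + 2)) (ρ : Smooth (m + 2))

/-- The Casimirs are moved along a line on which they are generic at x for all large parameters,
while the density is kept fixed. The value is polynomial in the parameter and so vanishes also at
its origin. -/
theorem DiffPoly.value_eq_zero_of_generic (p : DiffPoly m) (x : Space (m + 2))
    (h : ∀ c : Fin m → Smooth (m + 2), LinearIndependent ℝ (fun α => grad (c α) x) →
      (∀ α : Fin m, (α : ℕ) = 0 → ∀ v, v ≠ 0 → 0 < v ⬝ᵥ (hess (c α) x).mulVec v) →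
      value p ρ (fun α => c α) x = 0) : value p ρ (fun α => c α) x = 0 := by
  obtain ⟨s₀, hs⟩ := exists_generic c x
  refine value_eq_zero_of_line (contDiff_coe ρ) (fun α => contDiff_coe (c α))
    (σ := 0) (q := fun α => generic x α) contDiff_const (fun α => contDiff_coe _) p x ?_
  refine (Set.Ioi_infinite s₀).mono fun s hs' => ?_
  rw [Set.mem_ofPred_eq, smul_zero, add_zero]
  exact h (fun α => c α + s • generic x α) (hs s hs').1 (hs s hs').2

variable (hm : m = 1 ∨ m = 2)
include hm

/-- At each point the defect is the value of a differential polynomial, so the generic case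
suffices. -/
theorem defect_eq_zero (i j : Fin (m + 2)) :
    defect (diag (m + 2)) pdS ρ (namC c) (mixC c) i j = 0 := by
  refine Smooth.ext_eval fun x => ?_
  have h := DiffPoly.value_eq_zero_of_generic c ρ (DiffPoly.defect i j) x fun c h1 h2 => by
    rw [DiffPoly.isValue_defect i j]
    exact (defect_unit c ρ (evalAt x) i j).trans ((defect_zero_of_posDef hm c ρ x h1 h2).1 _ _)
  rw [DiffPoly.isValue_defect i j] at h
  exact h

theorem casDefect_eq_zero (α : Fin m) :
    casDefect (diag (m + 2)) pdS ρ (namC c) (mixC c) (c α) = 0 := by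
  refine Smooth.ext_eval fun x => ?_
  have h := DiffPoly.value_eq_zero_of_generic c ρ (DiffPoly.casDefect α) x fun c h1 h2 => by
    rw [DiffPoly.isValue_casDefect α]
    exact (casDefect_unit c ρ (evalAt x) (c α)).trans ((defect_zero_of_posDef hm c ρ x h1 h2).2 _)
  rw [DiffPoly.isValue_casDefect α] at h
  exact h

end Density

/-! ## Evaluation of the tetrahedral graph -/

section Sums

variable {X M : Type*} [Fintype X] [AddCommMonoid M]

theorem sum_vecCons {n : ℕ} (f : (Fin (n + 1) → X) → M) :
    ∑ α, f α = ∑ a, ∑ α, f (Matrix.vecCons a α) := by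
  rw [← (Fin.consEquiv fun _ => X).sum_comp, Fintype.sum_prod_type]; rfl

theorem sum_vecEmpty (f : (Fin 0 → X) → M) : ∑ α, f α = f ![] := by
  rw [Fintype.sum_unique]; congr 1

theorem sum_vec_two (f : (Fin 2 → X) → M) : ∑ α, f α = ∑ a, ∑ b, f ![a, b] := by
  simp only [sum_vecCons, sum_vecEmpty]

theorem sum_vec_six (f : (Fin 6 → X) → M) :
    ∑ α, f α = ∑ a, ∑ b, ∑ c, ∑ d, ∑ e, ∑ g, f ![a, b, c, d, e, g] := by
  simp only [sum_vecCons, sum_vecEmpty]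

end Sums

namespace Tetra

variable {q d : ℕ}

/-- A vertex, given by the labels of its incoming and outgoing arrows. The labels below six are
those of the edges of the tetrahedron, the others are those of the arrows into the sinks. -/
abbrev Vtx (q : ℕ) : Type := List (Fin (6 + q)) × List (Fin (6 + q))

/-- The tails of the arrows. -/
def tail (o : Fin 6 → Bool) (w : Fin q → Fin 4) : Fin (6 + q) → Fin 4 :=
  Fin.append (fun e => if o e then (tetrahedron e).1 else (tetrahedron e).2) w

/-- The heads of the directed edges. -/
def head (o : Fin 6 → Bool) (e : Fin 6) : Fin 4 :=
  if o e then (tetrahedron e).2 else (tetrahedron e).1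

/-- The arrows at a vertex. -/
def vtx (o : Fin 6 → Bool) (w : Fin q → Fin 4) (v : Fin 4) : Vtx q :=
  (((List.finRange 6).filter fun e => head o e = v).map (Fin.castAdd q),
    (List.finRange (6 + q)).filter fun e => tail o w e = v)

/-- The sign of a directed graph. -/
def sign (o : Fin 6 → Bool) (w : Fin q → Fin 4) : ℤ :=
  ((List.finRange (6 + q)).map fun e => ((List.finRange (6 + q)).map fun e' =>
    if e < e' ∧ tail o w e' < tail o w e then (-1 : ℤ) else 1).prod).prod

/-- The content of a vertex, differentiated along the incoming arrows. -/
def content (G : MField d) (x : Space d) (idx : Fin (6 + q) → Fin d) (u : Vtx q) : ℝ :=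
  pds (u.1.map idx) (G (u.2.map idx)) x

/-- The sum over all indices on the edges of the product of the contents of the vertices. -/
def value (G : MField d) (x : Space d) (I : Fin q → Fin d) (t : List (Vtx q)) : ℝ :=
  ∑ α : Fin 6 → Fin d, (t.map (content G x (Fin.append α I))).prod

/-- The fields in the vertices are taken to be the parts of prescribed degrees of one field G. The
content of a vertex then depends only on its arrows and not on its number, which makes directed
graphs comparable under relabelling, even with one function among the bivectors. -/
theorem orientGraph_eq (F : Fin 4 → MField d) (G : MField d) (deg : Fin 4 → ℕ)
    (hF : ∀ v J, F v J = if J.length = deg v then G J else 0) (I : List (Fin d)) (x : Space d) :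
    orientGraph tetrahedron F I x = ∑ o : Fin 6 → Bool, ∑ w : Fin I.length → Fin 4,
      if ∀ v, (vtx o w v).2.length = deg v then
        (sign o w : ℝ) * value G x I.get ((List.finRange 4).map (vtx o w)) else 0 := by
  refine Finset.sum_congr rfl fun o _ => Finset.sum_congr rfl fun w _ => ?_
  have hsign : ((sign o w : ℤ) : ℝ) = ∏ e : Fin (6 + I.length), ∏ e' : Fin (6 + I.length),
      if e < e' ∧ tail o w e' < tail o w e then (-1 : ℝ) else 1 := by
    rw [sign, ← List.ofFn_eq_map, List.prod_ofFn, Int.cast_prod]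
    refine Finset.prod_congr rfl fun e _ => ?_
    rw [← List.ofFn_eq_map, List.prod_ofFn, Int.cast_prod]
    refine Finset.prod_congr rfl fun e' _ => ?_
    split_ifs <;> simp
  have hin : ∀ (α : Fin 6 → Fin d) (v : Fin 4),
      ((List.finRange 6).filter fun e => (if o e then (tetrahedron e).2 else (tetrahedron e).1) = v).map α
        = (vtx o w v).1.map (Fin.append α I.get) := fun α v => by
    rw [vtx, List.map_map]
    refine List.map_congr_left fun e _ => ?_
    rw [Function.comp_apply, Fin.append_left]
  split_ifs with hg
  · rw [value, Finset.mul_sum]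
    refine Finset.sum_congr rfl fun α _ => ?_
    rw [hsign, List.map_map, ← List.ofFn_eq_map, List.prod_ofFn]
    refine congrArg _ (Finset.prod_congr rfl fun v _ => ?_)
    change pds _ (F v (((vtx o w v).2).map _)) x = _
    rw [hF, List.length_map, if_pos (hg v)]
    exact congrArg (fun l => pds l _ x) (hin α v)
  · refine Finset.sum_eq_zero fun α _ => mul_eq_zero_of_right _ ?_
    obtain ⟨v, hv⟩ := not_forall.1 hg
    refine Finset.prod_eq_zero (Finset.mem_univ v) ?_
    change pds _ (F v (((vtx o w v).2).map _)) x = _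
    rw [hF, List.length_map, if_neg hv]
    have : ∀ J : List (Fin d), pds J (0 : Scalar d) = 0 := fun J => by
      induction J with
      | nil => rfl
      | cons i J ih =>
        change pd i (pds J 0) = 0
        rw [ih]; exact pd_const i 0
    rw [this]; rfl

/-! ### Symmetries -/

/-- Renaming of the arrows. -/
def rename (σ : Fin 6 → Fin 6) (u : Vtx q) : Vtx q :=
  let τ : Fin (6 + q) → Fin (6 + q) := Fin.append (fun e => Fin.castAdd q (σ e)) (Fin.natAdd 6)
  (u.1.map τ, u.2.map τ)

/-- Sorting of the arrows at a vertex. -/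
def sorted (u : Vtx q) : Vtx q :=
  (u.1.insertionSort (· ≤ ·), match u.2 with
    | [a, b] => if a ≤ b then [a, b] else [b, a]
    | l => l)

/-- The sign from sorting the outgoing arrows of a vertex. -/
def sortSign (u : Vtx q) : ℤ :=
  match u.2 with
  | [a, b] => if a ≤ b then 1 else -1
  | _ => 1

variable (G : MField d) (x : Space d) (I : Fin q → Fin d)

theorem value_rename {σ : Fin 6 → Fin 6} (hσ : Function.Injective σ) (t : List (Vtx q)) :
    value G x I (t.map (rename σ)) = value G x I t := by
  let e := Equiv.ofBijective σ hσ.bijective_of_finite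
  rw [value, value, ← (e.arrowCongr (Equiv.refl (Fin d))).sum_comp]
  refine Finset.sum_congr rfl fun α _ => ?_
  rw [List.map_map]
  refine congrArg List.prod (List.map_congr_left fun u _ => ?_)
  have h : Fin.append ((e.arrowCongr (Equiv.refl (Fin d))) α) I ∘
      Fin.append (fun e => Fin.castAdd q (σ e)) (Fin.natAdd 6) = Fin.append α I := by
    funext j
    refine Fin.addCases (fun j => ?_) (fun j => ?_) j
    · simp only [Function.comp_apply, Fin.append_left]
      change α (e.symm (e j)) = α j
      rw [e.symm_apply_apply]
    · simp only [Function.comp_apply, Fin.append_right]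
  rw [Function.comp_apply, content, rename]
  simp only [List.map_map, h]
  rfl

theorem sortSign_mul_self (u : Vtx q) : sortSign u * sortSign u = 1 := by
  unfold sortSign
  split
  · split_ifs <;> rfl
  · rfl

theorem prod_sortSign_mul_self (t : List (Vtx q)) :
    (t.map sortSign).prod * (t.map sortSign).prod = 1 := by
  induction t with
  | nil => rfl
  | cons u t ih =>
    rw [List.map_cons, List.prod_cons, mul_mul_mul_comm, sortSign_mul_self, ih, one_mul]

variable {G} (hs : ∀ J, ContDiff ℝ ∞ (G J)) (ha : ∀ i j, G [i, j] = -G [j, i])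

include hs ha

theorem content_sorted (idx : Fin (6 + q) → Fin d) (u : Vtx q) :
    content G x idx u = sortSign u * content G x idx (sorted u) := by
  obtain ⟨l, m⟩ := u
  have hp : ∀ f : Scalar d, ContDiff ℝ ∞ f →
      pds ((l.insertionSort (· ≤ ·)).map idx) f = pds (l.map idx) f := fun f hf =>
    pds_perm hf ((List.perm_insertionSort _ l).map idx)
  unfold content sorted sortSign
  dsimp only
  rw [hp _ (hs _)]
  split
  · rename_i a b
    split_ifs with h
    · simp
    · simp only [List.map_cons, List.map_nil]
      have : ∀ (J : List (Fin d)) (f : Scalar d), pds J (-f) = -pds J f := fun J f => by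
        induction J with
        | nil => rfl
        | cons i J ih =>
          change pd i (pds J (-f)) = -pd i (pds J f)
          rw [ih, pd_neg]
      rw [ha, this]
      simp
  · simp

theorem value_sorted (t : List (Vtx q)) :
    value G x I t = ((t.map sortSign).prod : ℤ) * value G x I (t.map sorted) := by
  rw [value, value, Finset.mul_sum]
  refine Finset.sum_congr rfl fun α _ => ?_
  induction t with
  | nil => simp
  | cons u t ih =>
    simp only [List.map_cons, List.prod_cons] at *
    rw [ih, content_sorted x hs ha]
    push_cast; ring

/-- Edge indices are summed over, so edges may be renamed; incoming arrows may be sorted because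
derivatives commute, and the two outgoing arrows at the price of a sign because G is antisymmetric.
Sorting signs square to one, so those of t' can be moved to the other side. -/
theorem value_eq {σ : Fin 6 → Fin 6} (hσ : Function.Injective σ) {t t' : List (Vtx q)}
    (h : (t.map (rename σ)).map sorted = t'.map sorted) :
    value G x I t = (((t.map (rename σ)).map sortSign).prod * (t'.map sortSign).prod : ℤ)
      * value G x I t' := by
  rw [← value_rename G x I hσ, value_sorted x I hs ha, h, value_sorted x I hs ha t', ← mul_assoc,
    ← Int.cast_mul, mul_assoc _ (List.prod _) (List.prod _), prod_sortSign_mul_self, mul_one]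

end Tetra

namespace Tetra

variable {q d : ℕ}

/-! ### Classification of the directed graphs -/

/-- The graph with a distinguished vertex and a directed cycle through the other vertices. -/
def cyclic (out : List (Fin (6 + q))) : List (Vtx q) :=
  [([0, 1, 2].map (Fin.castAdd q), out), ([Fin.castAdd q 4], [0, 3].map (Fin.castAdd q)),
    ([Fin.castAdd q 5], [1, 4].map (Fin.castAdd q)), ([Fin.castAdd q 3], [2, 5].map (Fin.castAdd q))]

/-- The edges of the graph `cyclic`. -/
def cyclicEdges : List (Fin 4 × Fin 4) := [(1, 0), (2, 0), (3, 0), (1, 3), (2, 1), (3, 2)]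

/-- The graph whose sinks have different tails. -/
def split (i j : Fin 2) : List (Vtx 2) :=
  [([5, 1], [Fin.natAdd 6 i, 0]), ([2, 3], [5, Fin.natAdd 6 j]), ([4], [2, 1]), ([0], [4, 3])]

/-- The edges of the graph `split`. -/
def splitEdges : List (Fin 4 × Fin 4) := [(0, 3), (2, 0), (2, 1), (3, 1), (3, 2), (1, 0)]

/-- Whether there is an edge from one vertex to another. -/
def arrow (o : Fin 6 → Bool) (u v : Fin 4) : Bool :=
  (List.finRange 6).any fun e => tail (q := 0) o ![] (Fin.castAdd 0 e) = u && head o e = v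

/-- An ordering of the vertices which identifies a directed graph with `cyclic`. -/
def cyclicOrder (o : Fin 6 → Bool) (v : Fin 4) : List (Fin 4) :=
  match (List.finRange 4).filter (· ≠ v) with
  | [a, b, c] => if arrow o a b then [v, a, c, b] else [v, a, b, c]
  | _ => []

/-- An ordering of the vertices which identifies a directed graph with `split`. -/
def splitOrder (o : Fin 6 → Bool) (u v : Fin 4) : List (Fin 4) :=
  match (List.finRange 4).filter fun y => y ≠ u ∧ y ≠ v with
  | [s, t] => if arrow o u s then [u, v, t, s] else [u, v, s, t]
  | _ => []

/-- The label of an edge, defined by the positions of its ends in an ordering of the vertices. -/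
def label (o : Fin 6 → Bool) (l : List (Fin 4)) (E : List (Fin 4 × Fin 4)) (e : Fin 6) : Fin 6 :=
  Fin.ofNat 6 (E.findIdx fun p => p.1 = Fin.ofNat 4 (l.idxOf (tail (q := 0) o ![] (Fin.castAdd 0 e)))
    ∧ p.2 = Fin.ofNat 4 (l.idxOf (head o e)))

/-- An ordering of the vertices and a renaming of the edges identify two graphs. -/
def Identified (o : Fin 6 → Bool) (w : Fin q → Fin 4) (l : List (Fin 4)) (σ : Fin 6 → Fin 6)
    (t : List (Vtx q)) : Prop :=
  l.Perm (List.finRange 4) ∧ Function.Injective σ ∧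
    ((l.map (vtx o w)).map (rename σ)).map sorted = t.map sorted

/-- The coefficient of a graph identified with another one. -/
def coefficient (o : Fin 6 → Bool) (w : Fin q → Fin 4) (l : List (Fin 4)) (σ : Fin 6 → Fin 6)
    (t : List (Vtx q)) : ℤ :=
  sign o w * ((((l.map (vtx o w)).map (rename σ)).map sortSign).prod * (t.map sortSign).prod)

section Identify

variable {G : MField d} (hs : ∀ J, ContDiff ℝ ∞ (G J)) (ha : ∀ i j, G [i, j] = -G [j, i])
  (x : Space d) (I : Fin q → Fin d)
include hs ha

theorem Identified.value {o : Fin 6 → Bool} {w : Fin q → Fin 4} {l : List (Fin 4)}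
    {σ : Fin 6 → Fin 6} {t : List (Vtx q)} (h : Identified o w l σ t) :
    (sign o w : ℝ) * value G x I ((List.finRange 4).map (vtx o w))
      = coefficient o w l σ t * value G x I t := by
  obtain ⟨h1, h2, h3⟩ := h
  have : Tetra.value G x I ((List.finRange 4).map (vtx o w))
      = Tetra.value G x I (l.map (vtx o w)) :=
    Finset.sum_congr rfl fun α _ => ((h1.map _).map _).prod_eq.symm
  rw [this, value_eq x I hs ha h2 h3, coefficient]
  push_cast; ring

end Identify

instance (o : Fin 6 → Bool) (w : Fin q → Fin 4) (l : List (Fin 4)) (σ : Fin 6 → Fin 6)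
    (t : List (Vtx q)) : Decidable (Identified o w l σ t) :=
  inferInstanceAs (Decidable (_ ∧ _ ∧ _))

/-- All fields in the vertices are bivectors. -/
def AllTwo (o : Fin 6 → Bool) (w : Fin 2 → Fin 4) : Prop := ∀ v, (vtx o w v).2.length = 2

instance (o : Fin 6 → Bool) (w : Fin 2 → Fin 4) : Decidable (AllTwo o w) :=
  inferInstanceAs (Decidable (∀ _, _))

/-- All fields in the vertices are bivectors, but for one function. -/
def OneZero (o : Fin 6 → Bool) (s : Fin 4) : Prop :=
  ∀ v, (vtx (q := 0) o ![] v).2.length = if v = s then 0 else 2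

instance (o : Fin 6 → Bool) (s : Fin 4) : Decidable (OneZero o s) :=
  inferInstanceAs (Decidable (∀ _, _))

/-- The contribution of a directed graph to the coefficient of `cyclic`. -/
def cyclicTerm (o : Fin 6 → Bool) (w : Fin 2 → Fin 4) : ℤ :=
  if AllTwo o w ∧ w 0 = w 1 then coefficient o w (cyclicOrder o (w 0))
    (label o (cyclicOrder o (w 0)) cyclicEdges) (cyclic [6, 7]) else 0

/-- The contribution of a directed graph to the coefficient of `split 0 1`. -/
def leftTerm (o : Fin 6 → Bool) (w : Fin 2 → Fin 4) : ℤ :=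
  if AllTwo o w ∧ w 0 ≠ w 1 ∧ arrow o (w 1) (w 0) then coefficient o w (splitOrder o (w 0) (w 1))
    (label o (splitOrder o (w 0) (w 1)) splitEdges) (split 0 1) else 0

/-- The contribution of a directed graph to the coefficient of `split 1 0`. -/
def rightTerm (o : Fin 6 → Bool) (w : Fin 2 → Fin 4) : ℤ :=
  if AllTwo o w ∧ w 0 ≠ w 1 ∧ ¬arrow o (w 1) (w 0) then coefficient o w (splitOrder o (w 1) (w 0))
    (label o (splitOrder o (w 1) (w 0)) splitEdges) (split 1 0) else 0

/-- The contribution of a directed graph to the coefficient of `cyclic` without sinks. -/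
def scalarTerm (o : Fin 6 → Bool) (s : Fin 4) : ℤ :=
  if OneZero o s then coefficient (q := 0) o ![] (cyclicOrder o s)
    (label o (cyclicOrder o s) cyclicEdges) (cyclic []) else 0

/-- A directed graph without coincident degrees is identified with one of the canonical graphs. -/
def IsClassified (o : Fin 6 → Bool) (w : Fin 2 → Fin 4) : Prop :=
  if w 0 = w 1 then Identified o w (cyclicOrder o (w 0))
    (label o (cyclicOrder o (w 0)) cyclicEdges) (cyclic [6, 7])
  else if arrow o (w 1) (w 0) then Identified o w (splitOrder o (w 0) (w 1))
    (label o (splitOrder o (w 0) (w 1)) splitEdges) (split 0 1)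
  else Identified o w (splitOrder o (w 1) (w 0))
    (label o (splitOrder o (w 1) (w 0)) splitEdges) (split 1 0)

instance (o : Fin 6 → Bool) (w : Fin 2 → Fin 4) : Decidable (IsClassified o w) :=
  inferInstanceAs (Decidable (ite _ _ _))

/-- An exhaustive check of the 64 directions and 16 choices of tails for the sink arrows. Two sinks
with a common tail leave a directed cycle on the other vertices; otherwise the two tails are joined
by an edge, whose direction selects one of the two `split` graphs. -/
theorem isClassified_vec : ∀ a b c d e f : Bool, ∀ u v : Fin 4,
    AllTwo ![a, b, c, d, e, f] ![u, v] → IsClassified ![a, b, c, d, e, f] ![u, v] := by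
  decide +kernel

theorem vec_six_eta {X : Type*} (o : Fin 6 → X) : o = ![o 0, o 1, o 2, o 3, o 4, o 5] := by
  funext i; fin_cases i <;> rfl

theorem vec_two_eta {X : Type*} (w : Fin 2 → X) : w = ![w 0, w 1] := by
  funext i; fin_cases i <;> rfl

theorem isClassified (o : Fin 6 → Bool) (w : Fin 2 → Fin 4) (h : AllTwo o w) : IsClassified o w := by
  rw [vec_six_eta o, vec_two_eta w] at *
  exact isClassified_vec _ _ _ _ _ _ _ _ h

theorem identified_scalar_vec : ∀ a b c d e f : Bool, ∀ s : Fin 4, OneZero ![a, b, c, d, e, f] s →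
    Identified (q := 0) ![a, b, c, d, e, f] ![] (cyclicOrder ![a, b, c, d, e, f] s)
      (label ![a, b, c, d, e, f] (cyclicOrder ![a, b, c, d, e, f] s) cyclicEdges) (cyclic []) := by
  decide +kernel

theorem identified_scalar (o : Fin 6 → Bool) (s : Fin 4) (h : OneZero o s) :
    Identified (q := 0) o ![] (cyclicOrder o s) (label o (cyclicOrder o s) cyclicEdges)
      (cyclic []) := by
  rw [vec_six_eta o] at *
  exact identified_scalar_vec _ _ _ _ _ _ _ h

/-- The signed multiplicities 8, 24, −24 found here and in the next two sums are in proportion 1 : 3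
: −3, as in `flow`, and so the flow is 8 times `flow`. -/
theorem sum_cyclicTerm : ∑ o, ∑ w, cyclicTerm o w = 8 := by
  simp only [sum_vec_six, sum_vec_two]
  decide +kernel

theorem sum_leftTerm : ∑ o, ∑ w, leftTerm o w = 24 := by
  simp only [sum_vec_six, sum_vec_two]
  decide +kernel

theorem sum_rightTerm : ∑ o, ∑ w, rightTerm o w = -24 := by
  simp only [sum_vec_six, sum_vec_two]
  decide +kernel

theorem sum_scalarTerm : ∑ o, ∑ s, scalarTerm o s = 8 := by
  simp only [sum_vec_six]
  decide +kernel

end Tetra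

section Contraction

variable {d : ℕ}

theorem lsum_diag {A : Type*} [CommRing A] [Algebra ℝ A] (f : Fin d × Fin d → A) :
    lsum (diag d) f = ∑ i, f (i, i) := by
  rw [diag, lsum_map, lsum_finRange]

theorem evalAt_pdS (x : Space d) (k : Fin d) (f : Smooth d) :
    evalAt x (pdS k f) = pd k (f : Scalar d) x := rfl

end Contraction

/-! ### Contraction formulas for the canonical directed graphs -/

namespace Tetra

variable {d : ℕ} {G : MField d} {ρ : Smooth d} {N : Fin d → Fin d → Smooth d}
  (hG : ∀ i j, G [i, j] = P ρ N i j) (x : Space d)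
include hG

theorem value_cyclic (i j : Fin d) :
    value G x ![i, j] (cyclic [6, 7]) = evalAt x (third (diag d) pdS ρ N i j) := by
  rw [value, sum_vec_six]
  simp only [third, T, lsum_diag, map_sum, map_mul, Finset.mul_sum]
  refine Finset.sum_congr rfl fun k _ => Finset.sum_congr rfl fun p _ => Finset.sum_congr rfl
    fun m _ => Finset.sum_congr rfl fun q _ => Finset.sum_congr rfl fun r _ =>
    Finset.sum_congr rfl fun s _ => ?_
  change pds [k, p, m] (G [i, j]) x * (pds [r] (G [k, q]) x * (pds [s] (G [p, r]) x *
    (pds [q] (G [m, s]) x * 1))) = _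
  simp only [hG, mul_one]
  rfl

theorem value_cyclic_nil {f : Smooth d} (hf : G [] = f) (I : Fin 0 → Fin d) :
    value G x I (cyclic []) = evalAt x (vel (diag d) pdS ρ N f) := by
  rw [value, sum_vec_six]
  simp only [vel, T, lsum_diag, map_sum, map_mul, Finset.mul_sum]
  refine Finset.sum_congr rfl fun k _ => Finset.sum_congr rfl fun p _ => Finset.sum_congr rfl
    fun m _ => Finset.sum_congr rfl fun q _ => Finset.sum_congr rfl fun r _ =>
    Finset.sum_congr rfl fun s _ => ?_
  change pds [k, p, m] (G []) x * (pds [r] (G [k, q]) x * (pds [s] (G [p, r]) x *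
    (pds [q] (G [m, s]) x * 1))) = _
  simp only [hG, hf, mul_one]
  rfl

theorem value_split_left (i j : Fin d) :
    value G x ![i, j] (split 0 1) = evalAt x (half (diag d) pdS ρ N i j) := by
  rw [value, sum_vec_six]
  simp only [half, lsum_diag, map_sum, map_mul, Finset.mul_sum, Finset.sum_mul]
  refine Finset.sum_congr rfl fun j' _ => Finset.sum_congr rfl fun p _ => Finset.sum_congr rfl
    fun k' _ => Finset.sum_congr rfl fun l' _ => ?_
  rw [Finset.sum_comm]
  refine Finset.sum_congr rfl fun k _ => Finset.sum_congr rfl fun m' _ => ?_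
  change pds [k, p] (G [i, j']) x * (pds [k', l'] (G [k, j]) x * (pds [m'] (G [k', p]) x *
    (pds [j'] (G [m', l']) x * 1))) = _
  simp only [hG, mul_one]
  have h : ∀ a b c d : ℝ, a * (b * (c * d)) = c * d * (a * b) := fun a b c d => by ring
  exact h _ _ _ _

theorem value_split_right (i j : Fin d) :
    value G x ![i, j] (split 1 0) = evalAt x (half (diag d) pdS ρ N j i) := by
  rw [← value_split_left hG]; rfl

variable (hs : ∀ J, ContDiff ℝ ∞ (G J)) (ha : ∀ i j, G [i, j] = -G [j, i])
include hs ha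

theorem tetraFlow_eq (h0 : ∀ J, J.length ≠ 2 → G J = 0) (i j : Fin d) :
    tetraFlow G [i, j] x = 8 * evalAt x (flow (diag d) pdS ρ N i j) := by
  have h := orientGraph_eq (fun _ => G) G (fun _ => 2) (fun v J => by
    split_ifs with hJ
    · rfl
    · exact h0 J hJ) [i, j] x
  have hget : ([i, j].get : Fin 2 → Fin d) = ![i, j] := by
    funext k; fin_cases k <;> rfl
  have hterm : ∀ (o : Fin 6 → Bool) (w : Fin 2 → Fin 4), (if AllTwo o w then
        (sign o w : ℝ) * value G x ![i, j] ((List.finRange 4).map (vtx o w)) else 0)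
      = cyclicTerm o w * value G x ![i, j] (cyclic [6, 7])
        + (leftTerm o w * value G x ![i, j] (split 0 1)
          + rightTerm o w * value G x ![i, j] (split 1 0)) := by
    intro o w
    have hi := isClassified o w
    unfold cyclicTerm leftTerm rightTerm
    by_cases hA : AllTwo o w
    · have hi := hi hA
      rw [if_pos hA]
      unfold IsClassified at hi
      split_ifs at hi with huv har
      · rw [hi.value hs ha]; simp [hA, huv]
      · rw [hi.value hs ha]; simp [hA, huv, har]
      · rw [hi.value hs ha]; simp [hA, huv, har]
    · simp [hA]
  rw [hget] at h
  refine h.trans ((Finset.sum_congr rfl fun o _ => Finset.sum_congr rfl fun w _ => hterm o w).trans ?_)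
  simp only [Finset.sum_add_distrib, ← Finset.sum_mul]
  have h1 := congrArg (Int.cast : ℤ → ℝ) sum_cyclicTerm
  have h2 := congrArg (Int.cast : ℤ → ℝ) sum_leftTerm
  have h3 := congrArg (Int.cast : ℤ → ℝ) sum_rightTerm
  push_cast at h1 h2 h3
  rw [h1, h2, h3, value_cyclic hG, value_split_left hG, value_split_right hG]
  simp only [flow, map_add, map_neg]
  ring

end Tetra

/-- The content of the tetrahedron with one function and three bivectors. -/
def mixedField {d : ℕ} (B : MField d) (f : Scalar d) : MField d := fun J => if J = [] then f else B J

open Tetra in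
-- A function and a bivector are told apart by the number of outgoing arrows, so one field contains
-- both. The directed graphs that contribute, for all four positions of the function, are copies of
-- one cyclic graph, with total multiplicity 8.
theorem casimirVelocity_eq {d : ℕ} {B : MField d} {ρ : Smooth d} {N : Fin d → Fin d → Smooth d}
    (hB : ∀ i j, B [i, j] = P ρ N i j) (x : Space d) (hs : ∀ J, ContDiff ℝ ∞ (B J))
    (ha : ∀ i j, B [i, j] = -B [j, i]) (h0 : ∀ J, J.length ≠ 2 → B J = 0) (f : Smooth d) :
    casimirVelocity B f x = 8 * evalAt x (vel (diag d) pdS ρ N f) := by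
  have hs' : ∀ J, ContDiff ℝ ∞ (mixedField B f J) := fun J => by
    unfold mixedField
    split_ifs
    · exact contDiff_coe f
    · exact hs J
  have h : ∀ s : Fin 4, orientGraph tetrahedron (Function.update (fun _ => B) s (scalarField f)) [] x
      = ∑ o, scalarTerm o s * value (mixedField B f) x ![] (cyclic []) := fun s => by
    refine (orientGraph_eq _ (mixedField B f) (fun v => if v = s then 0 else 2) (fun v J => ?_)
      [] x).trans (Finset.sum_congr rfl fun o _ => ?_)
    · by_cases hv : v = s
      · subst hv
        rw [Function.update_self, if_pos rfl]
        cases J with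
        | nil => rfl
        | cons a J => rfl
      · rw [Function.update_of_ne hv, if_neg hv]
        split_ifs with hJ
        · rw [mixedField, if_neg (by rintro rfl; cases hJ)]
        · exact h0 J hJ
    · have hI : (([] : List (Fin d)).get : Fin 0 → Fin d) = ![] := funext fun i => i.elim0
      refine (sum_vecEmpty (X := Fin 4) _).trans ?_
      unfold scalarTerm
      by_cases hA : OneZero o s
      · have hi := (identified_scalar o s hA).value hs' (fun i j => ha i j) x ![]
        rw [if_pos hA, ← hi, ← hI]
        exact if_pos hA
      · rw [if_neg hA, Int.cast_zero, zero_mul]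
        exact if_neg hA
  rw [casimirVelocity, Finset.sum_apply, Finset.sum_congr rfl fun s _ => h s]
  simp only [← Finset.sum_mul]
  have h1 := congrArg (Int.cast : ℤ → ℝ) sum_scalarTerm
  rw [Finset.sum_comm] at h1
  push_cast at h1
  rw [h1, value_cyclic_nil (G := mixedField B f) (fun i j => hB i j) x (f := f) rfl]

/-! ### The tetrahedral flow of a Nambu bivector -/

section Nambu

variable {m : ℕ} (ρ : Smooth (m + 2)) (c : Fin m → Smooth (m + 2))

theorem coe_rowDet (u v : Fin (m + 2) → ℝ) (f g : Scalar (m + 2)) (c : Fin m → Smooth (m + 2))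
    (x : Space (m + 2)) (hf : ∀ k, pd k f x = u k) (hg : ∀ k, pd k g x = v k) :
    nambuDet (fun α => c α) f g x = evalAt x (nam c u v) := by
  rw [nam, map_rowDet, rowDet_eq_det, nambuDet, jacobian]
  congr 1
  ext i k
  refine Fin.cases ?_ (fun i => Fin.cases ?_ (fun i => ?_) i) i
  · exact hf k
  · exact hg k
  · rfl

theorem nambuBivector_pair (i j : Fin (m + 2)) :
    nambuBivector (ρ : Scalar (m + 2)) (fun α => c α) [i, j] = P ρ (namC c) i j := by
  have hc : ∀ (i k : Fin (m + 2)) x, pd k (fun x : Space (m + 2) => x i) x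
      = (unit i : Space (m + 2)) k := fun i k x => by
    rw [pd_coord]
    exact (Pi.single_apply _ _ _).symm
  funext x
  change ρ.1 x * nambuDet _ _ _ x = _
  rw [coe_rowDet (unit i) (unit j) _ _ c x (fun k => hc i k x) (fun k => hc j k x)]
  rfl

theorem nambuBivector_eq_zero (ρ : Scalar (m + 2)) (a : Fin m → Scalar (m + 2))
    (J : List (Fin (m + 2))) (hJ : J.length ≠ 2) : nambuBivector ρ a J = 0 := by
  match J, hJ with
  | [], _ => rfl
  | [_], _ => rfl
  | [_, _], h => exact absurd rfl h
  | _ :: _ :: _ :: _, _ => rfl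

theorem contDiff_nambuBivector (J : List (Fin (m + 2))) :
    ContDiff ℝ ∞ (nambuBivector (ρ : Scalar (m + 2)) (fun α => c α) J) := by
  by_cases hJ : J.length = 2
  · obtain ⟨i, j, rfl⟩ := List.length_eq_two.1 hJ
    rw [nambuBivector_pair]
    exact contDiff_coe _
  · rw [nambuBivector_eq_zero _ _ _ hJ]
    exact contDiff_const

theorem namC_swap (i j : Fin (m + 2)) : namC c i j = -namC c j i := nam_swap _ _ _

theorem nambuBivector_swap (i j : Fin (m + 2)) :
    nambuBivector (ρ : Scalar (m + 2)) (fun α => c α) [i, j]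
      = -nambuBivector (ρ : Scalar (m + 2)) (fun α => c α) [j, i] := by
  rw [nambuBivector_pair, nambuBivector_pair]
  exact (congrArg (fun f => ((ρ * f : Smooth (m + 2)) : Scalar (m + 2))) (namC_swap c i j)).trans
    (congrArg Subtype.val (mul_neg ρ (namC c j i)))

theorem tetraFlow_nambu (i j : Fin (m + 2)) (x : Space (m + 2)) :
    tetraFlow (nambuBivector (ρ : Scalar (m + 2)) (fun α => c α)) [i, j] x
      = 8 * evalAt x (flow (diag (m + 2)) pdS ρ (namC c) i j) :=
  Tetra.tetraFlow_eq (nambuBivector_pair ρ c) x (contDiff_nambuBivector ρ c)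
    (nambuBivector_swap ρ c) (nambuBivector_eq_zero _ _) i j

theorem casimirVelocity_nambu (f : Smooth (m + 2)) (x : Space (m + 2)) :
    casimirVelocity (nambuBivector (ρ : Scalar (m + 2)) (fun α => c α)) f x
      = 8 * evalAt x (vel (diag (m + 2)) pdS ρ (namC c) f) :=
  casimirVelocity_eq (nambuBivector_pair ρ c) x (contDiff_nambuBivector ρ c)
    (nambuBivector_swap ρ c) (nambuBivector_eq_zero _ _) f

end Nambu

/-! ## Expansion and derivatives of Nambu determinants -/

section Expansion

variable {R : Type*} [CommRing R] {m : ℕ}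

/-- Multilinearity in the gradient rows. The remaining determinants of unit rows are Levi-Civita
symbols, so this links Nambu brackets with micro-graphs; it also gives the Leibniz rule, the symbols
being constant. -/
theorem rowDet_expand (u v : Fin (m + 2) → R) (G : Fin m → Fin (m + 2) → R) :
    rowDet u v G = ∑ r : Fin m → Fin (m + 2),
      (∏ α, G α (r α)) * rowDet u v (fun α => Pi.single (r α) 1) := by
  let f := ((Matrix.detRowAlternating (R := R) (n := Fin (m + 2))).toMultilinearMap.curryLeft
    u).curryLeft v
  have hf : ∀ G, f G = rowDet u v G := fun _ => rfl
  have hG : G = fun α => ∑ k, G α k • (Pi.single k 1 : Fin (m + 2) → R) := by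
    funext α j
    simp [Finset.sum_apply, Pi.single_apply]
  rw [← hf]
  conv_lhs => rw [hG]
  rw [f.map_sum]
  refine Finset.sum_congr rfl fun r _ => ?_
  rw [f.map_smul_univ, hf, smul_eq_mul]

variable {d : ℕ}

theorem dir_prod {ι : Type*} [DecidableEq ι] (w : Space d) (s : Finset ι) (g : ι → Smooth d) :
    dir w (∏ i ∈ s, g i) = ∑ j ∈ s, ∏ i ∈ s, Function.update g j (dir w (g j)) i := by
  induction s using Finset.induction_on with
  | empty =>
    rw [Finset.prod_empty, Finset.sum_empty, ← map_one (algebraMap ℝ (Smooth d)), dir_algebraMap]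
  | insert a s ha ih =>
    rw [Finset.prod_insert ha, Finset.sum_insert ha, Finset.prod_insert ha, dir_mul, ih,
      Function.update_self, Finset.mul_sum]
    congr 1
    · refine congrArg _ (Finset.prod_congr rfl fun i hi => ?_)
      rw [Function.update_of_ne (by rintro rfl; exact ha hi)]
    · refine Finset.sum_congr rfl fun j hj => ?_
      rw [Finset.prod_insert ha, Function.update_of_ne (by rintro rfl; exact ha hj)]

theorem rowDet_algebraMap (u v : Fin (m + 2) → ℝ) (G : Fin m → Fin (m + 2) → ℝ) :
    rowDet (fun k => algebraMap ℝ (Smooth d) (u k)) (fun k => algebraMap ℝ _ (v k))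
      (fun α k => algebraMap ℝ _ (G α k)) = algebraMap ℝ _ (rowDet u v G) :=
  (map_rowDet _ _ _ _).symm

theorem single_algebraMap (k : Fin (m + 2)) : (Pi.single k 1 : Fin (m + 2) → Smooth d)
    = fun l => algebraMap ℝ _ ((Pi.single k 1 : Fin (m + 2) → ℝ) l) := by
  funext l
  simp only [Pi.single_apply]
  split_ifs <;> simp

theorem nam_expand (c : Fin m → Smooth (m + 2)) (ξ η : Fin (m + 2) → ℝ) :
    nam c ξ η = ∑ r : Fin m → Fin (m + 2),
      (∏ α, dir (unit (r α)) (c α)) * algebraMap ℝ _ (rowDet ξ η fun α => Pi.single (r α) 1) := by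
  rw [nam, rowDet_expand]
  simp only [single_algebraMap, rowDet_algebraMap]

/-- The Leibniz rule for a Nambu determinant. -/
theorem dir_nam (c : Fin m → Smooth (m + 2)) (w : Space (m + 2)) (ξ η : Fin (m + 2) → ℝ) :
    dir w (nam c ξ η) = ∑ β, nam (Function.update c β (dir w (c β))) ξ η := by
  rw [nam_expand, dir_sum]
  simp only [nam_expand]
  rw [Finset.sum_comm]
  refine Finset.sum_congr rfl fun r _ => ?_
  rw [← Finset.sum_mul, mul_comm, algebraMap_const, mul_comm, dir_prod]
  refine congrArg₂ _ (Finset.sum_congr rfl fun β _ => Finset.prod_congr rfl fun α _ => ?_) rfl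
  by_cases h : α = β
  · subst h; rw [Function.update_self, Function.update_self, dir_comm]
  · rw [Function.update_of_ne h, Function.update_of_ne h]

end Expansion

/-! ## Micro-graphs -/

section Content

variable {m d : ℕ}

/-- Iterated partial derivatives of smooth functions. -/
def pdsS (J : List (Fin d)) (f : Smooth d) : Smooth d := J.foldr pdS f

theorem coe_pdsS (J : List (Fin d)) (f : Smooth d) : (pdsS J f : Scalar d) = pds J f := by
  induction J with
  | nil => rfl
  | cons i J ih => exact congrArg (pd i) ih

theorem pdsS_perm {J K : List (Fin d)} (h : J.Perm K) (f : Smooth d) : pdsS J f = pdsS K f :=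
  Subtype.ext (by rw [coe_pdsS, coe_pdsS, pds_perm (contDiff_coe f) h])

/-- The indices of those arrows which head to a given component of a Nambu graph. -/
def sel (L : List (Fin d × Option (Fin m))) (o : Option (Fin m)) : List (Fin d) :=
  (L.filter fun p => p.2 = o).map Prod.fst

theorem sel_cons_self (k : Fin d) (o : Option (Fin m)) (L : List (Fin d × Option (Fin m))) :
    sel ((k, o) :: L) o = k :: sel L o := by
  simp [sel]

theorem sel_cons_of_ne (k : Fin d) {o o' : Option (Fin m)} (h : o ≠ o')
    (L : List (Fin d × Option (Fin m))) : sel ((k, o) :: L) o' = sel L o' := by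
  simp [sel, h]

variable (ρ : Smooth (m + 2)) (c : Fin m → Smooth (m + 2))

/-- The components of a Nambu bivector with arrows heading to its vertices. -/
def cont (L : List (Fin (m + 2) × Option (Fin m))) (i j : Fin (m + 2)) : Smooth (m + 2) :=
  pdsS (sel L none) ρ * namC (fun α => pdsS (sel L (some α)) (c α)) i j

theorem cont_nil (i j : Fin (m + 2)) : cont ρ c [] i j = P ρ (namC c) i j := rfl

theorem cont_perm {L L' : List (Fin (m + 2) × Option (Fin m))} (h : L.Perm L')
    (i j : Fin (m + 2)) : cont ρ c L i j = cont ρ c L' i j := by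
  have hs : ∀ o, (sel L o).Perm (sel L' o) := fun o => (h.filter _).map _
  rw [cont, cont, pdsS_perm (hs none)]
  simp only [fun α => pdsS_perm (hs (some α))]

theorem cont_none (k : Fin (m + 2)) (L : List (Fin (m + 2) × Option (Fin m)))
    (i j : Fin (m + 2)) : cont ρ c ((k, none) :: L) i j
      = pdS k (pdsS (sel L none) ρ) * namC (fun α => pdsS (sel L (some α)) (c α)) i j := by
  rw [cont, sel_cons_self]
  simp only [fun α => sel_cons_of_ne k (Option.some_ne_none α).symm L]
  rfl

theorem cont_some (k : Fin (m + 2)) (β : Fin m) (L : List (Fin (m + 2) × Option (Fin m)))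
    (i j : Fin (m + 2)) : cont ρ c ((k, some β) :: L) i j
      = pdsS (sel L none) ρ * namC (Function.update (fun α => pdsS (sel L (some α)) (c α)) β
        (pdS k (pdsS (sel L (some β)) (c β)))) i j := by
  rw [cont, sel_cons_of_ne k (Option.some_ne_none β)]
  congr 2
  funext α
  by_cases h : α = β
  · subst h; rw [sel_cons_self, Function.update_self]; rfl
  · rw [sel_cons_of_ne k (by simpa using Ne.symm h), Function.update_of_ne h]

theorem pdS_mul (k : Fin d) (f g : Smooth d) : pdS k (f * g) = pdS k f * g + f * pdS k g :=
  dir_mul _ _ _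

theorem sum_cont_some (k : Fin (m + 2)) (L : List (Fin (m + 2) × Option (Fin m)))
    (i j : Fin (m + 2)) : ∑ β, cont ρ c ((k, some β) :: L) i j
      = pdsS (sel L none) ρ * pdS k (namC (fun α => pdsS (sel L (some α)) (c α)) i j) := by
  simp only [cont_some]
  rw [← Finset.mul_sum]
  exact congrArg _ (dir_nam _ _ _ _).symm

/-- The Leibniz rule. -/
theorem sum_cont (k : Fin (m + 2)) (L : List (Fin (m + 2) × Option (Fin m)))
    (i j : Fin (m + 2)) : ∑ o, cont ρ c ((k, o) :: L) i j = pdS k (cont ρ c L i j) := by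
  rw [Fintype.sum_option, sum_cont_some, cont_none, cont, pdS_mul]

/-- Restricting two arrows to different Casimirs is possible for micro-graphs, though not for graphs
built of whole bivectors. This is how the mixed part in `W` is encoded. -/
theorem sum_cont_pair (k l : Fin (m + 2)) (i j : Fin (m + 2)) :
    ∑ α, ∑ β ∈ Finset.univ.erase α, cont ρ c [(k, some α), (l, some β)] i j
      = ρ * mixC c k l i j := by
  rw [mixC, namMixed, Finset.mul_sum]
  refine Finset.sum_congr rfl fun α _ => ?_
  rw [Finset.mul_sum]
  refine Finset.sum_congr rfl fun β hβ => ?_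
  have h : α ≠ β := (Finset.ne_of_mem_erase hβ).symm
  rw [cont_some, sel_cons_of_ne l (Option.some_ne_none β)]
  refine congrArg (ρ * ·) (congrArg (fun c => namC c i j) (funext fun γ => ?_))
  by_cases hβ : γ = β
  · subst hβ
    rw [Function.update_self, Function.update_of_ne h.symm, sel_cons_self]; rfl
  · rw [Function.update_of_ne hβ]
    by_cases hα : γ = α
    · subst hα
      rw [Function.update_self, Function.update_self,
        sel_cons_of_ne l (by simpa using Ne.symm h)]; rfl
    · rw [Function.update_of_ne hα, Function.update_of_ne hα,
        sel_cons_of_ne l (by simpa using Ne.symm hβ)]; rfl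

end Content

/-! ### Micro-graphs built of three Nambu graphs -/

section Graph

variable {m : ℕ}

/-- The vertices of a micro-graph other than the sink. -/
abbrev Slot (m : ℕ) : Type := Fin 3 × Option (Fin m)

/-- The vertex at a slot. -/
def Slot.vertex (s : Slot m) : Vertex m 3 := s.2.elim (.levi s.1) (.casimir s.1)

theorem Slot.vertex_injective : Function.Injective (Slot.vertex (m := m)) := by
  rintro ⟨v, _ | c⟩ ⟨v', _ | c'⟩ h <;> simp_all [Slot.vertex]

theorem Slot.vertex_ne_sink (s : Slot m) : s.vertex ≠ .sink := by
  obtain ⟨v, _ | c⟩ := s <;> simp [Slot.vertex]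

/-- The micro-graph whose first arrow heads to the sink. -/
def graph (s₁ s₂ s₃ s₄ s₅ : Slot m) : MicroGraph m 3 where
  target := ![![.sink, s₁.vertex], ![s₂.vertex, s₃.vertex], ![s₄.vertex, s₅.vertex]]
  existsUnique_sink := by
    refine ⟨(0, 0), rfl, ?_⟩
    rintro ⟨v, k⟩ h
    have : ∀ v : Fin 3, ∀ k : Fin 2, v = 0 ∧ k = 0 ∨ v = 0 ∧ k = 1 ∨ v = 1 ∧ k = 0 ∨ v = 1 ∧ k = 1 ∨
      v = 2 ∧ k = 0 ∨ v = 2 ∧ k = 1 := by decide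
    rcases this v k with ⟨rfl, rfl⟩ | ⟨rfl, rfl⟩ | ⟨rfl, rfl⟩ | ⟨rfl, rfl⟩ | ⟨rfl, rfl⟩ | ⟨rfl, rfl⟩
    · rfl
    all_goals exact absurd h (Slot.vertex_ne_sink _)

variable {s₁ s₂ s₃ s₄ s₅ : Slot m}

/-- The arrows of a micro-graph which do not belong to a Levi-Civita vertex and its Casimirs. -/
def arrows (s₁ s₂ s₃ s₄ s₅ : Slot m) (i : Fin 5 → Fin (m + 2)) : List (Fin (m + 2) × Slot m) :=
  [(i 0, s₁), (i 1, s₂), (i 2, s₃), (i 3, s₄), (i 4, s₅)]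

/-- The arrows which head to the vertices of one of the Nambu graphs. -/
def at' (S : List (Fin (m + 2) × Slot m)) (v : Fin 3) : List (Fin (m + 2) × Option (Fin m)) :=
  (S.filter fun p => p.2.1 = v).map fun p => (p.1, p.2.2)

theorem sel_at (S : List (Fin (m + 2) × Slot m)) (v : Fin 3) (o : Option (Fin m)) :
    sel (at' S v) o = (S.filter fun p => p.2.vertex = Slot.vertex (v, o)).map Prod.fst := by
  rw [sel, at', List.filter_map, List.filter_filter, List.map_map]
  have : (fun p : Fin (m + 2) × Slot m => decide (p.2.vertex = Slot.vertex (v, o)))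
      = fun p => ((fun p : Fin (m + 2) × Option (Fin m) => decide (p.2 = o)) ∘
        fun p : Fin (m + 2) × Slot m => (p.1, p.2.2)) p && decide (p.2.1 = v) := by
    funext p
    rw [Function.comp_apply, ← Bool.decide_and]
    refine decide_eq_decide.2 ?_
    rw [Slot.vertex_injective.eq_iff, Prod.ext_iff, and_comm]
  rw [this]; rfl

/-- The indices on the arrows of a micro-graph, the free ones first. -/
def join (i₀ : Fin (m + 2)) (i : Fin 5 → Fin (m + 2)) (r : Fin 3 → Fin m → Fin (m + 2)) :
    Fin 3 → Fin (m + 2) → Fin (m + 2) :=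
  ![Matrix.vecCons i₀ (Matrix.vecCons (i 0) (r 0)),
    Matrix.vecCons (i 1) (Matrix.vecCons (i 2) (r 1)),
    Matrix.vecCons (i 3) (Matrix.vecCons (i 4) (r 2))]

/-- The index on the arrow from a Levi-Civita vertex to its own Casimir. -/
def own (r : Fin 3 → Fin m → Fin (m + 2)) : Vertex m 3 → List (Fin (m + 2))
  | .casimir v c => [r v c]
  | _ => []

theorem incoming_segment (Γ : MicroGraph m 3) (J : Fin (m + 2) → Fin (m + 2)) (u : Vertex m 3)
    (v : Fin 3) : ((List.finRange (m + 2)).filter fun k => Γ.fullTarget v k = u).map J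
      = (if Γ.target v 0 = u then [J 0] else []) ++ ((if Γ.target v 1 = u then [J 1] else []) ++
        ((List.finRange m).filter fun c => Vertex.casimir v c = u).map fun c => J c.succ.succ) := by
  rw [List.finRange_succ, List.finRange_succ, List.filter_cons]
  have h : List.map J (List.filter (fun k => decide (Γ.fullTarget v k = u))
      (List.map Fin.succ (0 :: List.map Fin.succ (List.finRange m))))
      = (if Γ.target v 1 = u then [J 1] else []) ++
        ((List.finRange m).filter fun c => Vertex.casimir v c = u).map fun c => J c.succ.succ := by
    rw [List.map_cons, List.filter_cons, List.map_map, List.filter_map]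
    have h1 : Γ.fullTarget v (Fin.succ 0) = Γ.target v 1 := rfl
    simp only [h1, decide_eq_true_eq]
    split_ifs
    · rw [List.map_cons, List.map_map]; rfl
    · rw [List.map_map]; rfl
  have h0 : Γ.fullTarget v 0 = Γ.target v 0 := rfl
  simp only [h0, decide_eq_true_eq]
  rw [← h]
  split_ifs <;> rfl

theorem incoming_own (u : Vertex m 3) (r : Fin 3 → Fin m → Fin (m + 2)) (v : Fin 3) :
    ((List.finRange m).filter fun c => Vertex.casimir v c = u).map (r v)
      = match u with
        | .casimir v' c => if v = v' then [r v c] else []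
        | _ => [] := by
  cases u with
  | sink => simp
  | levi => simp
  | casimir v' c =>
    by_cases h : v = v'
    · subst h
      simp only [Vertex.casimir.injEq, true_and, if_pos]
      have : (List.finRange m).filter (fun c' => decide (c' = c)) = [c] := by
        have := List.filter_beq (l := List.finRange m) c
        rw [List.count_eq_one_of_mem (List.nodup_finRange m) (List.mem_finRange c)] at this
        exact this
      rw [this]; rfl
    · simp [h]

/-- The arrows into a vertex are the sink arrow, those of the five free arrows that head there, and
the arrow from its own Levi-Civita vertex. The order is forgotten because derivatives commute, which
allows the comparison to be made with multisets. -/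
theorem incoming_perm (i₀ : Fin (m + 2)) (i : Fin 5 → Fin (m + 2))
    (r : Fin 3 → Fin m → Fin (m + 2)) (u : Vertex m 3) :
    ((graph s₁ s₂ s₃ s₄ s₅).incoming (join i₀ i r) u).Perm
      ((if .sink = u then [i₀] else []) ++ ((arrows s₁ s₂ s₃ s₄ s₅ i).filter
        fun p => p.2.vertex = u).map Prod.fst ++ own r u) := by
  have hseg : ∀ v : Fin 3, (((List.finRange (m + 2)).map fun k => (v, k)).filter
      fun q => (graph s₁ s₂ s₃ s₄ s₅).fullTarget q.1 q.2 = u).map (fun q => join i₀ i r q.1 q.2)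
      = (if (graph s₁ s₂ s₃ s₄ s₅).target v 0 = u then [join i₀ i r v 0] else []) ++
        ((if (graph s₁ s₂ s₃ s₄ s₅).target v 1 = u then [join i₀ i r v 1] else []) ++
        ((List.finRange m).filter fun c => Vertex.casimir v c = u).map (r v)) := fun v => by
    have hr : (fun c : Fin m => join i₀ i r v c.succ.succ) = r v := by
      fin_cases v <;> rfl
    rw [List.filter_map, List.map_map, ← hr, ← incoming_segment]; rfl
  have hA : ((arrows s₁ s₂ s₃ s₄ s₅ i).filter fun p => p.2.vertex = u).map Prod.fst
      = (if s₁.vertex = u then [i 0] else []) ++ ((if s₂.vertex = u then [i 1] else []) ++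
        ((if s₃.vertex = u then [i 2] else []) ++ ((if s₄.vertex = u then [i 3] else []) ++
        (if s₅.vertex = u then [i 4] else [])))) := by
    simp only [arrows, List.filter_cons, List.filter_nil, decide_eq_true_eq]
    split_ifs <;> rfl
  have hO : (own r u : Multiset (Fin (m + 2))) = (((List.finRange m).filter fun c =>
      Vertex.casimir (0 : Fin 3) c = u).map (r 0) : Multiset (Fin (m + 2)))
      + (((List.finRange m).filter fun c => Vertex.casimir (1 : Fin 3) c = u).map (r 1) :
        Multiset (Fin (m + 2)))
      + (((List.finRange m).filter fun c => Vertex.casimir (2 : Fin 3) c = u).map (r 2) :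
        Multiset (Fin (m + 2))) := by
    rw [incoming_own, incoming_own, incoming_own]
    cases u with
    | sink => rfl
    | levi => rfl
    | casimir v c => fin_cases v <;> rfl
  rw [MicroGraph.incoming, show List.finRange 3 = [0, 1, 2] from rfl]
  rw [List.product_cons, List.product_cons, List.product_cons, List.nil_product]
  simp only [List.filter_append, List.map_append, hseg, hA, List.filter_nil, List.map_nil]
  have t0 : (graph s₁ s₂ s₃ s₄ s₅).target 0 0 = .sink := rfl
  have t1 : (graph s₁ s₂ s₃ s₄ s₅).target 0 1 = s₁.vertex := rfl
  have t2 : (graph s₁ s₂ s₃ s₄ s₅).target 1 0 = s₂.vertex := rfl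
  have t3 : (graph s₁ s₂ s₃ s₄ s₅).target 1 1 = s₃.vertex := rfl
  have t4 : (graph s₁ s₂ s₃ s₄ s₅).target 2 0 = s₄.vertex := rfl
  have t5 : (graph s₁ s₂ s₃ s₄ s₅).target 2 1 = s₅.vertex := rfl
  have j0 : join i₀ i r 0 0 = i₀ := rfl
  have j1 : join i₀ i r 0 1 = i 0 := rfl
  have j2 : join i₀ i r 1 0 = i 1 := rfl
  have j3 : join i₀ i r 1 1 = i 2 := rfl
  have j4 : join i₀ i r 2 0 = i 3 := rfl
  have j5 : join i₀ i r 2 1 = i 4 := rfl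
  rw [t0, t1, t2, t3, t4, t5, j0, j1, j2, j3, j4, j5, ← Multiset.coe_eq_coe]
  simp only [← Multiset.coe_add, hO]
  rw [Multiset.coe_nil]
  abel

/-- The indices on the arrows of a micro-graph correspond to free indices and own ones. -/
def joinEquiv : Fin (m + 2) × (Fin 5 → Fin (m + 2)) × (Fin 3 → Fin m → Fin (m + 2)) ≃
    (Fin 3 → Fin (m + 2) → Fin (m + 2)) where
  toFun p := join p.1 p.2.1 p.2.2
  invFun J := (J 0 0, ![J 0 1, J 1 0, J 1 1, J 2 0, J 2 1], fun v c => J v c.succ.succ)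
  left_inv p := by
    obtain ⟨i₀, i, r⟩ := p
    refine Prod.ext rfl (Prod.ext ?_ ?_)
    · funext k; fin_cases k <;> rfl
    · funext v; fin_cases v <;> rfl
  right_inv J := by
    funext v k
    refine Fin.cases ?_ (fun k => Fin.cases ?_ (fun k => ?_) k) k <;> fin_cases v <;> rfl

theorem incoming_sink (i₀ : Fin (m + 2)) (i : Fin 5 → Fin (m + 2))
    (r : Fin 3 → Fin m → Fin (m + 2)) :
    (graph s₁ s₂ s₃ s₄ s₅).incoming (join i₀ i r) .sink = [i₀] := by
  have h := incoming_perm (s₁ := s₁) (s₂ := s₂) (s₃ := s₃) (s₄ := s₄) (s₅ := s₅) i₀ i r .sink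
  have h0 : (arrows s₁ s₂ s₃ s₄ s₅ i).filter (fun p => p.2.vertex = Vertex.sink) = [] := by
    rw [List.filter_eq_nil_iff]
    intro p _
    simpa using Slot.vertex_ne_sink p.2
  rw [h0, if_pos rfl] at h
  exact List.perm_singleton.1 h

theorem incoming_levi (i₀ : Fin (m + 2)) (i : Fin 5 → Fin (m + 2))
    (r : Fin 3 → Fin m → Fin (m + 2)) (v : Fin 3) :
    ((graph s₁ s₂ s₃ s₄ s₅).incoming (join i₀ i r) (.levi v)).Perm
      (sel (at' (arrows s₁ s₂ s₃ s₄ s₅ i) v) none) := by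
  have h := incoming_perm (s₁ := s₁) (s₂ := s₂) (s₃ := s₃) (s₄ := s₄) (s₅ := s₅) i₀ i r (.levi v)
  rw [if_neg (by simp), List.nil_append] at h
  rw [sel_at]
  have h0 : own r (.levi v) = [] := rfl
  rwa [h0, List.append_nil] at h

theorem incoming_casimir (i₀ : Fin (m + 2)) (i : Fin 5 → Fin (m + 2))
    (r : Fin 3 → Fin m → Fin (m + 2)) (v : Fin 3) (c : Fin m) :
    ((graph s₁ s₂ s₃ s₄ s₅).incoming (join i₀ i r) (.casimir v c)).Perm
      (r v c :: sel (at' (arrows s₁ s₂ s₃ s₄ s₅ i) v) (some c)) := by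
  have h := incoming_perm (s₁ := s₁) (s₂ := s₂) (s₃ := s₃) (s₄ := s₄) (s₅ := s₅) i₀ i r (.casimir v c)
  rw [if_neg (by simp), List.nil_append] at h
  rw [sel_at]
  exact h.trans List.perm_append_comm

theorem leviCivita_eq (a b : Fin (m + 2)) (r : Fin m → Fin (m + 2)) :
    leviCivita (Matrix.vecCons a (Matrix.vecCons b r))
      = rowDet (unit a) (unit b) fun α => Pi.single (r α) 1 := by
  rw [leviCivita, rowDet_eq_det]
  congr 1
  ext s t
  refine Fin.cases ?_ (fun s => Fin.cases ?_ (fun s => ?_) s) s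
  all_goals
    refine Eq.trans ?_ (Pi.single_apply _ _ _).symm
    exact if_congr eq_comm rfl rfl

variable (ρ : Smooth (m + 2)) (c : Fin m → Smooth (m + 2))

/-- Summation over the indices of the arrows to the own Casimirs reassembles the Levi-Civita symbol
and the gradients into a determinant, by `nam_expand`. -/
theorem sum_leviCivita (L : List (Fin (m + 2) × Option (Fin m))) (x : Space (m + 2))
    (a b : Fin (m + 2)) : (∑ r : Fin m → Fin (m + 2),
      leviCivita (Matrix.vecCons a (Matrix.vecCons b r)) * pds (sel L none) (ρ : Scalar (m + 2)) x *
        ∏ α, pds (r α :: sel L (some α)) (c α : Scalar (m + 2)) x) = evalAt x (cont ρ c L a b) := by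
  rw [cont, namC, nam_expand, map_mul, map_sum, Finset.mul_sum]
  refine Finset.sum_congr rfl fun r _ => ?_
  rw [leviCivita_eq, map_mul, map_prod]
  have h1 : evalAt x (pdsS (sel L none) ρ) = pds (sel L none) (ρ : Scalar (m + 2)) x := by
    rw [← coe_pdsS]; rfl
  have h2 : ∀ α, evalAt x (dir (unit (r α)) (pdsS (sel L (some α)) (c α)))
      = pds (r α :: sel L (some α)) (c α : Scalar (m + 2)) x := fun α => by
    change _ = pd (r α) (pds (sel L (some α)) (c α : Scalar (m + 2))) x
    rw [← coe_pdsS]; rfl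
  rw [h1]
  simp only [h2]
  change _ = _ * (_ * rowDet _ _ _)
  ring

/-- The index on the sink arrow is fixed by the component. For given free indices the own indices of
the three Nambu graphs are independent, so the sum over them factors into three determinants. -/
theorem toVField_graph (i₀ : Fin (m + 2)) (x : Space (m + 2)) :
    (graph s₁ s₂ s₃ s₄ s₅).toVField ρ (fun α => c α) i₀ x = evalAt x (∑ i : Fin 5 → Fin (m + 2),
      cont ρ c (at' (arrows s₁ s₂ s₃ s₄ s₅ i) 0) i₀ (i 0) *
        (cont ρ c (at' (arrows s₁ s₂ s₃ s₄ s₅ i) 1) (i 1) (i 2) *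
        cont ρ c (at' (arrows s₁ s₂ s₃ s₄ s₅ i) 2) (i 3) (i 4))) := by
  rw [MicroGraph.toVField, ← joinEquiv.sum_comp, Fintype.sum_prod_type]
  have h : ∀ j i r, joinEquiv (j, i, r) = join (m := m) j i r := fun _ _ _ => rfl
  rw [Finset.sum_eq_single i₀, Fintype.sum_prod_type, map_sum]
  · refine Finset.sum_congr rfl fun i _ => ?_
    simp only [h, incoming_sink, if_true]
    let f : Fin 3 → (Fin m → Fin (m + 2)) → ℝ := fun v r =>
      leviCivita (join i₀ i (fun _ => r) v) *
        pds (sel (at' (arrows s₁ s₂ s₃ s₄ s₅ i) v) none) (ρ : Scalar (m + 2)) x *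
        ∏ α, pds (r α :: sel (at' (arrows s₁ s₂ s₃ s₄ s₅ i) v) (some α)) (c α : Scalar (m + 2)) x
    have hf : ∀ r : Fin 3 → Fin m → Fin (m + 2), ∀ v,
        leviCivita (join i₀ i r v) *
          pds ((graph s₁ s₂ s₃ s₄ s₅).incoming (join i₀ i r) (.levi v)) (ρ : Scalar (m + 2)) x *
          ∏ α, pds ((graph s₁ s₂ s₃ s₄ s₅).incoming (join i₀ i r) (.casimir v α))
            (c α : Scalar (m + 2)) x = f v (r v) := fun r v => by
      have hj : join i₀ i r v = join i₀ i (fun _ => r v) v := by fin_cases v <;> rfl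
      rw [pds_perm (contDiff_coe ρ) (incoming_levi i₀ i r v), hj]
      refine congrArg _ (Finset.prod_congr rfl fun α _ => ?_)
      rw [pds_perm (contDiff_coe (c α)) (incoming_casimir i₀ i r v α)]
    simp only [hf]
    -- Distributivity, read from right to left: a sum over all three families of own indices becomes
    -- a product of three sums.
    have hp := Finset.prod_univ_sum (fun _ : Fin 3 => (Finset.univ : Finset (Fin m → Fin (m + 2)))) f
    rw [Fintype.piFinset_univ] at hp
    rw [← hp, Fin.prod_univ_three, map_mul, map_mul, ← sum_leviCivita, ← sum_leviCivita,
      ← sum_leviCivita, mul_assoc]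
    rfl
  · intro j _ hj
    refine Finset.sum_eq_zero fun p _ => ?_
    have : joinEquiv (j, p) = join (m := m) j p.1 p.2 := rfl
    rw [this, incoming_sink, if_neg (by simpa using hj)]
  · simp

end Graph

/-! ## The trivialising vector field -/

section Trivialising

variable {m : ℕ}

theorem sum_vec_five {X M : Type*} [Fintype X] [AddCommMonoid M] (f : X → X → X → X → X → M) :
    ∑ i : Fin 5 → X, f (i 0) (i 1) (i 2) (i 3) (i 4) = ∑ j, ∑ k, ∑ p, ∑ n, ∑ s, f j k n p s := by
  simp only [sum_vecCons, sum_vecEmpty]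
  refine Finset.sum_congr rfl fun j _ => Finset.sum_congr rfl fun k _ => ?_
  rw [Finset.sum_comm]
  rfl

variable (ρ : Smooth (m + 2)) (c : Fin m → Smooth (m + 2))

/-- The component of the vector field encoded by a micro-graph. -/
def graphValue (s₁ s₂ s₃ s₄ s₅ : Slot m) (i₀ : Fin (m + 2)) : Smooth (m + 2) :=
  ∑ i : Fin 5 → Fin (m + 2), cont ρ c (at' (arrows s₁ s₂ s₃ s₄ s₅ i) 0) i₀ (i 0) *
    (cont ρ c (at' (arrows s₁ s₂ s₃ s₄ s₅ i) 1) (i 1) (i 2) *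
    cont ρ c (at' (arrows s₁ s₂ s₃ s₄ s₅ i) 2) (i 3) (i 4))

theorem sum_sum_mul {ι κ X A : Type*} [Fintype ι] [Fintype κ] [Fintype X] [CommRing A]
    (f : ι → κ → X → A) (g : X → A) :
    ∑ x, ∑ y, ∑ i, f x y i * g i = ∑ i, (∑ x, ∑ y, f x y i) * g i := by
  simp only [Finset.sum_mul]
  rw [Finset.sum_congr rfl fun x _ => Finset.sum_comm, Finset.sum_comm]

theorem sum_cont_cont (k p : Fin (m + 2)) (L : List (Fin (m + 2) × Option (Fin m)))
    (i j : Fin (m + 2)) : ∑ x, ∑ y, cont ρ c ((k, x) :: (p, y) :: L) i j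
      = pdS k (pdS p (cont ρ c L i j)) := by
  rw [Finset.sum_comm]
  simp only [sum_cont]
  rw [← sum_cont]
  exact (dir_sum _ _ _).symm

theorem cont_density (n : Fin (m + 2)) (i j : Fin (m + 2)) :
    cont ρ c [(n, none)] i j = pdS n ρ * namC c i j := cont_none _ _ _ _ _ _

/-- Letting x and y run over all vertices of the first Nambu graph yields two derivatives of its
whole content. The other two graphs point at each other's densities instead of their own; after
multiplication the two first derivatives of ϱ may be exchanged, which gives the product of two
modular components. -/
theorem sum_graphValue_modular (i : Fin (m + 2)) :
    ∑ x, ∑ y, graphValue ρ c (0, none) (0, x) (2, none) (0, y) (1, none) i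
      = lsum (diag (m + 2)) fun k => lsum (diag (m + 2)) fun p =>
        pdS k.1 (pdS p.1 (mv (diag (m + 2)) pdS ρ (namC c) i)) *
          (mv (diag (m + 2)) pdS ρ (namC c) k.2 * mv (diag (m + 2)) pdS ρ (namC c) p.2) := by
  have h0 : ∀ x y (J : Fin 5 → Fin (m + 2)),
      cont ρ c (at' (arrows (0, none) (0, x) (2, none) (0, y) (1, none) J) 0) i (J 0) *
      (cont ρ c (at' (arrows (0, none) (0, x) (2, none) (0, y) (1, none) J) 1) (J 1) (J 2) *
      cont ρ c (at' (arrows (0, none) (0, x) (2, none) (0, y) (1, none) J) 2) (J 3) (J 4))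
      = cont ρ c (at' (arrows (0, none) (0, x) (2, none) (0, y) (1, none) J) 0) i (J 0) *
        (cont ρ c [(J 4, none)] (J 1) (J 2) * cont ρ c [(J 2, none)] (J 3) (J 4)) :=
    fun x y J => rfl
  unfold graphValue
  simp only [h0]
  rw [sum_sum_mul]
  have h : ∀ J : Fin 5 → Fin (m + 2), (∑ x, ∑ y, cont ρ c (at' (arrows (0, none) (0, x) (2, none)
      (0, y) (1, none) J) 0) i (J 0)) = pdS (J 1) (pdS (J 3) (pdS (J 0) ρ * namC c i (J 0))) := by
    intro J
    rw [← cont_density, ← sum_cont_cont]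
    refine Finset.sum_congr rfl fun x _ => Finset.sum_congr rfl fun y _ => cont_perm _ _ ?_ _ _
    exact (List.Perm.swap (J 1, x) (J 0, none) [(J 3, y)]).trans
      ((List.Perm.swap _ _ []).cons _)
  simp only [h]
  refine (sum_vec_five fun j k n p s => pdS k (pdS p (pdS j ρ * namC c i j)) *
    (cont ρ c [(s, none)] k n * cont ρ c [(n, none)] p s)).trans ?_
  simp only [lsum_diag, cont_density, mv]
  rw [Finset.sum_comm]
  refine Finset.sum_congr rfl fun k _ => ?_
  rw [Finset.sum_comm]
  refine Finset.sum_congr rfl fun p _ => ?_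
  rw [pdS, pdS, dir_sum, dir_sum, Finset.sum_mul]
  refine Finset.sum_congr rfl fun j _ => ?_
  rw [Finset.sum_mul_sum, Finset.mul_sum]
  refine Finset.sum_congr rfl fun n _ => ?_
  rw [Finset.mul_sum]
  refine Finset.sum_congr rfl fun s _ => ?_
  ring

theorem sum_graphValue_G (i : Fin (m + 2)) :
    ∑ x, ∑ u, graphValue ρ c (1, u) (0, x) (2, none) (0, none) (1, none) i
      = G (diag (m + 2)) pdS ρ (namC c) i := by
  have h0 : ∀ x u (J : Fin 5 → Fin (m + 2)),
      cont ρ c (at' (arrows (1, u) (0, x) (2, none) (0, none) (1, none) J) 0) i (J 0) *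
      (cont ρ c (at' (arrows (1, u) (0, x) (2, none) (0, none) (1, none) J) 1) (J 1) (J 2) *
      cont ρ c (at' (arrows (1, u) (0, x) (2, none) (0, none) (1, none) J) 2) (J 3) (J 4))
      = (cont ρ c [(J 1, x), (J 3, none)] i (J 0) * cont ρ c [(J 0, u), (J 4, none)] (J 1) (J 2)) *
        cont ρ c [(J 2, none)] (J 3) (J 4) := fun x u J => (mul_assoc _ _ _).symm
  unfold graphValue
  simp only [h0]
  rw [sum_sum_mul]
  simp only [← Finset.mul_sum, ← Finset.sum_mul, sum_cont]
  refine (sum_vec_five fun j k n p s => pdS k (cont ρ c [(p, none)] i j) *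
    pdS j (cont ρ c [(s, none)] k n) * cont ρ c [(n, none)] p s).trans ?_
  simp only [lsum_diag, cont_density, G, Finset.mul_sum]
  refine Finset.sum_congr rfl fun j _ => Finset.sum_congr rfl fun k _ => Finset.sum_congr rfl
    fun p _ => Finset.sum_congr rfl fun n _ => Finset.sum_congr rfl fun s _ => ?_
  ring

/-- The arrows from the second and third Nambu graphs are spread over the first one and give second
derivatives of the bivector. The family T restricts how the remaining arrows hit the second and
third graphs, so that all parts of `W` are covered by one computation. -/
theorem sum_graphValue_second {ι : Type*} (T : Finset ι) (u v z : ι → Option (Fin m))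
    (i : Fin (m + 2)) : ∑ t ∈ T, ∑ x, ∑ y, graphValue ρ c (1, u t) (0, x) (2, z t) (0, y) (1, v t) i
      = ∑ j, ∑ k, ∑ p, pdS k (pdS p (P ρ (namC c) i j)) * ∑ n, ∑ s, ∑ t ∈ T,
        cont ρ c [(j, u t), (s, v t)] k n * cont ρ c [(n, z t)] p s := by
  have h : ∀ t, ∑ x, ∑ y, graphValue ρ c (1, u t) (0, x) (2, z t) (0, y) (1, v t) i
      = ∑ j, ∑ k, ∑ p, ∑ n, ∑ s, pdS k (pdS p (P ρ (namC c) i j)) *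
        (cont ρ c [(j, u t), (s, v t)] k n * cont ρ c [(n, z t)] p s) := fun t => by
    have h0 : ∀ x y (J : Fin 5 → Fin (m + 2)),
        cont ρ c (at' (arrows (1, u t) (0, x) (2, z t) (0, y) (1, v t) J) 0) i (J 0) *
        (cont ρ c (at' (arrows (1, u t) (0, x) (2, z t) (0, y) (1, v t) J) 1) (J 1) (J 2) *
        cont ρ c (at' (arrows (1, u t) (0, x) (2, z t) (0, y) (1, v t) J) 2) (J 3) (J 4))
        = cont ρ c (at' (arrows (1, u t) (0, x) (2, z t) (0, y) (1, v t) J) 0) i (J 0) *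
          (cont ρ c [(J 0, u t), (J 4, v t)] (J 1) (J 2) * cont ρ c [(J 2, z t)] (J 3) (J 4)) :=
      fun x y J => rfl
    unfold graphValue
    simp only [h0]
    rw [sum_sum_mul]
    have h : ∀ J : Fin 5 → Fin (m + 2), (∑ x, ∑ y, cont ρ c (at' (arrows (1, u t) (0, x) (2, z t)
        (0, y) (1, v t) J) 0) i (J 0)) = pdS (J 1) (pdS (J 3) (P ρ (namC c) i (J 0))) := fun J => by
      rw [← cont_nil, ← sum_cont_cont]; rfl
    simp only [h]
    exact sum_vec_five fun j k n p s => pdS k (pdS p (P ρ (namC c) i j)) *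
      (cont ρ c [(j, u t), (s, v t)] k n * cont ρ c [(n, z t)] p s)
  simp only [h, Finset.mul_sum]
  rw [Finset.sum_comm]
  refine Finset.sum_congr rfl fun j _ => ?_
  rw [Finset.sum_comm]
  refine Finset.sum_congr rfl fun k _ => ?_
  rw [Finset.sum_comm]
  refine Finset.sum_congr rfl fun p _ => ?_
  rw [Finset.sum_comm]
  refine Finset.sum_congr rfl fun n _ => ?_
  rw [Finset.sum_comm]

theorem cont_density_some (j s : Fin (m + 2)) (β : Fin m) (k n : Fin (m + 2)) :
    cont ρ c [(j, none), (s, some β)] k n = pdS j ρ * namC (Function.update c β (pdS s (c β))) k n := by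
  rw [cont_none, sel_cons_of_ne s (Option.some_ne_none β)]
  refine congrArg (pdS j ρ * ·) (congrArg (fun c => namC c k n) (funext fun α => ?_))
  by_cases h : α = β
  · subst h; rw [sel_cons_self, Function.update_self]; rfl
  · rw [sel_cons_of_ne s (by simpa using Ne.symm h), Function.update_of_ne h]; rfl

theorem sum_cont_density_some (j s : Fin (m + 2)) (k n : Fin (m + 2)) :
    ∑ β, cont ρ c [(j, none), (s, some β)] k n = pdS j ρ * pdS s (namC c k n) := by
  simp only [cont_density_some]
  rw [← Finset.mul_sum]
  exact congrArg _ (dir_nam _ _ _ _).symm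

theorem sum_cont_some_density (j s : Fin (m + 2)) (k n : Fin (m + 2)) :
    ∑ β, cont ρ c [(j, some β), (s, none)] k n = pdS s ρ * pdS j (namC c k n) := by
  rw [← sum_cont_density_some]
  exact Finset.sum_congr rfl fun β _ => cont_perm _ _ (List.Perm.swap _ _ _) _ _

/-- The part of `W` with a derivative of the bivector. -/
theorem sum_graphValue_W (i : Fin (m + 2)) :
    (∑ z, ∑ β : Fin m, ∑ x, ∑ y, graphValue ρ c (1, none) (0, x) (2, z) (0, y) (1, some β) i)
      + (∑ z, ∑ α : Fin m, ∑ x, ∑ y, graphValue ρ c (1, some α) (0, x) (2, z) (0, y) (1, none) i)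
      + (∑ z, ∑ α : Fin m, ∑ β ∈ Finset.univ.erase α, ∑ x, ∑ y,
        graphValue ρ c (1, some α) (0, x) (2, z) (0, y) (1, some β) i)
      + (∑ β : Fin m, ∑ x, ∑ y, graphValue ρ c (1, none) (0, x) (2, none) (0, y) (1, some β) i)
      = lsum (diag (m + 2)) fun j => lsum (diag (m + 2)) fun k => lsum (diag (m + 2)) fun p =>
        pdS k.1 (pdS p.1 (P ρ (namC c) i j.2)) *
          W (diag (m + 2)) pdS ρ (namC c) (mixC c) j.1 k.2 p.2 := by
  have h1 := sum_graphValue_second ρ c (Finset.univ : Finset (Option (Fin m) × Fin m))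
    (fun _ => none) (fun t => some t.2) (fun t => t.1) i
  have h2 := sum_graphValue_second ρ c (Finset.univ : Finset (Option (Fin m) × Fin m))
    (fun t => some t.2) (fun _ => none) (fun t => t.1) i
  have h3 := sum_graphValue_second ρ c ((Finset.univ : Finset (Option (Fin m))).sigma fun _ =>
    ((Finset.univ : Finset (Fin m)).sigma fun α => Finset.univ.erase α))
    (fun t => some t.2.1) (fun t => some t.2.2) (fun t => t.1) i
  have h4 := sum_graphValue_second ρ c (Finset.univ : Finset (Fin m))
    (fun _ => none) (fun t => some t) (fun _ => none) i
  simp only [Fintype.sum_prod_type, Finset.sum_sigma] at h1 h2 h3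
  rw [h1, h2, h3, h4]
  simp only [lsum_diag, W, ← Finset.sum_add_distrib, ← mul_add]
  refine Finset.sum_congr rfl fun j _ => Finset.sum_congr rfl fun k _ => Finset.sum_congr rfl
    fun p _ => congrArg _ (Finset.sum_congr rfl fun n _ => Finset.sum_congr rfl fun s _ => ?_)
  simp only [Finset.sum_add_distrib]
  simp only [← Finset.sum_mul, ← Finset.mul_sum, sum_cont_density_some, sum_cont_some_density,
    sum_cont_pair, sum_cont, cont_nil, cont_density]
  ring

/-- The linear combination of micro-graphs which trivialises the tetrahedral flow. -/
def trivialising (m : ℕ) : MicroGraph m 3 →₀ ℝ :=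
  (∑ x, ∑ y, .single (graph (0, none) (0, x) (2, none) (0, y) (1, none)) 8)
    + ((∑ z, ∑ β : Fin m, ∑ x, ∑ y, .single (graph (1, none) (0, x) (2, z) (0, y) (1, some β)) 8)
      + (∑ z, ∑ α : Fin m, ∑ x, ∑ y, .single (graph (1, some α) (0, x) (2, z) (0, y) (1, none)) 8)
      + (∑ z, ∑ α : Fin m, ∑ β ∈ Finset.univ.erase α, ∑ x, ∑ y,
        .single (graph (1, some α) (0, x) (2, z) (0, y) (1, some β)) 8)
      + (∑ β : Fin m, ∑ x, ∑ y,
        .single (graph (1, none) (0, x) (2, none) (0, y) (1, some β)) 8))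
    -- The weight 8 is the multiplicity of the tetrahedral flow; 16 appears because `Y` contains `G`
    -- twice.
    + ∑ x, ∑ u, .single (graph (1, u) (0, x) (2, none) (0, none) (1, none)) 16

theorem microField_eq {n : ℕ} (b : MicroGraph m n →₀ ℝ) (ρ : Scalar (m + 2))
    (a : Fin m → Scalar (m + 2)) (i : Fin (m + 2)) (x : Space (m + 2)) : microField b ρ a i x
      = Finsupp.linearCombination ℝ (fun Γ : MicroGraph m n => Γ.toVField ρ a i x) b := rfl

theorem microField_trivialising (i : Fin (m + 2)) (x : Space (m + 2)) :
    microField (trivialising m) (ρ : Scalar (m + 2)) (fun α => c α) i x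
      = 8 * evalAt x (Y (diag (m + 2)) pdS ρ (namC c) (mixC c) i) := by
  have hv : ∀ s₁ s₂ s₃ s₄ s₅ : Slot m, (graph s₁ s₂ s₃ s₄ s₅).toVField (ρ : Scalar (m + 2))
      (fun α => c α) i x = evalAt x (graphValue ρ c s₁ s₂ s₃ s₄ s₅ i) :=
    fun s₁ s₂ s₃ s₄ s₅ => toVField_graph ρ c i x
  rw [microField_eq, trivialising]
  simp only [map_add, map_sum, Finsupp.linearCombination_single, hv, smul_eq_mul, ← Finset.mul_sum]
  rw [Y, ← sum_graphValue_modular, ← sum_graphValue_W, ← sum_graphValue_G]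
  simp only [map_add, map_sum]
  ring

end Trivialising

/-! ## Lie derivatives of Nambu brackets -/

section Trace

variable {R : Type*} [CommRing R] {n m : ℕ}

theorem det_updateRow_eq (M : Matrix (Fin n) (Fin n) R) (r : Fin n) (v : Fin n → R) :
    (M.updateRow r v).det = ∑ j, v j * M.adjugate j r := by
  have hv : v = ∑ j, v j • (Pi.single j 1 : Fin n → R) := by
    funext k; simp [Finset.sum_apply, Pi.single_apply]
  conv_lhs => rw [hv]
  refine ((Matrix.detRowAlternating (R := R) (n := Fin n)).map_update_sum _ _ _ _).trans
    (Finset.sum_congr rfl fun j _ => ?_)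
  refine (AlternatingMap.map_update_smul Matrix.detRowAlternating (M : Fin n → Fin n → R) r _ _).trans
    ?_
  rw [Matrix.adjugate_apply]; rfl

/-- The infinitesimal form of the multiplicativity of determinants. -/
theorem sum_det_updateRow (M A : Matrix (Fin n) (Fin n) R) :
    ∑ r, (M.updateRow r (fun k => ∑ l, M r l * A l k)).det = A.trace * M.det := by
  have h : ∀ r, (M.updateRow r (fun k => ∑ l, M r l * A l k)).det
      = (M * A * M.adjugate) r r := fun r => by
    rw [det_updateRow_eq, Matrix.mul_apply]; rfl
  simp only [h]
  change (M * A * M.adjugate).trace = _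
  rw [mul_assoc, Matrix.trace_mul_comm, mul_assoc, Matrix.adjugate_mul, Matrix.mul_smul,
    mul_one, Matrix.trace_smul, smul_eq_mul, mul_comm]

/-- Transforming the rows one at a time is the derivative of det(M(1 + tA)) at t = 0; the first two
rows are separated from the gradients. -/
theorem sum_rowDet (u v : Fin (m + 2) → R) (G : Fin m → Fin (m + 2) → R)
    (A : Matrix (Fin (m + 2)) (Fin (m + 2)) R) :
    rowDet (fun k => ∑ l, u l * A l k) v G + rowDet u (fun k => ∑ l, v l * A l k) G
      + ∑ α, rowDet u v (Function.update G α fun k => ∑ l, G α l * A l k)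
      = A.trace * rowDet u v G := by
  rw [rowDet_eq_det u v G, ← sum_det_updateRow, Fin.sum_univ_succ, Fin.sum_univ_succ, ← add_assoc]
  have h : ∀ r v', (Matrix.of (Fin.cons u (Fin.cons v G : Fin (m + 1) → Fin (m + 2) → R) :
      Fin (m + 2) → Fin (m + 2) → R)).updateRow r v' = Matrix.of (Function.update (Fin.cons u
      (Fin.cons v G : Fin (m + 1) → Fin (m + 2) → R) : Fin (m + 2) → Fin (m + 2) → R) r v') :=
    fun _ _ => rfl
  simp only [h]
  rw [Fin.update_cons_zero, ← Fin.cons_update, Fin.update_cons_zero]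
  congr 1
  refine Finset.sum_congr rfl fun α _ => ?_
  rw [← Fin.cons_update, ← Fin.cons_update]; rfl

end Trace

section Lie

variable {m d : ℕ}

/-- The divergence of a smooth vector field. -/
def divS (X : Fin d → Smooth d) : Smooth d := ∑ k, pdS k (X k)

/-- The derivative along a smooth vector field. -/
def actS (X : Fin d → Smooth d) (f : Smooth d) : Smooth d := ∑ k, X k * pdS k f

/-- The velocity of the density along a smooth vector field. -/
def densS (X : Fin d → Smooth d) (ρ : Smooth d) : Smooth d := ρ * divS X - actS X ρ

theorem coe_actS (X : Fin d → Smooth d) (f : Smooth d) (x : Space d) :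
    VField.act (fun i => (X i : Scalar d)) f x = evalAt x (actS X f) := by
  rw [actS, map_sum]; rfl

theorem pdS_sum {ι : Type*} (s : Finset ι) (k : Fin d) (f : ι → Smooth d) :
    pdS k (∑ i ∈ s, f i) = ∑ i ∈ s, pdS k (f i) := dir_sum _ _ _

theorem pdS_actS (X : Fin d → Smooth d) (f : Smooth d) (k : Fin d) :
    pdS k (actS X f) = (∑ l, X l * pdS l (pdS k f)) + ∑ l, pdS l f * pdS k (X l) := by
  rw [actS, pdS_sum, ← Finset.sum_add_distrib]
  refine Finset.sum_congr rfl fun l _ => ?_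
  rw [pdS_mul, show pdS k (pdS l f) = pdS l (pdS k f) from dir_comm _ _ _]
  ring

variable (ρ : Smooth (m + 2)) (c : Fin m → Smooth (m + 2)) (X : Fin (m + 2) → Smooth (m + 2))

theorem namC_eq (i j : Fin (m + 2)) :
    namC c i j = rowDet (Pi.single i 1) (Pi.single j 1) fun α k => pdS k (c α) := by
  rw [single_algebraMap, single_algebraMap]; rfl

theorem namC_update_eq (i j : Fin (m + 2)) (α : Fin m) (f : Smooth (m + 2)) :
    namC (Function.update c α f) i j = rowDet (Pi.single i 1) (Pi.single j 1)
      (Function.update (fun α k => pdS k (c α)) α fun k => pdS k f) := by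
  rw [single_algebraMap, single_algebraMap]; exact nam_update_eq _ _ _ _ _

theorem rowDet_sum_left {R : Type*} [CommRing R] (f : Fin (m + 2) → R) (v : Fin (m + 2) → R)
    (G : Fin m → Fin (m + 2) → R) : rowDet f v G = ∑ l, f l * rowDet (Pi.single l 1) v G := by
  have hl : IsLinearMap R fun f => rowDet f v G :=
    ⟨fun _ _ => rowDet_add _ _ _ _, fun r _ => rowDet_smul r _ _ _⟩
  have hf : f = ∑ l, f l • (Pi.single l 1 : Fin (m + 2) → R) := by
    funext k; simp [Finset.sum_apply, Pi.single_apply]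
  conv_lhs => rw [hf]
  exact (map_sum (hl.mk' _) _ _).trans (Finset.sum_congr rfl fun l _ => (hl.mk' _).map_smul _ _)

theorem rowDet_sum_right {R : Type*} [CommRing R] (f : Fin (m + 2) → R) (v : Fin (m + 2) → R)
    (G : Fin m → Fin (m + 2) → R) : rowDet v f G = ∑ l, f l * rowDet v (Pi.single l 1) G := by
  rw [rowDet_swap, rowDet_sum_left, ← Finset.sum_neg_distrib]
  refine Finset.sum_congr rfl fun l _ => ?_
  rw [rowDet_swap v]; ring

/-- The Lie derivative of a Nambu determinant. -/
theorem lie_namC (i j : Fin (m + 2)) :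
    (∑ l, namC c l j * pdS l (X i)) + (∑ l, namC c i l * pdS l (X j))
      - ∑ l, X l * pdS l (namC c i j)
      = divS X * namC c i j - ∑ α, namC (Function.update c α (actS X (c α))) i j := by
  have h := sum_rowDet (Pi.single i 1) (Pi.single j 1) (fun α k => pdS k (c α))
    (Matrix.of fun l k => pdS k (X l))
  have hs : ∀ (i k : Fin (m + 2)), (∑ l, (Pi.single i 1 : Fin (m + 2) → Smooth (m + 2)) l *
      (Matrix.of fun l k => pdS k (X l)) l k) = pdS k (X i) := fun i k => by
    simp [Pi.single_apply]
  simp only [hs] at h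
  rw [rowDet_sum_left, rowDet_sum_right _ (Pi.single i 1)] at h
  simp only [← namC_eq] at h
  have ht : (Matrix.of fun l k => pdS k (X l) : Matrix (Fin (m + 2)) (Fin (m + 2))
      (Smooth (m + 2))).trace = divS X := rfl
  rw [ht] at h
  have hα : ∀ α, namC (Function.update c α (actS X (c α))) i j
      = (∑ l, X l * namC (Function.update c α (pdS l (c α))) i j)
        + rowDet (Pi.single i 1) (Pi.single j 1) (Function.update (fun α k => pdS k (c α)) α
          fun k => ∑ l, pdS l (c α) * pdS k (X l)) := fun α => by
    rw [namC_update_eq]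
    have e : (fun k => pdS k (actS X (c α))) = (∑ l, X l • fun k => pdS k (pdS l (c α)))
        + fun k => ∑ l, pdS l (c α) * pdS k (X l) := by
      funext k
      rw [pdS_actS, Pi.add_apply, Finset.sum_apply]
      refine congrArg (· + _) (Finset.sum_congr rfl fun l _ => ?_)
      rw [Pi.smul_apply, smul_eq_mul, show pdS k (pdS l (c α)) = pdS l (pdS k (c α)) from
        dir_comm _ _ _]
    rw [e, rowDet_update_add]
    congr 1
    have hl : IsLinearMap (Smooth (m + 2)) fun z => rowDet (Pi.single i 1) (Pi.single j 1)
        (Function.update (fun α k => pdS k (c α)) α z) :=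
      ⟨fun _ _ => rowDet_update_add _ _ _ _ _ _, fun r _ => rowDet_update_smul _ _ _ _ r _⟩
    refine (map_sum (hl.mk' _) _ _).trans (Finset.sum_congr rfl fun l _ => ?_)
    rw [namC_update_eq]
    exact (hl.mk' _).map_smul _ _
  have hN : ∑ l, X l * pdS l (namC c i j)
      = ∑ α, ∑ l, X l * namC (Function.update c α (pdS l (c α))) i j := by
    rw [Finset.sum_comm]
    refine Finset.sum_congr rfl fun l _ => ?_
    rw [← Finset.mul_sum]
    exact congrArg _ (dir_nam _ _ _ _)
  simp only [hα, Finset.sum_add_distrib]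
  rw [hN, ← h]
  simp only [Matrix.of_apply]
  have hc : ∀ a b : Fin (m + 2), namC c a b * pdS a (X i) = pdS a (X i) * namC c a b :=
    fun a b => mul_comm _ _
  have hc' : ∀ a b : Fin (m + 2), namC c a b * pdS b (X j) = pdS b (X j) * namC c a b :=
    fun a b => mul_comm _ _
  simp only [hc, hc']
  ring

theorem schouten_pair {d : ℕ} (F : MField d) (X : VField d) (i j : Fin d) (x : Space d) :
    schouten F X [i, j] x = (∑ l, F [l, j] x * pd l (X i) x) + (∑ l, F [i, l] x * pd l (X j) x)
      - ∑ l, X l x * pd l (F [i, j]) x := by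
  rw [schouten]
  congr 1
  exact Fin.sum_univ_two (M := ℝ) _

/-- The Lie derivative of the determinant yields a divergence term and the derivatives of the
Casimirs; adding the derivative of ϱ collects the first into the velocity of the density. So moving
the bracket along X amounts to moving ϱ and the Casimirs separately. -/
theorem schouten_nambu (i j : Fin (m + 2)) (x : Space (m + 2)) :
    schouten (nambuBivector (ρ : Scalar (m + 2)) (fun α => c α)) (fun k => (X k : Scalar (m + 2)))
      [i, j] x = evalAt x (densS X ρ * namC c i j
        - ρ * ∑ α, namC (Function.update c α (actS X (c α))) i j) := by
  have h := lie_namC c X i j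
  have hP : ∀ l, pdS l (P ρ (namC c) i j) = pdS l ρ * namC c i j + ρ * pdS l (namC c i j) :=
    fun l => pdS_mul _ _ _
  have e : densS X ρ * namC c i j - ρ * ∑ α, namC (Function.update c α (actS X (c α))) i j
      = (∑ l, P ρ (namC c) l j * pdS l (X i)) + (∑ l, P ρ (namC c) i l * pdS l (X j))
        - ∑ l, X l * pdS l (P ρ (namC c) i j) := by
    have h1 : ∑ l, P ρ (namC c) l j * pdS l (X i) = ρ * ∑ l, namC c l j * pdS l (X i) := by
      rw [Finset.mul_sum]; exact Finset.sum_congr rfl fun l _ => mul_assoc _ _ _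
    have h2 : ∑ l, P ρ (namC c) i l * pdS l (X j) = ρ * ∑ l, namC c i l * pdS l (X j) := by
      rw [Finset.mul_sum]; exact Finset.sum_congr rfl fun l _ => mul_assoc _ _ _
    have h3 : ∑ l, X l * pdS l (P ρ (namC c) i j)
        = actS X ρ * namC c i j + ρ * ∑ l, X l * pdS l (namC c i j) := by
      simp only [hP, mul_add, Finset.sum_add_distrib]
      rw [actS, Finset.sum_mul, Finset.mul_sum]
      congr 1
      · exact Finset.sum_congr rfl fun l _ => (mul_assoc _ _ _).symm
      · exact Finset.sum_congr rfl fun l _ => by ring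
    rw [h1, h2, h3, densS]
    linear_combination (-ρ) * h
  rw [schouten_pair, e]
  simp only [nambuBivector_pair, map_sub, map_add, map_sum, map_mul]
  rfl

end Lie

/-! ## The trivialisation of the tetrahedral flow -/

section Main

variable {m : ℕ} (ρ : Smooth (m + 2)) (c : Fin m → Smooth (m + 2))

/-- The trivialising vector field. -/
def trivS (i : Fin (m + 2)) : Smooth (m + 2) :=
  (8 : ℝ) • Y (diag (m + 2)) pdS ρ (namC c) (mixC c) i

theorem microField_trivialising_eq : microField (trivialising m) (ρ : Scalar (m + 2)) (fun α => c α)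
    = fun i => (trivS ρ c i : Scalar (m + 2)) := by
  funext i x
  rw [microField_trivialising]; rfl

variable (hm : m = 1 ∨ m = 2)
include hm

theorem casimirVelocity_trivS (α : Fin m) (x : Space (m + 2)) :
    casimirVelocity (nambuBivector (ρ : Scalar (m + 2)) (fun α => c α)) (c α) x
      = -evalAt x (actS (trivS ρ c) (c α)) := by
  have h := congrArg (evalAt x) (casDefect_eq_zero c ρ hm α)
  rw [casDefect, map_add, map_zero, lsum_diag, map_sum] at h
  rw [casimirVelocity_nambu, actS, map_sum, eq_neg_of_add_eq_zero_right h, mul_neg, Finset.mul_sum]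
  refine congrArg _ (Finset.sum_congr rfl fun i _ => ?_)
  rw [map_mul, map_mul, trivS, evalAt_smul]
  ring

theorem tetraFlow_trivS (i j : Fin (m + 2)) (x : Space (m + 2)) :
    tetraFlow (nambuBivector (ρ : Scalar (m + 2)) (fun α => c α)) [i, j] x
      = schouten (nambuBivector (ρ : Scalar (m + 2)) (fun α => c α))
        (fun k => (trivS ρ c k : Scalar (m + 2))) [i, j] x := by
  have h := congrArg (evalAt x) (defect_eq_zero c ρ hm i j)
  rw [defect, map_add, map_zero] at h
  rw [tetraFlow_nambu, eq_neg_of_add_eq_zero_left h, schouten_pair]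
  have hY : ∀ l k, pd l (trivS ρ c k : Scalar (m + 2)) x
      = 8 * evalAt x (pdS l (Y (diag (m + 2)) pdS ρ (namC c) (mixC c) k)) := fun l k => by
    rw [← evalAt_pdS, trivS, pdS, dir_smul, evalAt_smul]
  simp only [hY, nambuBivector_pair]
  rw [lie, lsum_diag, lsum_diag, lsum_diag]
  simp only [map_add, map_neg, map_sum, map_mul]
  have h1 : ∀ l, (trivS ρ c l : Scalar (m + 2)) x
      = 8 * evalAt x (Y (diag (m + 2)) pdS ρ (namC c) (mixC c) l) := fun l => rfl
  simp only [h1]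
  have h2 : ∀ f g h : Fin (m + 2) → ℝ, 8 * -(∑ l, f l + -∑ l, g l + -∑ l, h l)
      = ∑ l, 8 * g l + ∑ l, 8 * h l - ∑ l, 8 * f l := fun f g h => by
    simp only [← Finset.mul_sum]; ring
  rw [h2]
  refine congrArg₂ _ (congrArg₂ _ ?_ ?_) ?_
  · exact Finset.sum_congr rfl fun l _ => mul_left_comm _ _ _
  · exact Finset.sum_congr rfl fun l _ => mul_left_comm _ _ _
  · exact Finset.sum_congr rfl fun l _ => (mul_assoc _ _ _).symm

theorem trivialises_trivialising : Trivialises (trivialising m) := by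
  intro ρ a hρ ha i j x
  have := microField_trivialising_eq ⟨ρ, hρ⟩ fun α => ⟨a α, ha α⟩
  rw [this]
  exact tetraFlow_trivS ⟨ρ, hρ⟩ (fun α => ⟨a α, ha α⟩) hm i j x

omit hm in
theorem nambuDet_eq_sum (a : Fin m → Smooth (m + 2)) (f g : Scalar (m + 2)) (x : Space (m + 2)) :
    nambuDet (fun α => a α) f g x
      = ∑ i, ∑ j, evalAt x (namC a i j) * pd i f x * pd j g x := by
  rw [coe_rowDet (fun k => pd k f x) (fun k => pd k g x) f g a x (fun _ => rfl) (fun _ => rfl), nam,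
    map_rowDet, rowDet_sum_left]
  refine Finset.sum_congr rfl fun i _ => ?_
  rw [rowDet_sum_right, Finset.mul_sum]
  refine Finset.sum_congr rfl fun j _ => ?_
  rw [namC_eq, map_rowDet]
  have hs : ∀ i : Fin (m + 2), (fun k => evalAt x ((Pi.single i 1 : Fin (m + 2) → Smooth (m + 2)) k))
      = Pi.single i 1 := fun i => by
    funext k
    simp only [Pi.single_apply]
    split_ifs <;> simp
  rw [hs, hs]
  change pd i f x * (pd j g x * _) = _
  rw [mul_assoc, mul_comm, mul_comm (pd i f x), mul_comm (pd j g x), mul_assoc]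
  rfl

omit hm in
theorem namC_update_neg (α : Fin m) (f : Smooth (m + 2)) (i j : Fin (m + 2)) :
    namC (Function.update c α (-f)) i j = -namC (Function.update c α f) i j := by
  have := (lin_nam_update c α (unit i) (unit j)).map_smul (-1) f
  rw [neg_one_smul, neg_one_smul] at this
  exact this

omit hm in
-- The algebra of the cancellation: the Casimir part of the bracket with X is removed by the
-- brackets in which a Casimir is replaced by its velocity.
theorem sum_sub_sum_neg {ι κ : Type*} [Fintype ι] [Fintype κ] (w r : ℝ) (A : ι → ι → ℝ)
    (B : κ → ι → ι → ℝ) (f g : ι → ℝ) :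
    (∑ i, ∑ j, (w * A i j - r * ∑ α, B α i j) * f i * g j)
      - ∑ α, r * ∑ i, ∑ j, -B α i j * f i * g j = w * ∑ i, ∑ j, A i j * f i * g j := by
  have h : ∑ α, r * ∑ i, ∑ j, -B α i j * f i * g j
      = ∑ i, ∑ j, -(r * ∑ α, B α i j) * f i * g j := by
    simp only [Finset.mul_sum, ← Finset.sum_neg_distrib, Finset.sum_mul]
    rw [Finset.sum_comm]
    refine Finset.sum_congr rfl fun i _ => ?_
    rw [Finset.sum_comm]
    exact Finset.sum_congr rfl fun j _ => Finset.sum_congr rfl fun α _ => by ring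
  rw [h]
  simp only [Finset.mul_sum, ← Finset.sum_sub_distrib]
  exact Finset.sum_congr rfl fun i _ => Finset.sum_congr rfl fun j _ => by ring

/-- The velocity of the density as a differential polynomial. -/
def densityVelocity (m : ℕ) : DiffPoly m :=
  DiffPoly.density * ∑ k, DiffPoly.D k (MvPolynomial.C 8 *
    Y (diag (m + 2)) (fun k => DiffPoly.D k) DiffPoly.density DiffPoly.namC DiffPoly.mixC k)
  + -∑ k, MvPolynomial.C 8 *
    Y (diag (m + 2)) (fun k => DiffPoly.D k) DiffPoly.density DiffPoly.namC DiffPoly.mixC k *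
      DiffPoly.D k DiffPoly.density

omit hm in
theorem isValue_densityVelocity :
    DiffPoly.IsValue ρ c (densityVelocity m) (densS (trivS ρ c) ρ) := by
  have hr := DiffPoly.isValue_dRel (ρ := ρ) (c := c)
  have hY : ∀ k, DiffPoly.IsValue ρ c (MvPolynomial.C 8 * Y (diag (m + 2)) (fun k => DiffPoly.D k)
      DiffPoly.density DiffPoly.namC DiffPoly.mixC k) (trivS ρ c k) := fun k => by
    have h1 := hr.Y (n := 0) (l := diag (m + 2)) DiffPoly.isValue_density DiffPoly.isValue_namC
      DiffPoly.isValue_mixC k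
    unfold DiffPoly.IsValue at *
    rw [DiffPoly.value_mul, DiffPoly.value_C, h1]; rfl
  rw [densS, sub_eq_add_neg]
  exact hr.add (n := 0) (hr.mul (n := 0) DiffPoly.isValue_density
    (DiffPoly.isValue_sum _ fun k => DiffPoly.isValue_D k (hY k)))
    (hr.neg (n := 0) (DiffPoly.isValue_sum _ fun k => hr.mul (n := 0) (hY k)
      (DiffPoly.isValue_D k DiffPoly.isValue_density)))

/-- The Casimir velocities are minus the derivatives along the trivialising field, so in
`schouten_nambu` their contributions are what is subtracted, and only the multiple of the
determinant remains. -/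
theorem isDensityVelocity : IsDensityVelocity (densityVelocity m) := by
  intro ρ a f g hρ ha hf hg x
  have h := isValue_densityVelocity (⟨ρ, hρ⟩ : Smooth (m + 2)) fun α => (⟨a α, ha α⟩ : Smooth (m + 2))
  have hT := fun i j => tetraFlow_trivS (⟨ρ, hρ⟩ : Smooth (m + 2))
    (fun α => (⟨a α, ha α⟩ : Smooth (m + 2))) hm i j x
  have hC : ∀ α, casimirVelocity (nambuBivector ρ a) (a α)
      = ((-actS (trivS (⟨ρ, hρ⟩ : Smooth (m + 2)) fun α => (⟨a α, ha α⟩ : Smooth (m + 2)))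
        (⟨a α, ha α⟩ : Smooth (m + 2)) : Smooth (m + 2)) : Scalar (m + 2)) := fun α => by
    funext x
    exact casimirVelocity_trivS (⟨ρ, hρ⟩ : Smooth (m + 2))
      (fun α => (⟨a α, ha α⟩ : Smooth (m + 2))) hm α x
  generalize hρ' : (⟨ρ, hρ⟩ : Smooth (m + 2)) = ρ' at *
  generalize hc' : (fun α => (⟨a α, ha α⟩ : Smooth (m + 2))) = c at *
  obtain rfl : ρ = ρ' := by rw [← hρ']
  obtain rfl : a = fun α => (c α : Scalar (m + 2)) := by rw [← hc']
  have hv : (densityVelocity m).value ρ' (fun α => c α) x = evalAt x (densS (trivS ρ' c) ρ') :=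
    congrFun h x
  have hU : ∀ α (s : Smooth (m + 2)), Function.update (fun α => (c α : Scalar (m + 2))) α s
      = fun β => (Function.update c α s β : Scalar (m + 2)) := fun α s => by
    funext β
    by_cases hβ : β = α
    · subst hβ; rw [Function.update_self, Function.update_self]
    · rw [Function.update_of_ne hβ, Function.update_of_ne hβ]
  rw [hv]
  simp only [hC, nambuBracket, bivectorApply]
  simp only [hU, nambuDet_eq_sum]
  simp only [hT, schouten_nambu]
  simp only [namC_update_neg, map_sub, map_mul, map_sum, map_neg]
  exact sum_sub_sum_neg (evalAt x (densS (trivS ρ' c) ρ')) (evalAt x ρ')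
    (fun i j => evalAt x (namC c i j))
    (fun α i j => evalAt x (namC (Function.update c α (actS (trivS ρ' c) (c α))) i j)) _ _

end Main

/-! ## Top-degree multivector fields -/

section Top

variable {d : ℕ}

theorem leviCivita_update (I : Fin d → Fin d) (s l : Fin d) :
    leviCivita (Function.update I s l) = ((Matrix.of fun s t : Fin d =>
      if I s = t then (1 : ℝ) else 0).updateRow s (Pi.single l 1)).det := by
  rw [leviCivita]
  congr 1
  ext r t
  by_cases h : r = s
  · subst h
    simp [Pi.single_apply, eq_comm]
  · simp [h]

theorem det_updateRow_sum {n : ℕ} (M : Matrix (Fin n) (Fin n) ℝ) (r : Fin n) (v : Fin n → ℝ) :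
    ∑ l, (M.updateRow r (Pi.single l 1)).det * v l = (M.updateRow r v).det := by
  rw [det_updateRow_eq]
  refine Finset.sum_congr rfl fun l _ => ?_
  rw [mul_comm, Matrix.adjugate_apply]

/-- Apply `sum_det_updateRow` to the matrix that selects the indices I; its product with A has the
rows A (I s). -/
theorem sum_leviCivita_update (I : Fin d → Fin d) (A : Matrix (Fin d) (Fin d) ℝ) :
    ∑ s, ∑ l, leviCivita (Function.update I s l) * A (I s) l = A.trace * leviCivita I := by
  rw [leviCivita, ← sum_det_updateRow]
  refine Finset.sum_congr rfl fun s _ => ?_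
  simp only [leviCivita_update]
  rw [det_updateRow_sum]
  congr 2
  funext k
  simp

theorem topField_of_length {ϱ : Scalar d} {I : List (Fin d)} (h : I.length = d) (x : Space d) :
    topField ϱ I x = ϱ x * leviCivita (fun s : Fin d => I.get (s.cast h.symm)) := dif_pos h

theorem topField_of_length_ne {ϱ : Scalar d} {I : List (Fin d)} (h : I.length ≠ d) :
    topField ϱ I = 0 := funext fun _ => dif_neg h

theorem get_set_eq (I : List (Fin d)) (h : I.length = d) (s : Fin I.length) (l : Fin d)
    (h' : (I.set s l).length = d) : (fun t : Fin d => (I.set s l).get (t.cast h'.symm))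
      = Function.update (fun t : Fin d => I.get (t.cast h.symm)) (s.cast h) l := by
  funext t
  simp only [List.get_eq_getElem, Fin.val_cast, List.getElem_set]
  by_cases e : t = s.cast h
  · subst e; simp
  · rw [Function.update_of_ne e, if_neg fun hv => e (Fin.ext hv.symm)]

/-- Replacing one index at a time in the Levi-Civita symbol produces the trace of the Jacobian
matrix of X, which is the divergence. On multi-indices of the wrong length both sides are zero. -/
theorem schouten_topField (X : VField d) {ϱ : Scalar d} (hϱ : Differentiable ℝ ϱ) (I : List (Fin d)) :
    schouten (topField ϱ) X I
      = topField (fun x => ϱ x * (∑ k, pd k (X k) x) - VField.act X ϱ x) I := by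
  funext x
  rw [schouten]
  by_cases h : I.length = d
  · have hs : ∀ (s : Fin I.length) (l : Fin d), topField ϱ (I.set s l) x
        = ϱ x * leviCivita (Function.update (fun t : Fin d => I.get (t.cast h.symm)) (s.cast h) l) :=
      fun s l => by
        have h' : (I.set s l).length = d := by rw [List.length_set, h]
        rw [topField_of_length h', get_set_eq I h s l h']
    have hl : ∀ l : Fin d, pd l (topField ϱ I) x
        = pd l ϱ x * leviCivita (fun s : Fin d => I.get (s.cast h.symm)) := fun l => by
      have : topField ϱ I = fun y => ϱ y * leviCivita (fun s : Fin d => I.get (s.cast h.symm)) :=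
        funext fun y => topField_of_length h y
      rw [this, pd, fderiv_mul_const (hϱ x), smul_apply, smul_eq_mul, mul_comm]
      rfl
    simp only [hs, hl]
    rw [topField_of_length h]
    have ht := sum_leviCivita_update (fun t : Fin d => I.get (t.cast h.symm))
      (Matrix.of fun l k => pd k (X l) x)
    rw [← (finCongr h).sum_comp] at ht
    have e : (Matrix.of fun l k => pd k (X l) x : Matrix (Fin d) (Fin d) ℝ).trace
        = ∑ k, pd k (X k) x := rfl
    rw [e] at ht
    rw [VField.act, sub_mul, mul_assoc, ← ht, Finset.sum_mul, Finset.mul_sum]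
    congr 1
    · refine Finset.sum_congr rfl fun s _ => ?_
      rw [Finset.mul_sum]
      exact Finset.sum_congr rfl fun l _ => mul_assoc _ _ _
    · exact Finset.sum_congr rfl fun l _ => (mul_assoc _ _ _).symm
  · have hs : ∀ (s : Fin I.length) (l : Fin d), topField ϱ (I.set s l) = 0 := fun s l =>
      topField_of_length_ne (by rwa [List.length_set])
    have hp : ∀ l : Fin d, pd l (0 : Scalar d) x = 0 := fun l => by
      rw [pd, show (0 : Scalar d) = fun _ => 0 from rfl, fderiv_fun_const]; rfl
    simp only [hs, topField_of_length_ne h, hp, Pi.zero_apply, zero_mul, mul_zero,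
      Finset.sum_const_zero, sub_zero]

theorem sum_leviCivita_mul_prod (A : Matrix (Fin d) (Fin d) ℝ) :
    ∑ J : Fin d → Fin d, leviCivita J * ∏ s, A s (J s) = A.det := by
  have hA : A = fun s => ∑ j, A s j • (Pi.single j 1 : Fin d → ℝ) := by
    funext s k; simp [Finset.sum_apply, Pi.single_apply]
  have h := (Matrix.detRowAlternating (R := ℝ) (n := Fin d)).toMultilinearMap.map_sum
    fun s j => A s j • (Pi.single j 1 : Fin d → ℝ)
  have h2 : A.det = (Matrix.detRowAlternating (R := ℝ) (n := Fin d)).toMultilinearMap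
      fun s => ∑ j, A s j • (Pi.single j 1 : Fin d → ℝ) := congrArg Matrix.det hA
  rw [h2, h]
  refine Finset.sum_congr rfl fun J _ => ?_
  rw [MultilinearMap.map_smul_univ, smul_eq_mul, mul_comm]
  congr 1
  change _ = Matrix.det _
  rw [leviCivita]
  congr 1
  ext s t
  simp [Pi.single_apply, eq_comm]

/-- The Levi-Civita symbol contracted with d copies of the inverse Jacobian matrix gives its
determinant. A singular Jacobian does no harm, as both inverses are then zero or d = 0. -/
theorem pullback_topField (φ : Space d → Space d) (ϱ : Scalar d) (I : List (Fin d)) (x : Space d) :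
    pullback φ (topField ϱ) I x
      = (jacobianMatrix φ x).det⁻¹ * topField (fun y => ϱ (φ y)) I x := by
  rw [pullback]
  by_cases h : I.length = d
  · rw [topField_of_length h, ← ((finCongr h.symm).arrowCongr (Equiv.refl (Fin d))).sum_comp]
    have hJ : ∀ J : Fin d → Fin d, topField ϱ (List.ofFn
        ((finCongr h.symm).arrowCongr (Equiv.refl (Fin d)) J)) (φ x) = ϱ (φ x) * leviCivita J :=
      fun J => by
        have h' : (List.ofFn ((finCongr h.symm).arrowCongr (Equiv.refl (Fin d)) J)).length = d := by
          rw [List.length_ofFn, h]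
        rw [topField_of_length h']
        congr 2
        funext s
        simp
    have hprod : ∀ J : Fin d → Fin d, ∏ s, (jacobianMatrix φ x)⁻¹ (I.get s)
        ((finCongr h.symm).arrowCongr (Equiv.refl (Fin d)) J s)
        = ∏ s, ((jacobianMatrix φ x)⁻¹.submatrix (fun s : Fin d => I.get (s.cast h.symm)) id) s (J s) :=
      fun J => by
        rw [← (finCongr h.symm).prod_comp]
        refine Finset.prod_congr rfl fun s _ => ?_
        simp
    simp only [hJ, hprod, mul_assoc]
    rw [← Finset.mul_sum, sum_leviCivita_mul_prod]
    have e : (jacobianMatrix φ x)⁻¹.submatrix (fun s : Fin d => I.get (s.cast h.symm)) id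
        = (Matrix.of fun s t : Fin d => if I.get (s.cast h.symm) = t then (1 : ℝ) else 0)
          * (jacobianMatrix φ x)⁻¹ := by
      ext s t
      simp [Matrix.mul_apply]
    rw [e, Matrix.det_mul, Matrix.det_nonsing_inv, Ring.inverse_eq_inv', leviCivita]
    ring
  · rw [topField_of_length_ne h, Pi.zero_apply, mul_zero]
    refine Finset.sum_eq_zero fun J _ => ?_
    rw [topField_of_length_ne (by rwa [List.length_ofFn]), Pi.zero_apply, zero_mul]

end Top

/-! ## Evolution of functions and top-degree multivector fields -/

section Evolution

variable {d : ℕ}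

theorem hasDerivAt_det {n : ℕ} {A : ℝ → Matrix (Fin n) (Fin n) ℝ} {A' : Matrix (Fin n) (Fin n) ℝ}
    {t : ℝ} (h : ∀ i j, HasDerivAt (fun s => A s i j) (A' i j) t) :
    HasDerivAt (fun s => (A s).det) (∑ i, ((A t).updateCol i fun r => A' r i).det) t := by
  simp only [Matrix.det_apply']
  have h1 : ∀ σ : Equiv.Perm (Fin n), HasDerivAt (fun s => ((Equiv.Perm.sign σ : ℤ) : ℝ)
      * ∏ i, A s (σ i) i) (((Equiv.Perm.sign σ : ℤ) : ℝ)
      * ∑ i, (∏ j ∈ Finset.univ.erase i, A t (σ j) j) • A' (σ i) i) t := fun σ =>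
    (HasDerivAt.fun_finsetProd fun i _ => h (σ i) i).const_mul _
  refine (HasDerivAt.fun_sum fun σ _ => h1 σ).congr_deriv ?_
  rw [Finset.sum_comm]
  refine Finset.sum_congr rfl fun σ _ => ?_
  rw [Finset.mul_sum]
  refine Finset.sum_congr rfl fun i _ => ?_
  rw [← Finset.prod_erase_mul _ _ (Finset.mem_univ i), Matrix.updateCol_self, smul_eq_mul]
  congr 2
  refine Finset.prod_congr rfl fun j hj => ?_
  rw [Matrix.updateCol_ne (Finset.ne_of_mem_erase hj)]

theorem hasDerivAt_det_one {n : ℕ} {A : ℝ → Matrix (Fin n) (Fin n) ℝ}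
    {A' : Matrix (Fin n) (Fin n) ℝ} {t : ℝ} (h : ∀ i j, HasDerivAt (fun s => A s i j) (A' i j) t)
    (h1 : A t = 1) : HasDerivAt (fun s => (A s).det) A'.trace t := by
  refine (hasDerivAt_det h).congr_deriv (Finset.sum_congr rfl fun i _ => ?_)
  rw [h1, ← Matrix.cramer_apply, Matrix.cramer_one]; rfl

/-- Both sides are mixed second derivatives of f at (0, x), one in ε and one along v, and they agree
because the second derivative of a C² function is symmetric. -/
theorem hasDerivAt_fderiv {E : Type*} [NormedAddCommGroup E] [NormedSpace ℝ E] {f : ℝ × E → ℝ}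
    {g : E → ℝ} {x : E} (hf : ContDiffAt ℝ 2 f (0, x))
    (hg : ∀ᶠ y in 𝓝 x, HasDerivAt (fun ε => f (ε, y)) (g y) 0) (v : E) :
    HasDerivAt (fun ε => fderiv ℝ (fun y => f (ε, y)) x v) (fderiv ℝ g x v) 0 := by
  have hd : ∀ᶠ p in 𝓝 ((0 : ℝ), x), DifferentiableAt ℝ f p :=
    (hf.eventually (by simp)).mono fun p hp => hp.differentiableAt (by simp)
  have hdf : DifferentiableAt ℝ (fderiv ℝ f) (0, x) :=
    (hf.fderiv_right (m := 1) (by norm_num)).differentiableAt (by simp)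
  have ht : Filter.Tendsto (fun ε : ℝ => (ε, x)) (𝓝 0) (𝓝 (0, x)) :=
    (Continuous.prodMk_left x).continuousAt
  have ht' : Filter.Tendsto (fun y : E => ((0 : ℝ), y)) (𝓝 x) (𝓝 (0, x)) :=
    (Continuous.prodMk_right (0 : ℝ)).continuousAt
  have h1 : ∀ ε : ℝ, ∀ y : E, DifferentiableAt ℝ f (ε, y) →
      fderiv ℝ (fun y => f (ε, y)) y v = fderiv ℝ f (ε, y) (0, v) := fun ε y h => by
    have := h.hasFDerivAt.comp y (hasFDerivAt_prodMk_right ε y)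
    rw [show (fun y => f (ε, y)) = f ∘ fun y => (ε, y) from rfl, this.fderiv]
    simp
  have h2 : g =ᶠ[𝓝 x] fun y => fderiv ℝ f (0, y) (1, 0) := by
    filter_upwards [hg, ht'.eventually hd] with y hy hdy
    refine hy.unique ?_
    have := hdy.hasFDerivAt.comp_hasDerivAt (0 : ℝ)
      ((hasDerivAt_id (0 : ℝ)).prodMk (hasDerivAt_const (0 : ℝ) y))
    exact this
  have hs := hf.isSymmSndFDerivAt (by simp)
  have h3 : fderiv ℝ g x v = fderiv ℝ (fderiv ℝ f) (0, x) (1, 0) (0, v) := by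
    rw [h2.fderiv_eq, hs]
    have h4 : HasFDerivAt (fun y => fderiv ℝ f ((0 : ℝ), y))
        ((fderiv ℝ (fderiv ℝ f) (0, x)).comp (ContinuousLinearMap.inr ℝ ℝ E)) x :=
      hdf.hasFDerivAt.comp x (hasFDerivAt_prodMk_right (0 : ℝ) x)
    have h5 := h4.clm_apply (hasFDerivAt_const ((1 : ℝ), (0 : E)) x)
    rw [h5.fderiv]
    simp
  have h6 : HasDerivAt (fun ε : ℝ => fderiv ℝ f (ε, x)) (fderiv ℝ (fderiv ℝ f) (0, x) (1, 0)) 0 :=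
    hdf.hasFDerivAt.comp_hasDerivAt (0 : ℝ)
      ((hasDerivAt_id (0 : ℝ)).prodMk (hasDerivAt_const (0 : ℝ) x))
  have h7 : HasDerivAt (fun ε : ℝ => fderiv ℝ f (ε, x) (0, v))
      (fderiv ℝ (fderiv ℝ f) (0, x) (1, 0) (0, v)) 0 :=
    (h6.clm_apply (hasDerivAt_const (0 : ℝ) ((0 : ℝ), v))).congr_deriv (by simp)
  rw [h3]
  exact h7.congr_of_eventuallyEq ((ht.eventually hd).mono fun ε hε => h1 ε x hε)

theorem fderiv_eq_sum_pd (f : Scalar d) (x v : Space d) :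
    fderiv ℝ f x v = ∑ i, v i * pd i f x := by
  conv_lhs => rw [show v = ∑ i, v i • (Pi.single i 1 : Space d) by
    funext k; simp [Finset.sum_apply, Pi.single_apply]]
  rw [map_sum]
  exact Finset.sum_congr rfl fun i _ => map_smul _ _ _

variable {X : VField d} {ϱ a : Scalar d} {x : Space d} {Φ : ℝ → Space d → Space d}

theorem hasDerivAt_comp_flow (ha : ContDiff ℝ ∞ a) (h0 : Φ 0 x = x)
    (hv : HasDerivAt (fun ε => Φ ε x) (fun i => -X i x) 0) :
    HasDerivAt (fun ε => a (Φ ε x)) (VField.act (-X) a x) 0 := by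
  have h : HasFDerivAt a (fderiv ℝ a x) (Φ 0 x) := by
    rw [h0]; exact (ha.differentiable (by simp) x).hasFDerivAt
  refine (h.comp_hasDerivAt (0 : ℝ) hv).congr_deriv ?_
  rw [fderiv_eq_sum_pd]; rfl

/-- The Jacobian matrix is the identity at ε = 0 and its velocity is minus that of X, so the inverse
determinant grows at the rate div X. The transported coefficient contributes −X(ϱ) by the chain
rule. -/
theorem hasDerivAt_pullback_topField (hϱ : ContDiff ℝ ∞ ϱ)
    (hΦ : ContDiffAt ℝ ∞ (Function.uncurry Φ) (0, x)) (h0 : ∀ᶠ y in 𝓝 x, Φ 0 y = y)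
    (hv : ∀ᶠ y in 𝓝 x, HasDerivAt (fun ε => Φ ε y) (fun i => -X i y) 0) (I : List (Fin d)) :
    HasDerivAt (fun ε => pullback (Φ ε) (topField ϱ) I x) (schouten (topField ϱ) X I x) 0 := by
  have hJ : ∀ i j, HasDerivAt (fun ε => jacobianMatrix (Φ ε) x i j) (-pd j (X i) x) 0 := fun i j => by
    have hf : ContDiffAt ℝ 2 (fun p : ℝ × Space d => Function.uncurry Φ p i) (0, x) :=
      ((contDiffAt_pi.1 hΦ) i).of_le (by simp [← WithTop.coe_ofNat, WithTop.coe_le_coe])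
    have hg : ∀ᶠ y in 𝓝 x, HasDerivAt (fun ε => Φ ε y i) ((-X i) y) 0 :=
      hv.mono fun y hy => hasDerivAt_pi.1 hy i
    refine (hasDerivAt_fderiv hf hg (Pi.single j 1)).congr_deriv ?_
    rw [fderiv_neg]; rfl
  have hJ0 : jacobianMatrix (Φ 0) x = 1 := by
    ext i j
    have : (fun y => Φ 0 y i) =ᶠ[𝓝 x] fun y => y i :=
      h0.mono fun y hy => congrFun hy i
    rw [jacobianMatrix, Matrix.of_apply, pd, this.fderiv_eq]
    have hp := congrFun (pd_coord j i) x
    rw [pd] at hp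
    rw [hp, Matrix.one_apply]
    simp only [eq_comm]
  have hdet := hasDerivAt_det_one (A' := Matrix.of fun i j => -pd j (X i) x) hJ hJ0
  have hd0 : (jacobianMatrix (Φ 0) x).det = 1 := by rw [hJ0, Matrix.det_one]
  have hinv := hdet.inv (by rw [hd0]; exact one_ne_zero)
  have hρ := hasDerivAt_comp_flow hϱ h0.self_of_nhds hv.self_of_nhds
  simp only [pullback_topField]
  rw [schouten_topField X (hϱ.differentiable (by simp))]
  by_cases h : I.length = d
  · simp only [topField_of_length h, ← mul_assoc]
    refine ((hinv.mul hρ).mul_const _).congr_deriv ?_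
    have ht : (Matrix.of fun i j => -pd j (X i) x : Matrix (Fin d) (Fin d) ℝ).trace
        = -∑ k, pd k (X k) x := by
      rw [← Finset.sum_neg_distrib]; rfl
    have hn : VField.act (-X) ϱ x = -VField.act X ϱ x := by
      rw [VField.act, VField.act, ← Finset.sum_neg_distrib]
      exact Finset.sum_congr rfl fun i _ => neg_mul _ _
    simp only [Pi.inv_apply]
    rw [ht, hn, hd0, h0.self_of_nhds]
    ring
  · simp only [topField_of_length_ne h, Pi.zero_apply, mul_zero]
    exact hasDerivAt_const _ _

end Evolution

/-! ## Micro-graphs as differential polynomials -/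

section MicroPoly

variable {m n : ℕ}

namespace DiffPoly

/-- The components of the vector field of a micro-graph as differential polynomials. -/
def ofMicroGraph (Γ : MicroGraph m n) (i : Fin (m + 2)) : DiffPoly m :=
  ∑ idx : Fin n → Fin (m + 2) → Fin (m + 2),
    if Γ.incoming idx Vertex.sink = [i] then
      ∏ v : Fin n, (MvPolynomial.C (leviCivita (idx v))
        * MvPolynomial.X (none, Γ.incoming idx (Vertex.levi v))
        * ∏ c : Fin m, MvPolynomial.X (some c, Γ.incoming idx (Vertex.casimir v c)))
    else 0

theorem value_ofMicroGraph (Γ : MicroGraph m n) (i : Fin (m + 2)) (ρ : Scalar (m + 2))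
    (a : Fin m → Scalar (m + 2)) : value (ofMicroGraph Γ i) ρ a = Γ.toVField ρ a i := by
  funext x
  rw [value, ofMicroGraph, map_sum, MicroGraph.toVField]
  refine Finset.sum_congr rfl fun idx _ => ?_
  split_ifs
  · simp only [map_prod, map_mul, MvPolynomial.eval_C, MvPolynomial.eval_X, Option.elim]
  · exact map_zero _

/-- The components of the vector field of a combination of micro-graphs as differential
polynomials. -/
def micro (b : MicroGraph m n →₀ ℝ) (i : Fin (m + 2)) : DiffPoly m :=
  ∑ Γ ∈ b.support, MvPolynomial.C (b Γ) * ofMicroGraph Γ i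

theorem value_micro (b : MicroGraph m n →₀ ℝ) (i : Fin (m + 2)) (ρ : Scalar (m + 2))
    (a : Fin m → Scalar (m + 2)) : value (micro b i) ρ a = microField b ρ a i := by
  funext x
  rw [micro, value_sum, Finset.sum_apply]
  refine Finset.sum_congr rfl fun Γ _ => ?_
  rw [value_mul, value_C, value_ofMicroGraph]; rfl

theorem pds_zero {d : ℕ} (J : List (Fin d)) : pds J (0 : Scalar d) = 0 := by
  induction J with
  | nil => rfl
  | cons k J ih =>
    change pd k (pds J 0) = 0
    rw [ih]; exact pd_const k 0

/-- Each micro-graph has at least one Levi-Civita vertex, and its content is a derivative of the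
density. -/
theorem value_micro_zero (b : MicroGraph m (n + 1) →₀ ℝ) (i : Fin (m + 2))
    (a : Fin m → Scalar (m + 2)) : value (micro b i) 0 a = 0 := by
  rw [value_micro]
  funext x
  refine Finset.sum_eq_zero fun Γ _ => mul_eq_zero_of_right _ (Finset.sum_eq_zero fun idx _ => ?_)
  split_ifs
  · exact Finset.prod_eq_zero (Finset.mem_univ 0) (by rw [pds_zero]; simp)
  · rfl

theorem pds_eventuallyEq {d : ℕ} {f g : Scalar d} {x : Space d} (h : f =ᶠ[𝓝 x] g)
    (J : List (Fin d)) : pds J f =ᶠ[𝓝 x] pds J g := by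
  induction J with
  | nil => exact h
  | cons k J ih => exact ih.fderiv.fun_comp fun L => L (Pi.single k 1)

/-- The value of a differential polynomial is local. -/
theorem value_congr (p : DiffPoly m) {ρ σ : Scalar (m + 2)} (a : Fin m → Scalar (m + 2))
    {x : Space (m + 2)} (h : ρ =ᶠ[𝓝 x] σ) : value p ρ a x = value p σ a x := by
  rw [value, value]
  refine congrArg (fun f => MvPolynomial.eval f p) (funext fun q => ?_)
  obtain ⟨_ | β, J⟩ := q
  · exact (pds_eventuallyEq h J).self_of_nhds
  · rfl

/-- The velocity of a Casimir along the vector field of a combination of micro-graphs. -/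
def microAct (b : MicroGraph m n →₀ ℝ) (β : Fin m) : DiffPoly m := ∑ k, micro b k * row β k

/-- The velocity of the density along the vector field of a combination of micro-graphs. -/
def microDens (b : MicroGraph m n →₀ ℝ) : DiffPoly m :=
  density * ∑ k, D k (micro b k) + -∑ k, micro b k * D k density

end DiffPoly

open DiffPoly

variable (b : MicroGraph m n →₀ ℝ) (ρ : Smooth (m + 2)) (c : Fin m → Smooth (m + 2))

/-- The smooth components of the vector field of a combination of micro-graphs. -/
def microS (i : Fin (m + 2)) : Smooth (m + 2) :=
  ⟨microField b ρ (fun α => c α) i, show ContDiff ℝ ∞ _ by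
    rw [← value_micro]; exact contDiff_value (contDiff_coe ρ) (fun α => contDiff_coe (c α)) _⟩

theorem isValue_micro (i : Fin (m + 2)) : IsValue ρ c (micro b i) (microS b ρ c i) :=
  value_micro _ _ _ _

theorem isValue_microAct (β : Fin m) :
    IsValue ρ c (microAct b β) (actS (microS b ρ c) (c β)) :=
  isValue_sum _ fun k => isValue_dRel.mul (n := 0) (isValue_micro b ρ c k) (isValue_row β k)

theorem isValue_microDens : IsValue ρ c (microDens b) (densS (microS b ρ c) ρ) := by
  have hr := isValue_dRel (ρ := ρ) (c := c)
  rw [densS, sub_eq_add_neg]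
  exact hr.add (n := 0) (hr.mul (n := 0) isValue_density
    (isValue_sum _ fun k => isValue_D k (isValue_micro b ρ c k)))
    (hr.neg (n := 0) (isValue_sum _ fun k => hr.mul (n := 0) (isValue_micro b ρ c k)
      (isValue_D k isValue_density)))

end MicroPoly

/-! ## Vector fields preserving all Nambu brackets -/

section Rigidity

open DiffPoly

variable {m n : ℕ}

/-- Polarisation: the determinant vanishes when the second row equals row β, and this is applied to
the sum of both rows. -/
theorem rowDet_self {R : Type*} [CommRing R] (u : Fin (m + 2) → R) (v : Fin (m + 2) → R)
    (G : Fin m → Fin (m + 2) → R) (β : Fin m) : rowDet u (G β) (Function.update G β v)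
      = -rowDet u v G := by
  have hz : ∀ w : Fin (m + 2) → R, rowDet u w (Function.update G β w) = 0 := fun w => by
    rw [rowDet_update]
    refine AlternatingMap.map_eq_zero_of_eq _ _ (i := 1) (j := β.succ.succ) ?_
      (by simp [Fin.ext_iff])
    rw [Function.update_self, Function.update_of_ne (by simp [Fin.ext_iff])]; rfl
  have hadd : ∀ (w w' : Fin (m + 2) → R) G, rowDet u (w + w') G = rowDet u w G + rowDet u w' G :=
    fun w w' G => by
      rw [rowDet_swap, rowDet_add, rowDet_swap u w, rowDet_swap u w']; ring
  have h := hz (G β + v)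
  rw [rowDet_update_add, hadd, hadd, hz, hz, Function.update_eq_self] at h
  linear_combination h

theorem rowDet_mem {R : Type*} [CommRing R] (u : Fin (m + 2) → R) (G : Fin m → Fin (m + 2) → R)
    (β : Fin m) : rowDet u (G β) G = 0 := by
  rw [rowDet_eq_det]
  exact Matrix.det_zero_of_row_eq (i := 1) (j := β.succ.succ) (by simp [Fin.ext_iff]) rfl

theorem sum_namC (c : Fin m → Smooth (m + 2)) (i : Fin (m + 2)) (β : Fin m) :
    ∑ j, pdS j (c β) * namC c i j = 0 := by
  simp only [namC_eq]
  rw [← rowDet_sum_right (fun j => pdS j (c β))]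
  exact rowDet_mem _ (fun α k => pdS k (c α)) β

/-- Contraction puts the gradient of c β into the second row. If it is still among the other rows,
the determinant is zero; if it has been replaced by the gradient of f, exchanging the two rows
leaves a bracket with f. -/
theorem sum_namC_update (c : Fin m → Smooth (m + 2)) (i : Fin (m + 2)) (α β : Fin m)
    (f : Smooth (m + 2)) : ∑ j, pdS j (c β) * namC (Function.update c α f) i j
      = if α = β then -∑ p, namC c i p * pdS p f else 0 := by
  simp only [namC_update_eq]
  rw [← rowDet_sum_right (fun j => pdS j (c β))]
  split_ifs with h
  · subst h
    rw [rowDet_self (Pi.single i 1) (fun k => pdS k f) (fun α k => pdS k (c α)) α, rowDet_sum_right]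
    refine congrArg _ (Finset.sum_congr rfl fun p _ => ?_)
    rw [mul_comm, namC_eq]
  · have := rowDet_mem (Pi.single i 1) (Function.update (fun α k => pdS k (c α)) α
      fun k => pdS k f) β
    rwa [Function.update_of_ne (Ne.symm h)] at this

/-- At points where the gradients of the Casimirs are independent, the Nambu determinant does not
vanish. -/
theorem exists_namC_ne_zero (c : Fin m → Smooth (m + 2)) (x : Space (m + 2))
    (h : LinearIndependent ℝ fun α => grad (c α) x) : ∃ i j, evalAt x (namC c i j) ≠ 0 := by
  by_contra! h0
  -- Only a completion of the gradients to a coframe is needed, so the Euclidean form and the zero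
  -- form are used.
  obtain ⟨b, b', hb, -, -, hG, -⟩ := exists_adapted_frame
    (S := (1 : Matrix (Fin (m + 2)) (Fin (m + 2)) ℝ)) (Q := 0) (by simp [dotProduct_comm]) (fun v hv => by
      rw [Matrix.one_mulVec]
      exact lt_of_le_of_ne (Finset.sum_nonneg fun i _ => mul_self_nonneg (v i))
        fun h => hv (dotProduct_self_eq_zero.1 h.symm))
    (by simp) h
  have hd : rowDet (b' 0) (b' 1) (fun α => grad (c α) x) = 0 := by
    rw [rowDet_sum_left]
    refine Finset.sum_eq_zero fun i _ => ?_
    rw [rowDet_sum_right]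
    refine mul_eq_zero_of_right _ (Finset.sum_eq_zero fun j _ => mul_eq_zero_of_right _ ?_)
    have := h0 i j
    rw [namC, nam, map_rowDet] at this
    exact this
  rw [rowDet_eq_det] at hd
  have hM : Matrix.of b' = Matrix.of (Fin.cons (b' 0) (Fin.cons (b' 1) (fun α => grad (c α) x) :
      Fin (m + 1) → Fin (m + 2) → ℝ) : Fin (m + 2) → Fin (m + 2) → ℝ) := by
    ext i k
    refine Fin.cases rfl (fun i => Fin.cases rfl (fun i => ?_) i) i
    exact congrFun (hG i) k
  have := hb.det_mul
  rw [hM, hd, mul_zero] at this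
  exact zero_ne_one this

variable {b : MicroGraph m (n + 1) →₀ ℝ}

section

variable (hb : ∀ (ρ : Smooth (m + 2)) (c : Fin m → Smooth (m + 2)) (i j : Fin (m + 2)),
  densS (microS b ρ c) ρ * namC c i j
    = ρ * ∑ α, namC (Function.update c α (actS (microS b ρ c) (c α))) i j)
include hb

/-- The Casimirs of a vector field that preserves all Nambu brackets are Casimirs of the bracket. -/
theorem sum_namC_actS (ρ : Smooth (m + 2)) (c : Fin m → Smooth (m + 2)) (i : Fin (m + 2)) (β : Fin m) :
    ∑ p, namC c i p * pdS p (actS (microS b ρ c) (c β)) = 0 := by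
  have h1 : ∀ ρ : Smooth (m + 2),
      ρ * ∑ p, namC c i p * pdS p (actS (microS b ρ c) (c β)) = 0 := fun ρ => by
    -- Contraction with the gradient of c β annihilates the left side, where it meets N, and leaves
    -- on the right only the term in which this Casimir has been replaced.
    have h := Finset.sum_congr (rfl : (Finset.univ : Finset (Fin (m + 2))) = _)
      fun j _ => congrArg (pdS j (c β) * ·) (hb ρ c i j)
    have hl : ∑ j, pdS j (c β) * (densS (microS b ρ c) ρ * namC c i j) = 0 := by
      simp only [mul_left_comm _ (densS (microS b ρ c) ρ)]
      rw [← Finset.mul_sum, sum_namC, mul_zero]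
    have hr : ∑ j, pdS j (c β) *
        (ρ * ∑ α, namC (Function.update c α (actS (microS b ρ c) (c α))) i j)
        = -(ρ * ∑ p, namC c i p * pdS p (actS (microS b ρ c) (c β))) := by
      simp only [mul_left_comm _ ρ, Finset.mul_sum]
      rw [Finset.sum_comm]
      simp only [← Finset.mul_sum, sum_namC_update]
      rw [Finset.sum_ite_eq' Finset.univ β, if_pos (Finset.mem_univ _)]
      exact mul_neg _ _
    exact neg_eq_zero.1 (hr.symm.trans (h.symm.trans hl))
  refine Smooth.ext_eval fun x => ?_
  have hv : ∀ ρ : Smooth (m + 2), IsValue ρ c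
      (∑ p, DiffPoly.namC i p * D p (microAct b β))
      (∑ p, namC c i p * pdS p (actS (microS b ρ c) (c β))) := fun ρ =>
    isValue_sum _ fun p => isValue_dRel.mul (n := 0) (isValue_namC i p)
      (isValue_D p (isValue_microAct b ρ c β))
  -- The factor ϱ is cancelled along the line ϱ + s, which is nonzero at x for all s above −ϱ(x);
  -- polynomiality in s extends the vanishing to s = 0.
  have h2 := value_eq_zero_of_line (contDiff_coe ρ) (fun α => contDiff_coe (c α))
    (σ := ((1 : Smooth (m + 2)) : Scalar (m + 2))) (q := fun _ => 0) (contDiff_coe 1)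
    (fun _ => contDiff_const) (∑ p, DiffPoly.namC i p * D p (microAct b β)) x ?_
  · rw [hv ρ] at h2; exact h2
  refine (Set.Ioi_infinite (-(ρ : Scalar (m + 2)) x)).mono fun s hs => ?_
  rw [Set.mem_ofPred_eq]
  simp only [smul_zero, add_zero]
  have h3 := congrArg (evalAt x) (h1 (ρ + s • 1))
  rw [map_mul, map_zero] at h3
  rw [show ((ρ : Scalar (m + 2)) + s • ((1 : Smooth (m + 2)) : Scalar (m + 2)))
    = ((ρ + s • 1 : Smooth (m + 2)) : Scalar (m + 2)) from rfl, hv]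
  refine (mul_eq_zero.1 h3).resolve_left ?_
  rw [map_add, evalAt_smul, map_one, mul_one]
  have : -(ρ : Scalar (m + 2)) x < s := hs
  rw [evalAt_apply]
  linarith

/-- The function Z(c β) is constant along the Hamiltonian curves of N, which do not depend on ϱ. A
non-constant such curve leaves x, and ϱ can be changed to vanish near a later point without being
changed near x. There Z vanishes, so Z(c β) is zero at that point, hence at x, and locality returns
to the original ϱ. -/
theorem microAct_eq_zero_of_independent (ρ : Smooth (m + 2)) (c : Fin m → Smooth (m + 2)) (β : Fin m)
    (x : Space (m + 2)) (h : LinearIndependent ℝ fun α => grad (c α) x) :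
    value (microAct b β) ρ (fun α => c α) x = 0 := by
  obtain ⟨i, j, hij⟩ := exists_namC_ne_zero c x h
  have hV : ContDiff ℝ 1 fun y : Space (m + 2) => fun p => (namC c i p : Scalar (m + 2)) y :=
    contDiff_pi.2 fun p => (contDiff_coe (namC c i p)).of_le (by simp)
  obtain ⟨γ, hγ0, ε, hε, hγ⟩ :=
    hV.contDiffAt (x := x).exists_forall_mem_closedBall_exists_eq_forall_mem_Ioo_hasDerivAt₀ 0
  rw [zero_sub, zero_add] at hγ
  have h0ε : (0 : ℝ) ∈ Set.Ioo (-ε) ε := ⟨by linarith, hε⟩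
  -- A constant curve would have velocity zero, but the component j of the velocity at x is N at (i,
  -- j), which is nonzero.
  obtain ⟨t, ht, hne⟩ : ∃ t ∈ Set.Ioo (-ε) ε, γ t ≠ x := by
    by_contra! hc
    have h1 : γ =ᶠ[𝓝 0] fun _ => x :=
      Filter.eventuallyEq_of_mem (Ioo_mem_nhds h0ε.1 h0ε.2) hc
    have h2 := (hγ 0 h0ε).unique ((hasDerivAt_const (0 : ℝ) x).congr_of_eventuallyEq h1)
    rw [hγ0] at h2
    exact hij (congrFun h2 j)
  have hr : 0 < dist (γ t) x := dist_pos.2 hne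
  -- The radii are chosen so that the cut-off is 1 near x and its support stays away from a
  -- neighbourhood of γ t.
  let χ : ContDiffBump x := ⟨dist (γ t) x / 3, dist (γ t) x / 2, by linarith, by linarith⟩
  let ρ' : Smooth (m + 2) := ρ * ⟨χ, χ.contDiff⟩
  have h1 : (ρ' : Scalar (m + 2)) =ᶠ[𝓝 x] ρ := by
    filter_upwards [χ.eventuallyEq_one] with y hy
    change (ρ : Scalar (m + 2)) y * χ y = _
    rw [hy, Pi.one_apply, mul_one]
  have h2 : (ρ' : Scalar (m + 2)) =ᶠ[𝓝 (γ t)] 0 := by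
    have : ∀ᶠ y in 𝓝 (γ t), dist (γ t) x / 2 < dist y x :=
      (continuous_id.dist continuous_const).continuousAt.eventually_const_lt
        (show dist (γ t) x / 2 < dist (γ t) x by linarith)
    filter_upwards [this] with y hy
    change (ρ : Scalar (m + 2)) y * χ y = 0
    rw [χ.zero_of_le_dist hy.le, mul_zero]
  let f : Smooth (m + 2) := actS (microS b ρ' c) (c β)
  have hf : ∀ y, value (microAct b β) ρ' (fun α => c α) y = (f : Scalar (m + 2)) y :=
    congrFun (isValue_microAct b ρ' c β)
  have hd : ∀ s ∈ Set.Ioo (-ε) ε, HasDerivAt (fun s => (f : Scalar (m + 2)) (γ s)) 0 s :=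
    fun s hs => by
      refine ((differentiable_coe f (γ s)).hasFDerivAt.comp_hasDerivAt s (hγ s hs)).congr_deriv ?_
      rw [fderiv_eq_sum_pd]
      have := congrArg (evalAt (γ s)) (sum_namC_actS hb ρ' c i β)
      rw [map_sum, map_zero] at this
      simp only [map_mul] at this
      exact this
  have hconst : (f : Scalar (m + 2)) (γ 0) = (f : Scalar (m + 2)) (γ t) :=
    isOpen_Ioo.is_const_of_deriv_eq_zero isPreconnected_Ioo
      (fun s hs => (hd s hs).differentiableAt.differentiableWithinAt) (fun s hs => (hd s hs).deriv)
      h0ε ht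
  rw [← value_congr _ _ h1, hf, ← hγ0, hconst, ← hf, value_congr _ _ h2, microAct, value_sum,
    Finset.sum_apply]
  refine Finset.sum_eq_zero fun k _ => ?_
  rw [value_mul, value_micro_zero, zero_mul]; rfl

theorem actS_microS_eq_zero (ρ : Smooth (m + 2)) (c : Fin m → Smooth (m + 2)) (β : Fin m) :
    actS (microS b ρ c) (c β) = 0 := by
  refine Smooth.ext_eval fun x => ?_
  have h := value_eq_zero_of_generic c ρ (microAct b β) x fun c hc _ =>
    microAct_eq_zero_of_independent hb ρ c β x hc
  rw [isValue_microAct b ρ c β] at h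
  exact h

/-- Once Z annihilates the Casimirs, invariance of the bracket says that the density velocity times
N is zero, and N has a nonzero component at generic points. -/
theorem densS_microS_eq_zero (ρ : Smooth (m + 2)) (c : Fin m → Smooth (m + 2)) :
    densS (microS b ρ c) ρ = 0 := by
  refine Smooth.ext_eval fun x => ?_
  have h := value_eq_zero_of_generic c ρ (microDens b) x fun c hc _ => by
    obtain ⟨i, j, hij⟩ := exists_namC_ne_zero c x hc
    have h1 := hb ρ c i j
    simp only [actS_microS_eq_zero hb] at h1
    have h2 : ∀ α, namC (Function.update c α 0) i j = 0 := fun α => by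
      have := (lin_nam_update c α (unit i) (unit j)).map_smul 0 0
      rwa [zero_smul, zero_smul] at this
    simp only [h2, Finset.sum_const_zero, mul_zero] at h1
    have h3 := congrArg (evalAt x) h1
    rw [map_mul, map_zero] at h3
    rw [isValue_microDens b ρ c]
    exact (mul_eq_zero.1 h3).resolve_right hij
  rw [isValue_microDens b ρ c] at h
  exact h

end

end Rigidity

/-! ## The evolution of the density and the Casimirs -/

section Conclusion

variable {m n : ℕ}

theorem microS_sub (b b' : MicroGraph m n →₀ ℝ) (ρ : Smooth (m + 2)) (c : Fin m → Smooth (m + 2)) :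
    microS (b - b') ρ c = fun i => microS b ρ c i - microS b' ρ c i := by
  refine funext fun i => Smooth.ext_eval fun x => ?_
  rw [map_sub]
  change microField (b - b') _ _ i x = microField b _ _ i x - microField b' _ _ i x
  rw [microField_eq, microField_eq, microField_eq, map_sub]

theorem microS_trivialising (ρ : Smooth (m + 2)) (c : Fin m → Smooth (m + 2)) :
    microS (trivialising m) ρ c = trivS ρ c := funext fun i => Smooth.ext_eval fun x =>
  congrFun (congrFun (microField_trivialising_eq ρ c) i) x

theorem pdS_sub {d : ℕ} (k : Fin d) (f g : Smooth d) : pdS k (f - g) = pdS k f - pdS k g :=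
  map_sub ((lin_dir (unit k)).mk') f g

theorem divS_sub {d : ℕ} (X Y : Fin d → Smooth d) :
    divS (fun i => X i - Y i) = divS X - divS Y := by
  simp only [divS, pdS_sub, Finset.sum_sub_distrib]

theorem actS_sub {d : ℕ} (X Y : Fin d → Smooth d) (f : Smooth d) :
    actS (fun i => X i - Y i) f = actS X f - actS Y f := by
  simp only [actS, sub_mul, Finset.sum_sub_distrib]

theorem densS_sub {d : ℕ} (X Y : Fin d → Smooth d) (ρ : Smooth d) :
    densS (fun i => X i - Y i) ρ = densS X ρ - densS Y ρ := by
  rw [densS, divS_sub, actS_sub, densS, densS]; ring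

theorem namC_update_sub (c : Fin m → Smooth (m + 2)) (α : Fin m) (f g : Smooth (m + 2))
    (i j : Fin (m + 2)) : namC (Function.update c α (f - g)) i j
      = namC (Function.update c α f) i j - namC (Function.update c α g) i j :=
  map_sub ((lin_nam_update c α (unit i) (unit j)).mk') f g

variable (hm : m = 1 ∨ m = 2) {b : MicroGraph m 3 →₀ ℝ} (hb : Trivialises b)
include hm hb

theorem lie_microS_sub (ρ : Smooth (m + 2)) (c : Fin m → Smooth (m + 2)) (i j : Fin (m + 2)) :
    densS (microS (b - trivialising m) ρ c) ρ * namC c i j = ρ * ∑ α, namC (Function.update c α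
      (actS (microS (b - trivialising m) ρ c) (c α))) i j := by
  have h : ∀ b : MicroGraph m 3 →₀ ℝ, Trivialises b → ∀ x,
      tetraFlow (nambuBivector (ρ : Scalar (m + 2)) (fun α => c α)) [i, j] x
        = evalAt x (densS (microS b ρ c) ρ * namC c i j
          - ρ * ∑ α, namC (Function.update c α (actS (microS b ρ c) (c α))) i j) := fun b hb x => by
    rw [← schouten_nambu]
    exact hb ρ (fun α => c α) (contDiff_coe ρ) (fun α => contDiff_coe (c α)) i j x
  have h1 := Smooth.ext_eval fun x =>
    (h b hb x).symm.trans (h _ (trivialises_trivialising hm) x)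
  rw [microS_sub, densS_sub]
  simp only [actS_sub, namC_update_sub, Finset.sum_sub_distrib]
  linear_combination h1

theorem actS_microS (ρ : Smooth (m + 2)) (c : Fin m → Smooth (m + 2)) (α : Fin m) :
    actS (microS b ρ c) (c α) = actS (trivS ρ c) (c α) := by
  have h := actS_microS_eq_zero (lie_microS_sub hm hb) ρ c α
  rw [microS_sub, actS_sub, microS_trivialising] at h
  exact sub_eq_zero.1 h

theorem densS_microS (ρ : Smooth (m + 2)) (c : Fin m → Smooth (m + 2)) :
    densS (microS b ρ c) ρ = densS (trivS ρ c) ρ := by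
  have h := densS_microS_eq_zero (lie_microS_sub hm hb) ρ c
  rw [microS_sub, densS_sub, microS_trivialising] at h
  exact sub_eq_zero.1 h

theorem casimirVelocity_eq_act (ρ : Smooth (m + 2)) (c : Fin m → Smooth (m + 2)) (α : Fin m) :
    casimirVelocity (nambuBivector (ρ : Scalar (m + 2)) (fun α => c α)) (c α)
      = VField.act (-microField b ρ fun α => c α) (c α) := by
  funext x
  rw [casimirVelocity_trivS ρ c hm, ← actS_microS hm hb, ← coe_actS, VField.act, VField.act,
    ← Finset.sum_neg_distrib]
  exact Finset.sum_congr rfl fun i _ => (neg_mul _ _).symm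

theorem topField_densityVelocity (ρ : Smooth (m + 2)) (c : Fin m → Smooth (m + 2)) :
    topField ((densityVelocity m).value ρ fun α => c α)
      = schouten (topField (ρ : Scalar (m + 2))) (microField b ρ fun α => c α) := by
  funext I
  rw [schouten_topField _ (differentiable_coe ρ), isValue_densityVelocity ρ c,
    ← densS_microS hm hb]
  congr 1
  funext x
  have := coe_actS (microS b ρ c) ρ x
  rw [← evalAt_apply, densS, map_sub, map_mul, ← this, divS, map_sum]
  rfl

end Conclusion

end NambuFlow

end

theorem mainTheorem4 :
    -- along any vector field `Y = -X`, functions and `d`-vectors evolve as in the standard law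
    (∀ (d : ℕ), 3 ≤ d → ∀ (X : NambuFlow.VField d) (ϱ a : NambuFlow.Scalar d),
      (∀ i, ContDiff ℝ ∞ (X i)) → ContDiff ℝ ∞ ϱ → ContDiff ℝ ∞ a →
      ∀ (x : NambuFlow.Space d) (Φ : ℝ → NambuFlow.Space d → NambuFlow.Space d),
        ContDiffAt ℝ ∞ (Function.uncurry Φ) (0, x) →
        (∀ᶠ y in 𝓝 x, Φ 0 y = y) →
        (∀ᶠ y in 𝓝 x, HasDerivAt (fun ε => Φ ε y) (fun i => -X i y) 0) →
        HasDerivAt (fun ε => a (Φ ε x)) (NambuFlow.VField.act (-X) a x) 0 ∧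
        ∀ I : List (Fin d),
          HasDerivAt (fun ε => NambuFlow.pullback (Φ ε) (NambuFlow.topField ϱ) I x)
            (NambuFlow.schouten (NambuFlow.topField ϱ) X I x) 0) ∧
    -- the tetrahedral flow of Nambu brackets over `ℝ³` and `ℝ⁴`
    (∀ m : ℕ, m = 1 ∨ m = 2 →
      ∃ R : NambuFlow.DiffPoly m, NambuFlow.IsDensityVelocity R ∧
        (∃ c : NambuFlow.MicroGraph m 3 →₀ ℝ, NambuFlow.Trivialises c) ∧
        ∀ c : NambuFlow.MicroGraph m 3 →₀ ℝ, NambuFlow.Trivialises c →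
          ∀ (ϱ : NambuFlow.Scalar (m + 2)) (a : Fin m → NambuFlow.Scalar (m + 2)),
            ContDiff ℝ ∞ ϱ → (∀ i, ContDiff ℝ ∞ (a i)) →
            (∀ i, NambuFlow.casimirVelocity (NambuFlow.nambuBivector ϱ a) (a i)
              = NambuFlow.VField.act (-NambuFlow.microField c ϱ a) (a i)) ∧
            NambuFlow.topField (R.value ϱ a)
              = NambuFlow.schouten (NambuFlow.topField ϱ) (NambuFlow.microField c ϱ a)) := by
  refine ⟨fun d _ X ϱ a _ hϱ ha x Φ hΦ h0 hv =>
    ⟨NambuFlow.hasDerivAt_comp_flow ha h0.self_of_nhds hv.self_of_nhds,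
      NambuFlow.hasDerivAt_pullback_topField hϱ hΦ h0 hv⟩, fun m hm =>
    ⟨NambuFlow.densityVelocity m, NambuFlow.isDensityVelocity hm,
      ⟨NambuFlow.trivialising m, NambuFlow.trivialises_trivialising hm⟩,
      fun c hc ϱ a hϱ ha => ⟨fun i => ?_, ?_⟩⟩⟩
  · exact NambuFlow.casimirVelocity_eq_act hm hc ⟨ϱ, hϱ⟩ (fun α => ⟨a α, ha α⟩) i
  · exact NambuFlow.topField_densityVelocity hm hc ⟨ϱ, hϱ⟩ fun α => ⟨a α, ha α⟩
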